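/- **Setting.** An instance of the weighted Nash Social Welfare problem consists of a finite set $\mathcal A$ of $n$ agents, a finite set $\mathcal G$ of items, values $v_{ij}\ge 0$ and weights $w_i\ge 0$ ($i\in\mathcal A$, $j\in\mathcal G$) with $\sum_i w_i=1$. Put $\log 0=-\infty$, $0\cdot\log 0=0$. For an assignment $\sigma:\mathcal G\to\mathcal A$ let $$\mathrm{NSW}(\sigma)=\sum_{i} w_i\log\Big(\sum_{j\in\sigma^{-1}(i)}v_{ij}\Big).$$ Let $\mathcal P$ be the set of $b\in\mathbb R_{\ge0}^{\mathcal A\times\mathcal G}$ with $\sum_j b_{ij}=1$ for all $i$ and $\sum_i b_{ij}\le 1$ for all $j$. For $b\in\mathcal P$ let $$f_{\mathrm{cvx}}(b)=\sum_{i,j}w_ib_{ij}\log v_{ij}-\sum_{j}\sum_i w_ib_{ij}\log\Big(\sum_{i'}w_{i'}b_{i'j}\Big)+\sum_i w_i\log w_i ,$$ and let the support graph of $b$ be the bipartite graph on $\mathcal A\sqcup\mathcal G$ with an edge $ij$ iff $b_{ij}>0$. Let $D_{\mathrm{KL}}(w\|u)=\sum_i w_i\log(n w_i)$, where $u$ is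 the uniform distribution on $\mathcal A$. **Rounding algorithm.** Input: an instance and a point $b\in\mathcal P$ whose support graph is a forest. 1. Let $b^\star$ maximize $f_{\mathrm{cvx}}$ over the points of $\mathcal P$ whose support is contained in the support of $b$, and let $q^\star_j=\sum_i b^\star_{ij}$. 2. Let $F^\star$ be the support graph of $b^\star$, every tree (other than an isolated item) rooted at an agent. Remove the edges between $j$ and its children for every item $j$ with $q_j^\star<1/2$; call the result $\widetilde F$. 3. Let $L_i$ be the set of the items that are leaves of $\widetilde F$ and children of agent $i$, and let $L=\bigcup_i L_i$. Among the matchings $M$ in $\widetilde F$ between $\mathcal A$ and $\mathcal G\setminus L$ choose one that maximizes $\sum_i w_i\log\big(v_{iM(i)}+\sum_{j\in L_i}v_{ij}\big)$, where $v_{iM(i)}=0$ if $i$ is unmatched. 4. Output an assignment $\sigma$ with $\sigma(j)=i$ whenever $j\in L_i$ or $j=M(i)$; the remaining items are assigned arbitrarily. **Theorem.** For every instance and every $b\in\mathcal P$ whose support graph is a forest: (a) The rounding algorithm has an output, and every output $\sigma$ (whatever the choices of $b^\star$, the roots, $M$ and the owners of the remaining items) satisfies $$\mathrm{NSW}(\sigma)\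 \ge\ f_{\mathrm{cvx}}(b)-D_{\mathrm{KL}}(w\|u)-2\log 2-\frac1{2e}.\qquad(*)$$ (b) An assignment satisfying $(*)$ can be found in deterministic polynomial time: there are one deterministic program (for a random access machine with logarithmic cost) and one polynomial $p$ such that for all rational $v$, $w$, $b$ as above, given in binary, the program halts after at most $p(\text{bit length of the input})$ steps and outputs an assignment $\sigma$ that satisfies $(*)$. -/

import Mathlib

namespace NashWelfare

/-! ### Nash social welfare, the feasibility polytope and the convex objective -/

section Welfare

variable {A G : Type*} [Fintype A] [Fintype G]

/-- The logarithm of a nonnegative real, with `log 0 = -∞`. In `EReal` one has `0 * (-∞) = 0`. -/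
noncomputable def elog (x : ℝ) : EReal := ENNReal.log (ENNReal.ofReal x)

/-- `NSW(σ) = ∑ i, w i * log (∑ j ∈ σ⁻¹(i), v i j)`, with values in `[-∞, ∞)`. -/
noncomputable def NSW (v : A → G → ℝ) (w : A → ℝ) (σ : G → A) : EReal :=
  ∑ i, (w i : EReal) * elog (∑ j, (σ ⁻¹' {i}).indicator (v i) j)

/-- The feasibility polytope: every agent constraint is tight, every item constraint holds. -/
def feasible (A G : Type*) [Fintype A] [Fintype G] : Set (A → G → ℝ) :=
  {b | (∀ i j, 0 ≤ b i j) ∧ (∀ i, ∑ j, b i j = 1) ∧ (∀ j, ∑ i, b i j ≤ 1)}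

/-- The objective of the convex relaxation, with values in `[-∞, ∞)`. The value `-∞` is attained
exactly when `w i * b i j > 0` and `v i j = 0` for some pair; `0 * log 0` is `0` throughout. -/
noncomputable def fcvx (v : A → G → ℝ) (w : A → ℝ) (b : A → G → ℝ) : EReal :=
  (∑ i, ∑ j, ((w i * b i j : ℝ) : EReal) * elog (v i j))
    + ((-(∑ j, ∑ i, w i * b i j * Real.log (∑ i', w i' * b i' j))
        + ∑ i, w i * Real.log (w i) : ℝ) : EReal)

/-- The Kullback-Leibler divergence `∑ i, w i * log (w i / u i)` from `w` to the uniform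
distribution `u` on the agents. -/
noncomputable def klUniform (w : A → ℝ) : ℝ :=
  ∑ i, w i * Real.log (w i / (1 / (Fintype.card A : ℝ)))

/-- The additive guarantee of the rounding: `NSW(σ) ≥ f(b) - D(w ‖ u) - 2 log 2 - 1 / (2 e)`. -/
def Guarantee (v : A → G → ℝ) (w : A → ℝ) (b : A → G → ℝ) (σ : G → A) : Prop :=
  fcvx v w b - ((klUniform w + 2 * Real.log 2 + 1 / (2 * Real.exp 1) : ℝ) : EReal) ≤ NSW v w σ

/-- The bipartite support graph on agents and items: `i` and `j` are joined iff `b i j > 0`. -/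
def supportGraph {A G : Type*} (b : A → G → ℝ) : SimpleGraph (A ⊕ G) where
  Adj x y := (∃ i j, 0 < b i j ∧ x = Sum.inl i ∧ y = Sum.inr j) ∨
    (∃ i j, 0 < b i j ∧ x = Sum.inr j ∧ y = Sum.inl i)
  symm := ⟨by
    rintro x y (⟨i, j, h, hx, hy⟩ | ⟨i, j, h, hx, hy⟩)
    · exact Or.inr ⟨i, j, h, hy, hx⟩
    · exact Or.inl ⟨i, j, h, hy, hx⟩⟩
  loopless := ⟨by
    rintro x (⟨i, j, _, hx, hy⟩ | ⟨i, j, _, hx, hy⟩) <;> simp [hx] at hy⟩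

end Welfare

/-! ### The rounding algorithm -/

section Rounding

variable {A G : Type*} [Fintype A] [Fintype G]

/-- `bs` is an optimal solution of the convex relaxation among the feasible points whose support
is contained in that of `b`. -/
def IsRestrictedOptimum (v : A → G → ℝ) (w : A → ℝ) (b bs : A → G → ℝ) : Prop :=
  IsMaxOn (fcvx v w) {c | c ∈ feasible A G ∧ ∀ i j, b i j = 0 → c i j = 0} bs ∧
    bs ∈ feasible A G ∧ ∀ i j, b i j = 0 → bs i j = 0

/-- `root i` is an agent chosen as the root of the tree that contains agent `i`, the same one for
all agents of the tree. (A tree without agents is a single isolated item.) -/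
def IsRooting {A G : Type*} (H : SimpleGraph (A ⊕ G)) (root : A → A) : Prop :=
  (∀ i, H.Reachable (Sum.inl i) (Sum.inl (root i))) ∧
    ∀ i i', H.Reachable (Sum.inl i) (Sum.inl i') → root i = root i'

/-- Item `j` is a child of agent `i` in the rooted forest. -/
def IsItemChild {A G : Type*} (H : SimpleGraph (A ⊕ G)) (root : A → A) (i : A) (j : G) : Prop :=
  H.Adj (Sum.inl i) (Sum.inr j) ∧
    H.dist (Sum.inl (root i)) (Sum.inl i) < H.dist (Sum.inl (root i)) (Sum.inr j)

/-- Agent `i` is a child of item `j` in the rooted forest. -/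
def IsAgentChild {A G : Type*} (H : SimpleGraph (A ⊕ G)) (root : A → A) (j : G) (i : A) : Prop :=
  H.Adj (Sum.inl i) (Sum.inr j) ∧
    H.dist (Sum.inl (root i)) (Sum.inr j) < H.dist (Sum.inl (root i)) (Sum.inl i)

/-- The pruned forest: the edges between an item `j` and its children are removed whenever
`∑ i, bs i j < 1 / 2`. -/
def prunedForest (bs : A → G → ℝ) (root : A → A) : SimpleGraph (A ⊕ G) :=
  (supportGraph bs).deleteEdges
    {e | ∃ i j, ∑ k, bs k j < 1 / 2 ∧ IsAgentChild (supportGraph bs) root j i ∧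
      e = s(Sum.inl i, Sum.inr j)}

/-- The leaf items of the pruned forest that are children of agent `i`. -/
def leafItems (bs : A → G → ℝ) (root : A → A) (i : A) : Set G :=
  {j | (prunedForest bs root).Adj (Sum.inl i) (Sum.inr j) ∧
    IsItemChild (supportGraph bs) root i j ∧
    ∀ i', (prunedForest bs root).Adj (Sum.inl i') (Sum.inr j) → i' = i}

/-- `M` is a matching, inside the pruned forest, between agents and items that are not leaves;
`M i = none` means that agent `i` is unmatched. -/
def IsPrunedMatching (bs : A → G → ℝ) (root : A → A) (M : A → Option G) : Prop :=
  (∀ i j, M i = some j → (prunedForest bs root).Adj (Sum.inl i) (Sum.inr j) ∧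
    ∀ i', j ∉ leafItems bs root i') ∧
  ∀ i i' j, M i = some j → M i' = some j → i = i'

/-- The augmented weight `∑ i, w i * log (v i (M i) + ∑ j ∈ L i, v i j)` of a matching, where
`v i (M i)` is `0` if `i` is unmatched. -/
noncomputable def matchingWeight (v : A → G → ℝ) (w : A → ℝ) (bs : A → G → ℝ) (root : A → A)
    (M : A → Option G) : EReal :=
  ∑ i, (w i : EReal) *
    elog ((M i).elim 0 (v i) + ∑ j, (leafItems bs root i).indicator (v i) j)

/-- `σ` is an output of the rounding algorithm on the instance `(v, w)` and the acyclic solution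
`b`, for some choice of the optimum, of the roots, of the maximum weight matching, and of the
owners of the items that are neither leaves nor matched. -/
def IsRoundingOutput (v : A → G → ℝ) (w : A → ℝ) (b : A → G → ℝ) (σ : G → A) : Prop :=
  ∃ (bs : A → G → ℝ) (root : A → A) (M : A → Option G),
    IsRestrictedOptimum v w b bs ∧
    IsRooting (supportGraph bs) root ∧
    IsPrunedMatching bs root M ∧
    (∀ M', IsPrunedMatching bs root M' →
      matchingWeight v w bs root M' ≤ matchingWeight v w bs root M) ∧
    (∀ i j, j ∈ leafItems bs root i → σ j = i) ∧
    (∀ i j, M i = some j → σ j = i)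

end Rounding

/-! ### Random access machines with logarithmic cost

Structured programs on a memory `ℕ → ℕ` of cells that hold natural numbers. Every operation is
charged the bit lengths of the numbers and addresses that it touches, so that polynomial time
in this model is polynomial time on Turing machines. -/

namespace RAM

/-- The contents of the memory. -/
abbrev Memory := ℕ → ℕ

/-- Binary arithmetic operations; subtraction is truncated, division is rounded down. -/
inductive Op
  | add | sub | mul | div

/-- The value of an operation. -/
def Op.eval : Op → ℕ → ℕ → ℕ
  | .add, x, y => x + y
  | .sub, x, y => x - y
  | .mul, x, y => x * y
  | .div, x, y => x / y

/-- Expressions: constants, the content of a cell whose address is computed, and arithmetic. -/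
inductive Exp
  | const (n : ℕ)
  | load (a : Exp)
  | bin (o : Op) (x y : Exp)

/-- The value of an expression. -/
def Exp.eval (M : Memory) : Exp → ℕ
  | .const n => n
  | .load a => M (a.eval M)
  | .bin o x y => o.eval (x.eval M) (y.eval M)

/-- The number of steps needed to evaluate an expression; `Nat.size` is the bit length. -/
def Exp.cost (M : Memory) : Exp → ℕ
  | .const n => n.size + 1
  | .load a => a.cost M + (a.eval M).size + (M (a.eval M)).size + 1
  | .bin o x y => x.cost M + y.cost M + (x.eval M).size + (y.eval M).size
      + (o.eval (x.eval M) (y.eval M)).size + 1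

/-- Programs. A condition holds if its value is not zero. -/
inductive Prog
  | skip
  | store (a e : Exp)
  | seq (p q : Prog)
  | cond (e : Exp) (p q : Prog)
  | loop (e : Exp) (p : Prog)

/-- `Runs p M M' t`: started with memory `M`, the program `p` halts after `t` steps with memory
`M'`. -/
inductive Runs : Prog → Memory → Memory → ℕ → Prop
  | skip (M : Memory) : Runs .skip M M 1
  | store (a e : Exp) (M : Memory) :
      Runs (.store a e) M (Function.update M (a.eval M) (e.eval M))
        (a.cost M + e.cost M + (a.eval M).size + (e.eval M).size + 1)
  | seq {p q : Prog} {M₁ M₂ M₃ : Memory} {s t : ℕ} (hp : Runs p M₁ M₂ s) (hq : Runs q M₂ M₃ t) :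
      Runs (.seq p q) M₁ M₃ (s + t + 1)
  | condTrue {e : Exp} {p q : Prog} {M M' : Memory} {t : ℕ} (he : e.eval M ≠ 0)
      (hp : Runs p M M' t) : Runs (.cond e p q) M M' (e.cost M + t + 1)
  | condFalse {e : Exp} {p q : Prog} {M M' : Memory} {t : ℕ} (he : e.eval M = 0)
      (hq : Runs q M M' t) : Runs (.cond e p q) M M' (e.cost M + t + 1)
  | loopStep {e : Exp} {p : Prog} {M₁ M₂ M₃ : Memory} {s t : ℕ} (he : e.eval M₁ ≠ 0)
      (hp : Runs p M₁ M₂ s) (hl : Runs (.loop e p) M₂ M₃ t) :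
      Runs (.loop e p) M₁ M₃ (e.cost M₁ + s + t + 1)
  | loopStop {e : Exp} {p : Prog} {M : Memory} (he : e.eval M = 0) :
      Runs (.loop e p) M M (e.cost M + 1)

/-- Programs are deterministic: the final memory and the number of steps are unique. -/
theorem Runs.unique {p : Prog} {M M₁ M₂ : Memory} {s t : ℕ} (h₁ : Runs p M M₁ s)
    (h₂ : Runs p M M₂ t) : M₁ = M₂ ∧ s = t := by
  induction h₁ generalizing M₂ t with
  | skip | store => cases h₂; exact ⟨rfl, rfl⟩
  | seq _ _ ihp ihq =>
    cases h₂ with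
    | seq hp hq =>
      obtain ⟨rfl, rfl⟩ := ihp hp
      obtain ⟨rfl, rfl⟩ := ihq hq
      exact ⟨rfl, rfl⟩
  | condTrue he _ ih =>
    cases h₂ with
    | condTrue _ h => obtain ⟨rfl, rfl⟩ := ih h; exact ⟨rfl, rfl⟩
    | condFalse he' _ => exact absurd he' he
  | condFalse he _ ih =>
    cases h₂ with
    | condTrue he' _ => exact absurd he he'
    | condFalse _ h => obtain ⟨rfl, rfl⟩ := ih h; exact ⟨rfl, rfl⟩
  | loopStep he _ _ ihp ihl =>
    cases h₂ with
    | loopStep _ hp hl =>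
      obtain ⟨rfl, rfl⟩ := ihp hp
      obtain ⟨rfl, rfl⟩ := ihl hl
      exact ⟨rfl, rfl⟩
    | loopStop he' => exact absurd he' he
  | loopStop he =>
    cases h₂ with
    | loopStep he' _ _ => exact absurd he he'
    | loopStop _ => exact ⟨rfl, rfl⟩

/-- The initial memory: the input in the first cells, zeros elsewhere. -/
def initial (input : List ℕ) : Memory := fun a => input.getD a 0

/-- The bit length of an input. -/
def inputSize (input : List ℕ) : ℕ := (input.map fun x => x.size + 1).sum

end RAM

/-- The encoding of a nonnegative rational by its numerator and denominator. -/
def encodeRat (q : ℚ≥0) : List ℕ := [q.num, q.den]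

/-- The encoding of a matrix, row by row. -/
def encodeMatrix {n m : ℕ} (c : Fin n → Fin m → ℚ≥0) : List ℕ :=
  (List.finRange n).flatMap fun i => (List.finRange m).flatMap fun j => encodeRat (c i j)

/-- The encoding of an instance together with a fractional solution. -/
def encodeInput {n m : ℕ} (v : Fin n → Fin m → ℚ≥0) (w : Fin n → ℚ≥0)
    (b : Fin n → Fin m → ℚ≥0) : List ℕ :=
  [n, m] ++ encodeMatrix v ++ ((List.finRange n).flatMap fun i => encodeRat (w i)) ++
    encodeMatrix b

end NashWelfare

namespace NashWelfare

section Matching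

variable {A G : Type*} [Fintype A] [Fintype G]

/-- Integrality of the bipartite matching polytope: a fractional matching, in which agent `i` is
left unmatched to the extent `u i`, is dominated by an integral one in its support. -/
theorem exists_matching_ge (x : A → G → ℝ) (u : A → ℝ) (hx : ∀ i j, 0 ≤ x i j)
    (hu : ∀ i, 0 ≤ u i) (hrow : ∀ i, ∑ j, x i j + u i = 1) (hcol : ∀ j, ∑ i, x i j ≤ 1)
    (α : A → G → ℝ) (β : A → ℝ) :
    ∃ M : A → Option G, (∀ i j, M i = some j → 0 < x i j) ∧ (∀ i, M i = none → 0 < u i) ∧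
      (∀ i i' j, M i = some j → M i' = some j → i = i') ∧
      ∑ i, ∑ j, x i j * α i j + ∑ i, u i * β i ≤ ∑ i, (M i).elim (β i) (α i) := by
  classical
  let D : Matrix (A ⊕ G) (A ⊕ G) ℝ := Matrix.fromBlocks (Matrix.diagonal u) (Matrix.of x)
    (Matrix.of x).transpose (Matrix.diagonal fun j => 1 - ∑ i, x i j)
  have hD : D ∈ doublyStochastic ℝ (A ⊕ G) := by
    rw [mem_doublyStochastic_iff_sum]
    refine ⟨?_, ?_, ?_⟩
    · rintro (i | j) (i' | j') <;> simp only [D, Matrix.fromBlocks_apply₁₁,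
        Matrix.fromBlocks_apply₁₂, Matrix.fromBlocks_apply₂₁, Matrix.fromBlocks_apply₂₂,
        Matrix.diagonal_apply, Matrix.of_apply, Matrix.transpose_apply]
      · split_ifs <;> simp [hu]
      · exact hx _ _
      · exact hx _ _
      · split_ifs
        · linarith [hcol j]
        · exact le_rfl
    · rintro (i | j) <;> simp [D, Matrix.diagonal_apply]
      linarith [hrow i]
    · rintro (i | j) <;> simp [D, Matrix.diagonal_apply]
      linarith [hrow i]
  obtain ⟨c, hc0, hc1, hc⟩ := exists_eq_sum_perm_of_mem_doublyStochastic hD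
  let W : A ⊕ G → A ⊕ G → ℝ := fun a y => Sum.elim (fun i => Sum.elim (fun _ => β i) (α i) y)
    (fun _ => 0) a
  have hDW : ∑ a, ∑ y, D a y * W a y = ∑ σ, c σ * ∑ a, W a (σ a) := by
    rw [← hc]
    simp only [Matrix.sum_apply, Matrix.smul_apply, smul_eq_mul, Finset.sum_mul, Finset.mul_sum]
    rw [Finset.sum_congr rfl fun a _ => Finset.sum_comm, Finset.sum_comm]
    refine Finset.sum_congr rfl fun σ _ => Finset.sum_congr rfl fun a _ => ?_
    simp [Equiv.Perm.permMatrix, PEquiv.toMatrix_apply, Equiv.toPEquiv_apply]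
  have hval : ∑ a, ∑ y, D a y * W a y = ∑ i, ∑ j, x i j * α i j + ∑ i, u i * β i := by
    simp [D, W, Matrix.diagonal_apply, Finset.sum_add_distrib, add_comm]
  have hex : ∃ σ, 0 < c σ ∧ ∑ i, ∑ j, x i j * α i j + ∑ i, u i * β i ≤ ∑ a, W a (σ a) := by
    by_contra! hcon
    have hpos : ∃ σ ∈ Finset.univ, 0 < c σ := by
      by_contra! h
      have : ∑ σ, c σ ≤ 0 := Finset.sum_nonpos h
      linarith
    obtain ⟨σ₀, _, hσ₀⟩ := hpos
    have : ∑ σ, c σ * ∑ a, W a (σ a)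
        < ∑ σ, c σ * (∑ i, ∑ j, x i j * α i j + ∑ i, u i * β i) := by
      refine Finset.sum_lt_sum (fun σ _ => ?_) ⟨σ₀, Finset.mem_univ _, ?_⟩
      · rcases (hc0 σ).eq_or_lt with h | h
        · simp [← h]
        · exact mul_le_mul_of_nonneg_left (hcon σ h).le h.le
      · exact mul_lt_mul_of_pos_left (hcon σ₀ hσ₀) hσ₀
    rw [← Finset.sum_mul, hc1, one_mul, ← hDW, hval] at this
    exact lt_irrefl _ this
  obtain ⟨σ, hσ, hle⟩ := hex
  have hsupp : ∀ a, 0 < D a (σ a) := by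
    intro a
    have h1 : c σ * (σ.permMatrix ℝ) a (σ a) ≤ D a (σ a) := by
      rw [← hc]
      simp only [Matrix.sum_apply, Matrix.smul_apply, smul_eq_mul]
      refine Finset.single_le_sum (f := fun τ : Equiv.Perm (A ⊕ G) =>
        c τ * (τ.permMatrix ℝ) a (σ a)) (fun τ _ => mul_nonneg (hc0 τ) ?_) (Finset.mem_univ σ)
      simp only [Equiv.Perm.permMatrix, PEquiv.toMatrix_apply]
      split_ifs <;> simp
    refine lt_of_lt_of_le ?_ h1
    simpa [Equiv.Perm.permMatrix, PEquiv.toMatrix_apply, Equiv.toPEquiv_apply] using hσ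
  have hM : ∀ i j, (σ (Sum.inl i)).getRight? = some j → σ (Sum.inl i) = Sum.inr j := by
    intro i j h
    simpa using h
  refine ⟨fun i => (σ (Sum.inl i)).getRight?, ?_, ?_, ?_, hle.trans (le_of_eq ?_)⟩
  · intro i j h
    have := hsupp (Sum.inl i)
    rw [hM i j h] at this
    simpa [D] using this
  · intro i h
    have := hsupp (Sum.inl i)
    rcases hy : σ (Sum.inl i) with i' | j
    · rw [hy] at this
      simp only [D, Matrix.fromBlocks_apply₁₁, Matrix.diagonal_apply] at this
      split_ifs at this
      · exact this
      · exact absurd this (lt_irrefl _)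
    · simp [hy] at h
  · intro i i' j h h'
    exact Sum.inl_injective (σ.injective ((hM i j h).trans (hM i' j h').symm))
  · simp only [W, Fintype.sum_sum_type, Sum.elim_inl, Sum.elim_inr, Finset.sum_const_zero,
      add_zero]
    refine Finset.sum_congr rfl fun i _ => ?_
    rcases σ (Sum.inl i) with i' | j <;> simp

/-- A fractional assignment `x`, at most `s` times `b`, of nonleaf items `N` and of leaf items
`L i` owned by the agents can be rounded to a matching of the nonleaf items. The loss is the
entropy of at most `2n` atoms and `log s`. -/
theorem exists_matching_log_ge [Nonempty A] (v : A → G → ℝ) (w : A → ℝ) (b x : A → G → ℝ) (s : ℝ)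
    (N : Finset G) (L : A → Finset G) (hv : ∀ i j, 0 ≤ v i j) (hw : ∀ i, 0 ≤ w i)
    (hw1 : ∑ i, w i = 1) (hb : ∀ i j, 0 ≤ b i j) (hx : ∀ i j, 0 ≤ x i j) (hs : 0 < s)
    (hxb : ∀ i j, x i j ≤ s * b i j) (hrow : ∀ i, ∑ j, x i j = 1)
    (hcol : ∀ j ∈ N, ∑ i, x i j ≤ 1) (hN : N.card ≤ Fintype.card A)
    (hsplit : ∀ i j, 0 < x i j → j ∈ N ∨ j ∈ L i) (hLN : ∀ i, ∀ j ∈ L i, j ∉ N)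
    (hpos : ∀ i j, 0 < w i → 0 < x i j → 0 < v i j) :
    ∃ M : A → Option G, (∀ i j, M i = some j → 0 < x i j ∧ j ∈ N) ∧
      (∀ i i' j, M i = some j → M i' = some j → i = i') ∧
      (∀ i, 0 < w i → 0 < (M i).elim 0 (v i) + ∑ j ∈ L i, v i j) ∧
      ∑ i, ∑ j, w i * x i j * (Real.log (v i j) - Real.log (∑ i', w i' * b i' j))
        - Real.log (2 * Fintype.card A * s)
        ≤ ∑ i, w i * Real.log ((M i).elim 0 (v i) + ∑ j ∈ L i, v i j) := by
  classical
  set V : A → ℝ := fun i => ∑ j ∈ L i, v i j with hV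
  set p : G → ℝ := fun j => ∑ i', w i' * b i' j with hp
  have hV0 : ∀ i, 0 ≤ V i := fun i => Finset.sum_nonneg fun j _ => hv i j
  have hp0 : ∀ j, 0 ≤ p j := fun j => Finset.sum_nonneg fun i _ => mul_nonneg (hw i) (hb i j)
  have hwp : ∀ i j, w i * x i j ≤ s * p j := by
    intro i j
    have h1 : w i * b i j ≤ p j :=
      Finset.single_le_sum (f := fun i => w i * b i j) (fun i _ => mul_nonneg (hw i) (hb i j))
        (Finset.mem_univ i)
    have h2 := mul_le_mul_of_nonneg_left (hxb i j) (hw i)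
    have h3 := mul_le_mul_of_nonneg_left h1 hs.le
    linarith
  obtain ⟨M, hM1, hM2, hM3, hM4⟩ := exists_matching_ge (fun i j => if j ∈ N then x i j else 0)
    (fun i => ∑ j, if j ∈ N then 0 else x i j)
    (fun i j => by split_ifs; exacts [hx i j, le_rfl])
    (fun i => Finset.sum_nonneg fun j _ => by split_ifs; exacts [le_rfl, hx i j])
    (fun i => by
      rw [← Finset.sum_add_distrib, ← hrow i]
      exact Finset.sum_congr rfl fun j _ => by split_ifs <;> simp)
    (fun j => by
      by_cases hj : j ∈ N
      · simpa [hj] using hcol j hj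
      · simp [hj])
    (fun i j => w i * Real.log (v i j)) (fun i => w i * Real.log (V i))
  have hsome : ∀ i j, M i = some j → 0 < x i j ∧ j ∈ N := by
    intro i j h
    have := hM1 i j h
    split_ifs at this with hj
    exacts [⟨this, hj⟩, absurd this (lt_irrefl _)]
  have hVpos : ∀ i j, 0 < w i → 0 < x i j → j ∉ N → 0 < V i := by
    intro i j hwi hxij hj
    have hjL := (hsplit i j hxij).resolve_left hj
    exact lt_of_lt_of_le (hpos i j hwi hxij)
      (Finset.single_le_sum (f := v i) (fun j _ => hv i j) hjL)
  refine ⟨M, hsome, hM3, ?_, ?_⟩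
  · intro i hwi
    rcases hMi : M i with _ | j
    · have := hM2 i hMi
      obtain ⟨j, _, hj⟩ := Finset.exists_lt_of_sum_lt
        (f := fun _ => (0 : ℝ)) (g := fun j => if j ∈ N then 0 else x i j) (by simpa using this)
      split_ifs at hj with hjN
      · exact absurd hj (lt_irrefl _)
      · simpa using hVpos i j hwi hj hjN
    · have := hpos i j hwi (hsome i j hMi).1
      simpa using add_pos_of_pos_of_nonneg this (hV0 i)
  · have hmono : ∑ i, (M i).elim (w i * Real.log (V i)) (fun j => w i * Real.log (v i j))
        ≤ ∑ i, w i * Real.log ((M i).elim 0 (v i) + V i) := by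
      refine Finset.sum_le_sum fun i _ => ?_
      rcases hMi : M i with _ | j
      · simp
      · simp only [Option.elim_some]
        rcases (hw i).eq_or_lt with h | h
        · simp [← h]
        · exact mul_le_mul_of_nonneg_left (Real.log_le_log (hpos i j h (hsome i j hMi).1)
            (by linarith [hV0 i])) h.le
    refine le_trans ?_ (hM4.trans hmono)
    have hn : (0 : ℝ) < Fintype.card A := by exact_mod_cast Fintype.card_pos
    set K : ℝ := 2 * Fintype.card A * s with hK
    have hK0 : 0 < K := by positivity
    have hsum1 : ∑ i, ∑ j, w i * x i j = 1 := by
      simp_rw [← Finset.mul_sum, hrow, mul_one, hw1]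
    have hterm : ∀ i j, w i * x i j * (Real.log (v i j) - Real.log (p j)) - w i * x i j * Real.log K
        ≤ (if j ∈ N then x i j else 0) * (w i * Real.log (v i j))
          + (if j ∈ N then 0 else x i j) * (w i * Real.log (V i))
          + (((if j ∈ N then w i * x i j / (K * p j) else 0)
          + (if j ∈ L i then w i * x i j * (v i j / (V i * p j * K)) else 0)) - w i * x i j) := by
      intro i j
      rcases (mul_nonneg (hw i) (hx i j)).eq_or_lt with h0 | h0
      · have h1 : (if j ∈ N then x i j else 0) * (w i * Real.log (v i j)) = 0 := by
          split_ifs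
          · rw [← mul_assoc, mul_comm (x i j), ← h0, zero_mul]
          · simp
        have h2 : (if j ∈ N then 0 else x i j) * (w i * Real.log (V i)) = 0 := by
          split_ifs
          · simp
          · rw [← mul_assoc, mul_comm (x i j), ← h0, zero_mul]
        rw [h1, h2, ← h0]
        simp
      · have hwi : 0 < w i := (hw i).lt_of_ne fun h => by simp [← h] at h0
        have hxi : 0 < x i j := (hx i j).lt_of_ne fun h => by simp [← h] at h0
        have hvi := hpos i j hwi hxi
        have hpj : 0 < p j := pos_of_mul_pos_right (lt_of_lt_of_le h0 (hwp i j)) hs.le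
        by_cases hj : j ∈ N
        · have hjL : j ∉ L i := fun h => hLN i j h hj
          simp only [hj, hjL, if_true, if_false]
          have := Real.log_le_sub_one_of_pos (x := 1 / (K * p j)) (by positivity)
          rw [one_div, Real.log_inv, Real.log_mul hK0.ne' hpj.ne'] at this
          have := mul_le_mul_of_nonneg_left this h0.le
          have e : w i * x i j / (K * p j) = w i * x i j * (K * p j)⁻¹ := by rw [div_eq_mul_inv]
          rw [e]
          linarith
        · have hjL : j ∈ L i := (hsplit i j hxi).resolve_left hj
          have hVi := hVpos i j hwi hxi hj
          simp only [hj, hjL, if_true, if_false]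
          have := Real.log_le_sub_one_of_pos (x := v i j / (V i * p j * K)) (by positivity)
          rw [Real.log_div hvi.ne' (by positivity), Real.log_mul (by positivity) hK0.ne',
            Real.log_mul hVi.ne' hpj.ne'] at this
          have := mul_le_mul_of_nonneg_left this h0.le
          linarith
    have hNsum : ∑ i, ∑ j, (if j ∈ N then w i * x i j / (K * p j) else 0)
        ≤ Fintype.card A * (s / K) := by
      rw [Finset.sum_comm]
      have : ∀ j, ∑ i, (if j ∈ N then w i * x i j / (K * p j) else 0)
          ≤ if j ∈ N then s / K else 0 := by
        intro j
        by_cases hj : j ∈ N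
        · simp only [hj, if_true]
          rw [← Finset.sum_div]
          have h1 : ∑ i, w i * x i j ≤ s * p j := by
            rw [hp, Finset.mul_sum]
            refine Finset.sum_le_sum fun i _ => ?_
            have := mul_le_mul_of_nonneg_left (hxb i j) (hw i)
            linarith
          rcases (hp0 j).eq_or_lt with h | h
          · rw [← h]
            simp
            positivity
          · rw [div_le_div_iff₀ (by positivity) hK0]
            nlinarith
        · simp [hj]
      refine (Finset.sum_le_sum fun j _ => this j).trans ?_
      rw [Finset.sum_ite_mem, Finset.univ_inter, Finset.sum_const, nsmul_eq_mul]
      exact mul_le_mul_of_nonneg_right (by exact_mod_cast hN) (by positivity)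
    have hLsum : ∑ i, ∑ j, (if j ∈ L i then w i * x i j * (v i j / (V i * p j * K)) else 0)
        ≤ Fintype.card A * (s / K) := by
      have : ∀ i, ∑ j, (if j ∈ L i then w i * x i j * (v i j / (V i * p j * K)) else 0)
          ≤ s / K := by
        intro i
        rw [Finset.sum_ite_mem, Finset.univ_inter]
        have h1 : ∀ j ∈ L i, w i * x i j * (v i j / (V i * p j * K)) ≤ v i j * (s / (V i * K)) := by
          intro j _
          rcases (hp0 j).eq_or_lt with h | h
          · rw [← h]
            simp only [mul_zero, zero_mul, div_zero]
            exact mul_nonneg (hv i j) (div_nonneg hs.le (mul_nonneg (hV0 i) hK0.le))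
          · have e : w i * x i j * (v i j / (V i * p j * K))
                = (w i * x i j / p j) * (v i j / (V i * K)) := by
              rw [div_mul_div_comm, mul_div_assoc', mul_assoc (V i), mul_comm (p j), ← mul_assoc,
                mul_comm (V i * K)]
            have e2 : v i j * (s / (V i * K)) = s * (v i j / (V i * K)) := by ring
            rw [e, e2]
            refine mul_le_mul_of_nonneg_right ?_
              (div_nonneg (hv i j) (mul_nonneg (hV0 i) hK0.le))
            rw [div_le_iff₀ h]
            exact hwp i j
        refine (Finset.sum_le_sum h1).trans ?_
        rw [← Finset.sum_mul]
        change V i * (s / (V i * K)) ≤ s / K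
        rcases (hV0 i).eq_or_lt with h | h
        · rw [← h]
          simp
          positivity
        · apply le_of_eq
          field_simp
      refine (Finset.sum_le_sum fun i _ => this i).trans ?_
      simp
    have hKK : Fintype.card A * (s / K) + Fintype.card A * (s / K) = 1 := by
      rw [hK]
      field_simp
      norm_num
    have htot := Finset.sum_le_sum fun i (_ : i ∈ Finset.univ) =>
      Finset.sum_le_sum fun j (_ : j ∈ Finset.univ) => hterm i j
    simp only [Finset.sum_add_distrib, Finset.sum_sub_distrib] at htot
    rw [hsum1] at htot
    simp only [← Finset.sum_mul] at htot
    rw [hsum1, one_mul] at htot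
    linarith

end Matching

section Logarithms

variable {A G : Type*} [Fintype A] [Fintype G]

theorem elog_of_pos {x : ℝ} (hx : 0 < x) : elog x = (Real.log x : EReal) :=
  ENNReal.log_ofReal_of_pos hx

theorem elog_zero : elog 0 = ⊥ := by simp [elog]

theorem elog_mono {x y : ℝ} (h : x ≤ y) : elog x ≤ elog y :=
  ENNReal.log_monotone (ENNReal.ofReal_le_ofReal h)

theorem ereal_sum_eq_bot {ι : Type*} (s : Finset ι) (f : ι → EReal) {i : ι} (hi : i ∈ s)
    (h : f i = ⊥) : ∑ i ∈ s, f i = ⊥ := by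
  classical
  rw [← Finset.add_sum_erase s f hi, h, EReal.bot_add]

theorem ereal_coe_sum {ι : Type*} (s : Finset ι) (f : ι → ℝ) :
    ((∑ i ∈ s, f i : ℝ) : EReal) = ∑ i ∈ s, (f i : EReal) := by
  classical
  induction s using Finset.induction_on with
  | empty => simp
  | insert a s ha ih => rw [Finset.sum_insert ha, Finset.sum_insert ha, EReal.coe_add, ih]

theorem coe_mul_elog {a y : ℝ} (ha : 0 ≤ a) (h : 0 < a → 0 < y) :
    (a : EReal) * elog y = ((a * Real.log y : ℝ) : EReal) := by
  rcases ha.eq_or_lt with h0 | h0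
  · simp [← h0]
  · rw [elog_of_pos (h h0), EReal.coe_mul]

theorem sum_mul_elog {w y : A → ℝ} (hw : ∀ i, 0 ≤ w i) (hy : ∀ i, 0 < w i → 0 < y i) :
    ∑ i, (w i : EReal) * elog (y i) = ((∑ i, w i * Real.log (y i) : ℝ) : EReal) := by
  rw [ereal_coe_sum]
  exact Finset.sum_congr rfl fun i _ => coe_mul_elog (hw i) (hy i)

/-- The real expression that `fcvx` takes where it is finite. -/
noncomputable def realObjective (v : A → G → ℝ) (w : A → ℝ) (b : A → G → ℝ) : ℝ :=
  (∑ i, ∑ j, w i * b i j * Real.log (v i j))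
    + (-(∑ j, ∑ i, w i * b i j * Real.log (∑ i', w i' * b i' j)) + ∑ i, w i * Real.log (w i))

theorem fcvx_eq_coe {v : A → G → ℝ} {w : A → ℝ} {b : A → G → ℝ} (hw : ∀ i, 0 ≤ w i)
    (hb : ∀ i j, 0 ≤ b i j) (h : ∀ i j, 0 < w i * b i j → 0 < v i j) :
    fcvx v w b = (realObjective v w b : EReal) := by
  have h1 : ∑ i, ∑ j, ((w i * b i j : ℝ) : EReal) * elog (v i j)
      = ((∑ i, ∑ j, w i * b i j * Real.log (v i j) : ℝ) : EReal) := by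
    rw [ereal_coe_sum]
    refine Finset.sum_congr rfl fun i _ => ?_
    rw [ereal_coe_sum]
    exact Finset.sum_congr rfl fun j _ => coe_mul_elog (mul_nonneg (hw i) (hb i j)) (h i j)
  rw [fcvx, realObjective, h1, ← EReal.coe_add]

theorem fcvx_eq_bot {v : A → G → ℝ} {w : A → ℝ} {b : A → G → ℝ} (hv : ∀ i j, 0 ≤ v i j)
    (h : ¬ ∀ i j, 0 < w i * b i j → 0 < v i j) : fcvx v w b = ⊥ := by
  push Not at h
  obtain ⟨i, j, h1, h2⟩ := h
  have h3 : v i j = 0 := le_antisymm h2 (hv i j)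
  have : ∑ j, ((w i * b i j : ℝ) : EReal) * elog (v i j) = ⊥ := by
    refine ereal_sum_eq_bot _ _ (Finset.mem_univ j) ?_
    rw [h3, elog_zero, EReal.coe_mul_bot_of_pos h1]
  rw [fcvx, ereal_sum_eq_bot _ _ (Finset.mem_univ i) this, EReal.bot_add]

theorem realObjective_eq {v : A → G → ℝ} {w : A → ℝ} {b : A → G → ℝ} :
    realObjective v w b =
      ∑ i, ∑ j, w i * b i j * (Real.log (v i j) - Real.log (∑ i', w i' * b i' j))
        + ∑ i, w i * Real.log (w i) := by
  rw [realObjective, Finset.sum_comm (s := (Finset.univ : Finset G))]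
  simp only [mul_sub, Finset.sum_sub_distrib]
  ring

theorem klUniform_eq [Nonempty A] {w : A → ℝ} (hw1 : ∑ i, w i = 1) :
    klUniform w = ∑ i, w i * Real.log (w i) + Real.log (Fintype.card A) := by
  have hn : (Fintype.card A : ℝ) ≠ 0 := by exact_mod_cast Fintype.card_ne_zero
  have : ∀ i, w i * Real.log (w i / (1 / (Fintype.card A : ℝ)))
      = w i * Real.log (w i) + w i * Real.log (Fintype.card A) := by
    intro i
    by_cases h : w i = 0
    · simp [h]
    · rw [div_div_eq_mul_div, div_one, Real.log_mul h hn]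
      ring
  rw [klUniform, Finset.sum_congr rfl fun i _ => this i, Finset.sum_add_distrib,
    ← Finset.sum_mul, hw1, one_mul]

end Logarithms

end NashWelfare
namespace NashWelfare

section Forest

theorem IsAcyclic.eq_of_adj_of_dist_lt {V : Type*} {H : SimpleGraph V} (hH : H.IsAcyclic)
    {r v u₁ u₂ : V} (hr : H.Reachable r v) (h₁ : H.Adj u₁ v) (h₂ : H.Adj u₂ v)
    (hd₁ : H.dist r u₁ < H.dist r v) (hd₂ : H.dist r u₂ < H.dist r v) : u₁ = u₂ := by
  have key : ∀ u, H.Adj u v → H.dist r u < H.dist r v →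
      ∃ (p : H.Walk r u) (h : H.Adj u v), (p.concat h).IsPath := by
    intro u h hd
    obtain ⟨p, hp⟩ := (hr.trans h.symm.reachable).exists_walk_length_eq_dist
    refine ⟨p, h, (p.concat h).isPath_of_length_eq_dist ?_⟩
    rw [SimpleGraph.Walk.length_concat, hp]
    have := SimpleGraph.dist_le (p.concat h)
    rw [SimpleGraph.Walk.length_concat, hp] at this
    omega
  obtain ⟨p₁, a₁, hp₁⟩ := key u₁ h₁ hd₁
  obtain ⟨p₂, a₂, hp₂⟩ := key u₂ h₂ hd₂
  have := (hH.subsingleton_path r v).elim ⟨_, hp₁⟩ ⟨_, hp₂⟩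
  rw [Subtype.mk.injEq] at this
  rw [← SimpleGraph.Walk.penultimate_concat p₁ a₁, this, SimpleGraph.Walk.penultimate_concat]

theorem Reachable.exists_adj_dist_lt {V : Type*} {H : SimpleGraph V} {r v : V}
    (hr : H.Reachable r v) (hne : r ≠ v) : ∃ u, H.Adj u v ∧ H.dist r u < H.dist r v := by
  obtain ⟨p, hp⟩ := hr.exists_walk_length_eq_dist
  have hnil : ¬ p.Nil := SimpleGraph.Walk.not_nil_of_ne hne
  refine ⟨p.penultimate, p.adj_penultimate hnil, ?_⟩
  have h1 := SimpleGraph.dist_le p.dropLast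
  have h2 : 0 < p.length := SimpleGraph.Walk.not_nil_iff_lt_length.mp hnil
  have h3 : p.dropLast.length = p.length - 1 := by simp
  omega

variable {A G : Type*}

theorem supportGraph_adj {b : A → G → ℝ} {i : A} {j : G} :
    (supportGraph b).Adj (Sum.inl i) (Sum.inr j) ↔ 0 < b i j := by
  simp [supportGraph]

theorem exists_agent_of_adj {b : A → G → ℝ} {y : A ⊕ G} {j : G}
    (h : (supportGraph b).Adj y (Sum.inr j)) : ∃ i, y = Sum.inl i := by
  rcases h with ⟨i, j', _, hx, _⟩ | ⟨i, j', _, _, hy⟩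
  · exact ⟨i, hx⟩
  · simp at hy

theorem exists_isRooting (H : SimpleGraph (A ⊕ G)) : ∃ root : A → A, IsRooting H root := by
  classical
  let f : A → H.ConnectedComponent := fun i => H.connectedComponentMk (Sum.inl i)
  have hf : ∀ i, ∃ i', f i' = f i := fun i => ⟨i, rfl⟩
  let g : H.ConnectedComponent → A → A := fun c d => if h : ∃ i', f i' = c then h.choose else d
  refine ⟨fun i => g (f i) i, fun i => ?_, fun i i' h => ?_⟩
  · simp only [g, dif_pos (hf i)]
    exact SimpleGraph.ConnectedComponent.exact (hf i).choose_spec.symm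
  · have e : f i = f i' := SimpleGraph.ConnectedComponent.sound h
    simp only [g, e, dif_pos (hf i')]

/-- The distance of agent `i` from its root. -/
noncomputable def agentDepth (H : SimpleGraph (A ⊕ G)) (root : A → A) (i : A) : ℕ :=
  H.dist (Sum.inl (root i)) (Sum.inl i)

variable {b : A → G → ℝ} {root : A → A}

theorem isItemChild_or_isAgentChild (hH : (supportGraph b).IsAcyclic)
    (hroot : IsRooting (supportGraph b) root) {i : A} {j : G} (h : 0 < b i j) :
    IsItemChild (supportGraph b) root i j ∨ IsAgentChild (supportGraph b) root j i := by
  have hadj := supportGraph_adj.mpr h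
  rcases lt_or_gt_of_ne (hH.dist_ne_of_adj hadj (hroot.1 i).symm) with h' | h'
  · exact Or.inl ⟨hadj, h'⟩
  · exact Or.inr ⟨hadj, h'⟩

theorem IsItemChild.not_isAgentChild {H : SimpleGraph (A ⊕ G)} {i : A} {j : G}
    (h : IsItemChild H root i j) : ¬ IsAgentChild H root j i :=
  fun h' => lt_asymm h.2 h'.2

theorem IsAgentChild.unique (hH : (supportGraph b).IsAcyclic)
    (hroot : IsRooting (supportGraph b) root) {i : A} {j j' : G}
    (h : IsAgentChild (supportGraph b) root j i) (h' : IsAgentChild (supportGraph b) root j' i) :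
    j = j' :=
  Sum.inr_injective (IsAcyclic.eq_of_adj_of_dist_lt hH (hroot.1 i).symm h.1.symm h'.1.symm h.2 h'.2)

theorem root_eq_of_adj (hroot : IsRooting (supportGraph b) root) {i i' : A} {j : G}
    (h : (supportGraph b).Adj (Sum.inl i) (Sum.inr j))
    (h' : (supportGraph b).Adj (Sum.inl i') (Sum.inr j)) : root i = root i' :=
  hroot.2 _ _ (h.reachable.trans h'.symm.reachable)

theorem IsItemChild.unique (hH : (supportGraph b).IsAcyclic)
    (hroot : IsRooting (supportGraph b) root) {i i' : A} {j : G}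
    (h : IsItemChild (supportGraph b) root i j) (h' : IsItemChild (supportGraph b) root i' j) :
    i = i' := by
  have e := root_eq_of_adj hroot h.1 h'.1
  refine Sum.inl_injective (IsAcyclic.eq_of_adj_of_dist_lt hH
    ((hroot.1 i).symm.trans h.1.reachable) h.1 h'.1 h.2 ?_)
  rw [e]
  exact h'.2

theorem IsAgentChild.exists_isItemChild (hroot : IsRooting (supportGraph b) root) {i : A} {j : G}
    (h : 0 < b i j) : ∃ i', IsItemChild (supportGraph b) root i' j := by
  have hadj := supportGraph_adj.mpr h
  obtain ⟨u, hu, hd⟩ := Reachable.exists_adj_dist_lt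
    ((hroot.1 i).symm.trans hadj.reachable) (by simp)
  obtain ⟨i', rfl⟩ := exists_agent_of_adj hu
  refine ⟨i', hu, ?_⟩
  rw [← root_eq_of_adj hroot hadj hu]
  exact hd

theorem IsItemChild.depth_lt (hroot : IsRooting (supportGraph b) root) {i i' : A} {j : G}
    (h : IsItemChild (supportGraph b) root i j) (h' : IsAgentChild (supportGraph b) root j i') :
    agentDepth (supportGraph b) root i < agentDepth (supportGraph b) root i' := by
  have e := root_eq_of_adj hroot h.1 h'.1
  have h1 := h.2
  rw [e] at h1
  rw [agentDepth, agentDepth, e]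
  exact h1.trans h'.2

/-- In a rooted forest there are at most as many items with a child as there are agents. -/
theorem card_le_of_agentChild [Fintype A] (hH : (supportGraph b).IsAcyclic)
    (hroot : IsRooting (supportGraph b) root) (N : Finset G)
    (hN : ∀ j ∈ N, ∃ i, IsAgentChild (supportGraph b) root j i) : N.card ≤ Fintype.card A := by
  rcases N.eq_empty_or_nonempty with rfl | ⟨j₀, hj₀⟩
  · simp
  have : Nonempty A := ⟨(hN j₀ hj₀).choose⟩
  choose! f hf using hN
  refine Finset.card_le_card_of_injOn f (fun _ _ => Finset.mem_univ _) fun j hj j' hj' h => ?_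
  have h1 := hf j hj
  rw [h] at h1
  exact h1.unique hH hroot (hf j' hj')

/-- An item with two neighbours has a child. -/
theorem exists_agentChild_of_two (hH : (supportGraph b).IsAcyclic)
    (hroot : IsRooting (supportGraph b) root) {j : G} {i i' : A} (hne : i ≠ i') (h : 0 < b i j)
    (h' : 0 < b i' j) : ∃ k, IsAgentChild (supportGraph b) root j k := by
  rcases isItemChild_or_isAgentChild hH hroot h with h1 | h1
  · rcases isItemChild_or_isAgentChild hH hroot h' with h2 | h2
    · exact absurd (h1.unique hH hroot h2) hne
    · exact ⟨i', h2⟩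
  · exact ⟨i, h1⟩

end Forest

end NashWelfare
namespace NashWelfare

set_option linter.unusedSectionVars false

section Redistribution

theorem exists_fixedPoint_of_rank {A : Type*} (rank : A → ℕ) (Φ : (A → ℝ) → A → ℝ)
    (h : ∀ s s' i, (∀ r, rank r < rank i → s r = s' r) → Φ s i = Φ s' i) :
    ∃ s, ∀ i, s i = Φ s i := by
  have key : ∀ d i k l, rank i = d → rank i < k → rank i < l →
      Φ^[k] (fun _ => 0) i = Φ^[l] (fun _ => 0) i := by
    intro d
    induction d using Nat.strong_induction_on with
    | _ d ih =>
      intro i k l hd hk hl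
      obtain ⟨k, rfl⟩ := Nat.exists_eq_succ_of_ne_zero (by omega : k ≠ 0)
      obtain ⟨l, rfl⟩ := Nat.exists_eq_succ_of_ne_zero (by omega : l ≠ 0)
      rw [Function.iterate_succ_apply', Function.iterate_succ_apply']
      exact h _ _ _ fun r hr => ih (rank r) (by omega) r k l rfl (by omega) (by omega)
  refine ⟨fun i => Φ^[rank i + 1] (fun _ => 0) i, fun i => ?_⟩
  change Φ^[rank i + 1] (fun _ => 0) i = _
  rw [Function.iterate_succ_apply']
  exact h _ _ _ fun r hr => key _ r _ _ rfl (by omega) (by omega)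

variable {A G : Type*} [Fintype A] [Fintype G]

open Classical in
/-- The factor by which the shares of the children of item `j` are scaled when the shares of its
parent are scaled by `s`. -/
noncomputable def childFactor (b : A → G → ℝ) (root : A → A) (s : A → ℝ) (j : G) : ℝ :=
  if ∑ k, b k j < 1 / 2 then 0 else
    max 0 ((∑ k, b k j - ∑ k, if IsAgentChild (supportGraph b) root j k then 0 else s k * b k j)
      / ∑ k, if IsAgentChild (supportGraph b) root j k then b k j else 0)

open Classical in
/-- The factor by which agent `i` has to scale its children after the loss at its parent. -/
noncomputable def agentFactor (b : A → G → ℝ) (root : A → A) (s : A → ℝ) (i : A) : ℝ :=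
  (1 - ∑ j, if IsAgentChild (supportGraph b) root j i then childFactor b root s j * b i j else 0)
    / (1 - ∑ j, if IsAgentChild (supportGraph b) root j i then b i j else 0)

open Classical in
/-- The redistributed fractional assignment. -/
noncomputable def redistributed (b : A → G → ℝ) (root : A → A) (s : A → ℝ) (i : A) (j : G) : ℝ :=
  if IsAgentChild (supportGraph b) root j i then childFactor b root s j * b i j else s i * b i j

variable {b : A → G → ℝ} {root : A → A}

theorem exists_agentFactor_fixedPoint (hb : b ∈ feasible A G) (hH : (supportGraph b).IsAcyclic)
    (hroot : IsRooting (supportGraph b) root) : ∃ s, ∀ i, s i = agentFactor b root s i := by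
  classical
  refine exists_fixedPoint_of_rank (agentDepth (supportGraph b) root) _ fun s s' i hs => ?_
  have key : ∀ j, IsAgentChild (supportGraph b) root j i →
      childFactor b root s j = childFactor b root s' j := by
    intro j hj
    rw [childFactor, childFactor]
    congr 4
    refine Finset.sum_congr rfl fun k _ => ?_
    split_ifs with hk
    · rfl
    · rcases (hb.1 k j).eq_or_lt with h0 | h0
      · simp [← h0]
      · have h1 := (isItemChild_or_isAgentChild hH hroot h0).resolve_right hk
        rw [hs k (h1.depth_lt hroot hj)]
  rw [agentFactor, agentFactor]
  congr 2
  refine Finset.sum_congr rfl fun j _ => ?_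
  split_ifs with hj
  · rw [key j hj]
  · rfl

theorem sum_ite_agentChild (hH : (supportGraph b).IsAcyclic)
    (hroot : IsRooting (supportGraph b) root) {i : A} {j : G}
    (hj : IsAgentChild (supportGraph b) root j i) [DecidablePred fun j =>
      IsAgentChild (supportGraph b) root j i] (f : G → ℝ) :
    (∑ j, if IsAgentChild (supportGraph b) root j i then f j else 0) = f j := by
  rw [Finset.sum_eq_single j]
  · rw [if_pos hj]
  · intro j' _ hne
    rw [if_neg fun h => hne (h.unique hH hroot hj)]
  · simp

theorem sum_ite_not_agentChild (hb : ∀ i j, 0 ≤ b i j) (hH : (supportGraph b).IsAcyclic)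
    (hroot : IsRooting (supportGraph b) root) {r : A} {j : G}
    (hr : IsItemChild (supportGraph b) root r j) [DecidablePred fun i =>
      IsAgentChild (supportGraph b) root j i] (s : A → ℝ) :
    (∑ k, if IsAgentChild (supportGraph b) root j k then 0 else s k * b k j) = s r * b r j := by
  rw [Finset.sum_eq_single r]
  · rw [if_neg hr.not_isAgentChild]
  · intro k _ hne
    split_ifs with hk
    · rfl
    · rcases (hb k j).eq_or_lt with h0 | h0
      · simp [← h0]
      · exact absurd (((isItemChild_or_isAgentChild hH hroot h0).resolve_right hk).unique
          hH hroot hr) hne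
  · simp

theorem sum_children_add (hb : ∀ i j, 0 ≤ b i j) (hH : (supportGraph b).IsAcyclic)
    (hroot : IsRooting (supportGraph b) root) {r : A} {j : G}
    (hr : IsItemChild (supportGraph b) root r j) [DecidablePred fun i =>
      IsAgentChild (supportGraph b) root j i] :
    (∑ k, if IsAgentChild (supportGraph b) root j k then b k j else 0) + b r j = ∑ k, b k j := by
  have h := sum_ite_not_agentChild hb hH hroot hr fun _ => 1
  simp only [one_mul] at h
  rw [← h, ← Finset.sum_add_distrib]
  exact Finset.sum_congr rfl fun k _ => by split_ifs <;> simp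

/-- The share of an agent at its parent item, and the parent of that item. -/
theorem share_lt_one (hb : b ∈ feasible A G) (hH : (supportGraph b).IsAcyclic)
    (hroot : IsRooting (supportGraph b) root) {i : A} {j : G}
    (hj : IsAgentChild (supportGraph b) root j i) [DecidablePred fun i =>
      IsAgentChild (supportGraph b) root j i] :
    ∃ r, IsItemChild (supportGraph b) root r j ∧ 0 < b r j ∧ 0 < b i j ∧
      b i j ≤ ∑ k, (if IsAgentChild (supportGraph b) root j k then b k j else 0) ∧
      b i j + b r j ≤ ∑ k, b k j ∧ b i j < 1 := by
  have hij := supportGraph_adj.mp hj.1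
  obtain ⟨r, hr⟩ := IsAgentChild.exists_isItemChild hroot hij
  have hrj := supportGraph_adj.mp hr.1
  have h1 : b i j ≤ ∑ k, (if IsAgentChild (supportGraph b) root j k then b k j else 0) := by
    have := Finset.single_le_sum
      (f := fun k => if IsAgentChild (supportGraph b) root j k then b k j else 0)
      (fun k _ => by split_ifs; exacts [hb.1 k j, le_rfl]) (Finset.mem_univ i)
    simpa [hj] using this
  have h2 := sum_children_add hb.1 hH hroot hr
  have h3 := hb.2.2 j
  exact ⟨r, hr, hrj, hij, h1, by linarith, by linarith⟩

theorem childFactor_mem (hb : b ∈ feasible A G) {s : A → ℝ} {j : G}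
    (hs : ∀ k, 0 < b k j → ¬ IsAgentChild (supportGraph b) root j k → 1 ≤ s k) :
    0 ≤ childFactor b root s j ∧ childFactor b root s j ≤ 1 := by
  classical
  rw [childFactor]
  split_ifs with hq
  · simp
  · refine ⟨le_max_left _ _, max_le zero_le_one ?_⟩
    have hβ : 0 ≤ ∑ k, if IsAgentChild (supportGraph b) root j k then b k j else 0 :=
      Finset.sum_nonneg fun k _ => by split_ifs; exacts [hb.1 k j, le_rfl]
    refine div_le_one_of_le₀ ?_ hβ
    rw [sub_le_iff_le_add, ← Finset.sum_add_distrib]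
    refine Finset.sum_le_sum fun k _ => ?_
    split_ifs with hk
    · simp
    · rcases (hb.1 k j).eq_or_lt with h0 | h0
      · simp [← h0]
      · have := mul_le_mul_of_nonneg_right (hs k h0 hk) h0.le
        linarith

theorem agentFactor_mem (hb : b ∈ feasible A G) (hH : (supportGraph b).IsAcyclic)
    (hroot : IsRooting (supportGraph b) root) {s : A → ℝ} (hs : ∀ i, s i = agentFactor b root s i) :
    ∀ i, 1 ≤ s i ∧ s i ≤ 2 := by
  classical
  suffices h : ∀ d i, agentDepth (supportGraph b) root i = d → 1 ≤ s i ∧ s i ≤ 2 from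
    fun i => h _ i rfl
  intro d
  induction d using Nat.strong_induction_on with
  | _ d ih =>
    intro i hd
    by_cases hpar : ∃ j, IsAgentChild (supportGraph b) root j i
    · obtain ⟨j, hj⟩ := hpar
      obtain ⟨r, hr, hrj, hij, hβ, hq, hlt⟩ := share_lt_one hb hH hroot hj
      have hsr := ih _ (hd ▸ hr.depth_lt hroot hj) r rfl
      have hc := childFactor_mem (root := root) hb (s := s) (j := j) fun k hk hk' => by
        rw [((isItemChild_or_isAgentChild hH hroot hk).resolve_right hk').unique hH hroot hr]
        exact hsr.1
      rw [hs i, agentFactor, sum_ite_agentChild hH hroot hj, sum_ite_agentChild hH hroot hj]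
      rw [le_div_iff₀ (by linarith), div_le_iff₀ (by linarith)]
      refine ⟨by nlinarith, ?_⟩
      have hb1 := hb.2.2 j
      rw [childFactor, sum_ite_not_agentChild hb.1 hH hroot hr] at hc ⊢
      have hsum := sum_children_add hb.1 hH hroot hr
      split_ifs at hc ⊢ with hq2
      · linarith
      · set β := ∑ k, if IsAgentChild (supportGraph b) root j k then b k j else 0 with hβdef
        set c := max 0 ((∑ k, b k j - s r * b r j) / β) with hcdef
        have hβ0 : 0 < β := by linarith
        have h1 : ∑ k, b k j - s r * b r j ≤ c * β := by
          rw [← div_le_iff₀ hβ0]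
          exact le_max_right _ _
        have h2 : s r * b r j ≤ 2 * b r j := mul_le_mul_of_nonneg_right hsr.2 hrj.le
        have h3 : (1 - c) * β ≤ b r j := by linarith
        have h4 : (1 - c) * b i j ≤ (1 - c) * β :=
          mul_le_mul_of_nonneg_left hβ (by linarith [hc.2])
        linarith
    · push Not at hpar
      rw [hs i, agentFactor]
      simp [hpar]

/-- After the redistribution every agent still receives one unit, no share has more than
doubled, the children of items with load below `1/2` have lost their shares of these items, and
the load of the other items has not decreased. -/
theorem exists_redistribution (hb : b ∈ feasible A G) (hH : (supportGraph b).IsAcyclic)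
    (hroot : IsRooting (supportGraph b) root) :
    ∃ x : A → G → ℝ, (∀ i j, 0 ≤ x i j) ∧ (∀ i j, x i j ≤ 2 * b i j) ∧ (∀ i, ∑ j, x i j = 1) ∧
      (∀ j, ∑ i, x i j ≤ 1) ∧ (∀ j, 1 / 2 ≤ ∑ i, b i j → ∑ i, b i j ≤ ∑ i, x i j) ∧
      ∀ i j, ∑ k, b k j < 1 / 2 → IsAgentChild (supportGraph b) root j i → x i j = 0 := by
  classical
  obtain ⟨s, hs⟩ := exists_agentFactor_fixedPoint hb hH hroot
  have hsm := agentFactor_mem hb hH hroot hs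
  have hcm : ∀ j, 0 ≤ childFactor b root s j ∧ childFactor b root s j ≤ 1 := fun j =>
    childFactor_mem hb fun k _ _ => (hsm k).1
  have hx0 : ∀ i j, 0 ≤ redistributed b root s i j := by
    intro i j
    rw [redistributed]
    split_ifs
    · exact mul_nonneg (hcm j).1 (hb.1 i j)
    · exact mul_nonneg (by linarith [(hsm i).1]) (hb.1 i j)
  have hrow : ∀ i, ∑ j, redistributed b root s i j = 1 := by
    intro i
    have hup : (∑ j, if IsAgentChild (supportGraph b) root j i then b i j else 0) < 1 := by
      by_cases hpar : ∃ j, IsAgentChild (supportGraph b) root j i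
      · obtain ⟨j, hj⟩ := hpar
        obtain ⟨r, _, _, _, _, _, hlt⟩ := share_lt_one hb hH hroot hj
        rwa [sum_ite_agentChild hH hroot hj]
      · push Not at hpar
        simp [hpar]
    have h1 := hs i
    rw [agentFactor, eq_div_iff (by linarith)] at h1
    have h2 : ∑ j, redistributed b root s i j
        = (∑ j, if IsAgentChild (supportGraph b) root j i then childFactor b root s j * b i j
            else 0)
          + s i * (∑ j, b i j - ∑ j, if IsAgentChild (supportGraph b) root j i then b i j
            else 0) := by
      rw [← Finset.sum_sub_distrib, Finset.mul_sum, ← Finset.sum_add_distrib]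
      refine Finset.sum_congr rfl fun j _ => ?_
      rw [redistributed]
      split_ifs <;> simp
    rw [h2, hb.2.1 i, h1]
    ring
  have hcol : ∀ j, ∑ i, redistributed b root s i j
      = (∑ k, if IsAgentChild (supportGraph b) root j k then 0 else s k * b k j)
        + childFactor b root s j
          * ∑ k, if IsAgentChild (supportGraph b) root j k then b k j else 0 := by
    intro j
    rw [Finset.mul_sum, ← Finset.sum_add_distrib]
    refine Finset.sum_congr rfl fun i _ => ?_
    rw [redistributed]
    split_ifs <;> simp
  have ha1 : ∀ j, (∑ k, if IsAgentChild (supportGraph b) root j k then 0 else s k * b k j) ≤ 1 := by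
    intro j
    by_cases hr : ∃ r, IsItemChild (supportGraph b) root r j
    · obtain ⟨r, hr⟩ := hr
      rw [sum_ite_not_agentChild hb.1 hH hroot hr, ← hrow r]
      have := Finset.single_le_sum (f := redistributed b root s r) (fun j _ => hx0 r j)
        (Finset.mem_univ j)
      rwa [redistributed, if_neg hr.not_isAgentChild] at this
    · push Not at hr
      refine (le_of_eq ?_).trans zero_le_one
      refine Finset.sum_eq_zero fun k _ => ?_
      split_ifs with hk
      · rfl
      · rcases (hb.1 k j).eq_or_lt with h0 | h0
        · simp [← h0]
        · exact absurd ((isItemChild_or_isAgentChild hH hroot h0).resolve_right hk) (hr k)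
  have hload : ∀ j, ∑ k, b k j - (∑ k, if IsAgentChild (supportGraph b) root j k then b k j else 0)
      ≤ ∑ k, if IsAgentChild (supportGraph b) root j k then 0 else s k * b k j := by
    intro j
    rw [← Finset.sum_sub_distrib]
    refine Finset.sum_le_sum fun k _ => ?_
    split_ifs
    · simp
    · have := mul_le_mul_of_nonneg_right (hsm k).1 (hb.1 k j)
      linarith
  have hmain : ∀ j, 1 / 2 ≤ ∑ i, b i j → ∑ i, redistributed b root s i j
      = max (∑ k, if IsAgentChild (supportGraph b) root j k then 0 else s k * b k j)
        (∑ k, b k j) := by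
    intro j hj
    have hl := hload j
    rw [hcol, childFactor, if_neg (not_lt.mpr hj)]
    set a := ∑ k, if IsAgentChild (supportGraph b) root j k then 0 else s k * b k j
    set β := ∑ k, if IsAgentChild (supportGraph b) root j k then b k j else 0 with hβ
    have hβ0 : 0 ≤ β := Finset.sum_nonneg fun k _ => by split_ifs; exacts [hb.1 k j, le_rfl]
    rcases hβ0.eq_or_lt with h0 | h0
    · rw [← h0] at hl ⊢
      rw [mul_zero, add_zero, max_eq_left (by linarith)]
    · rw [max_mul_of_nonneg _ _ h0.le, zero_mul, div_mul_cancel₀ _ h0.ne', ← max_add_add_left]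
      simp
  refine ⟨redistributed b root s, hx0, ?_, hrow, ?_, ?_, ?_⟩
  · intro i j
    rw [redistributed]
    split_ifs
    · exact mul_le_mul_of_nonneg_right (by linarith [(hcm j).2]) (hb.1 i j)
    · exact mul_le_mul_of_nonneg_right (hsm i).2 (hb.1 i j)
  · intro j
    by_cases hj : 1 / 2 ≤ ∑ i, b i j
    · rw [hmain j hj]
      exact max_le (ha1 j) (hb.2.2 j)
    · rw [hcol, childFactor, if_pos (not_le.mp hj), zero_mul, add_zero]
      exact ha1 j
  · intro j hj
    rw [hmain j hj]
    exact le_max_right _ _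
  · intro i j hj hji
    rw [redistributed, if_pos hji, childFactor, if_pos hj, zero_mul]

end Redistribution

section Optimality

variable {A G : Type*} [Fintype A] [Fintype G]

theorem mul_log_le {p y : ℝ} (hp : 0 ≤ p) (hy : 0 ≤ y) (h0 : p = 0 → y = 0) :
    y * Real.log y ≤ y * Real.log p + (y - p) + (y - p) ^ 2 / p := by
  rcases hp.eq_or_lt with h | h
  · simp [← h, h0 h.symm]
  · rcases hy.eq_or_lt with h' | h'
    · rw [← h']
      have : (0 - p) ^ 2 / p = p := by field_simp; ring
      rw [this]
      simp
    · have := mul_le_mul_of_nonneg_left (Real.log_le_sub_one_of_pos (div_pos h' h)) h'.le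
      rw [Real.log_div h'.ne' h.ne'] at this
      have e : y * (y / p - 1) = (y - p) + (y - p) ^ 2 / p := by field_simp; ring
      linarith

/-- First-order optimality of `b` against a redistribution `x` from which one can move away. -/
theorem first_order_optimality {v : A → G → ℝ} {w : A → ℝ} {b x : A → G → ℝ}
    {S : Set (A → G → ℝ)} (hw : ∀ i, 0 ≤ w i) (hb : ∀ i j, 0 ≤ b i j) (hx : ∀ i j, 0 ≤ x i j)
    (hxb : ∀ i j, x i j ≤ 2 * b i j) (hrow : ∀ i, ∑ j, x i j = ∑ j, b i j)
    (hfin : ∀ i j, 0 < w i * b i j → 0 < v i j) (hmax : IsMaxOn (fcvx v w) S b)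
    (hS : ∀ t : ℝ, 0 < t → t ≤ 1 → (fun i j => (1 + t) * b i j - t * x i j) ∈ S) :
    ∑ i, ∑ j, w i * b i j * (Real.log (v i j) - Real.log (∑ i', w i' * b i' j))
      ≤ ∑ i, ∑ j, w i * x i j * (Real.log (v i j) - Real.log (∑ i', w i' * b i' j)) := by
  set p : G → ℝ := fun j => ∑ i', w i' * b i' j with hp
  set d : G → ℝ := fun j => ∑ i, w i * x i j - p j with hd
  set Q : ℝ := ∑ j, d j ^ 2 / p j with hQ
  have hp0 : ∀ j, 0 ≤ p j := fun j => Finset.sum_nonneg fun i _ => mul_nonneg (hw i) (hb i j)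
  have hQ0 : 0 ≤ Q := Finset.sum_nonneg fun j _ => div_nonneg (sq_nonneg _) (hp0 j)
  have hdsum : ∑ j, d j = 0 := by
    simp only [hd, hp, Finset.sum_sub_distrib]
    rw [Finset.sum_comm, Finset.sum_comm (f := fun j i => w i * b i j)]
    simp [← Finset.mul_sum, hrow]
  have hdlog : ∑ j, d j * Real.log (p j) = ∑ i, ∑ j, w i * (x i j - b i j) * Real.log (p j) := by
    rw [Finset.sum_comm]
    refine Finset.sum_congr rfl fun j _ => ?_
    rw [← Finset.sum_mul]
    congr 1
    simp only [hd, hp, ← Finset.sum_sub_distrib, mul_sub]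
  set Δ : ℝ := ∑ i, ∑ j, w i * (x i j - b i j) * (Real.log (v i j) - Real.log (p j)) with hΔ
  suffices hmain : 0 ≤ Δ by
    have : Δ = ∑ i, ∑ j, w i * x i j * (Real.log (v i j) - Real.log (p j))
        - ∑ i, ∑ j, w i * b i j * (Real.log (v i j) - Real.log (p j)) := by
      simp only [hΔ, ← Finset.sum_sub_distrib]
      exact Finset.sum_congr rfl fun i _ => Finset.sum_congr rfl fun j _ => by ring
    linarith
  have key : ∀ t : ℝ, 0 < t → t ≤ 1 → 0 ≤ Δ + t * Q := by
    intro t ht0 ht1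
    set c : A → G → ℝ := fun i j => (1 + t) * b i j - t * x i j with hc
    have hc0 : ∀ i j, 0 ≤ c i j := by
      intro i j
      have h1 := mul_le_mul_of_nonneg_left (hxb i j) ht0.le
      have h2 := mul_nonneg (sub_nonneg.mpr ht1) (hb i j)
      simp only [hc]
      linarith
    have hcb : ∀ i j, b i j = 0 → c i j = 0 := by
      intro i j h
      have h1 := hxb i j
      rw [h, mul_zero] at h1
      simp [hc, h, le_antisymm h1 (hx i j)]
    have hcfin : ∀ i j, 0 < w i * c i j → 0 < v i j := by
      intro i j h
      refine hfin i j ((mul_nonneg (hw i) (hb i j)).lt_of_ne fun h' => ?_)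
      rcases mul_eq_zero.mp h'.symm with h1 | h1
      · simp [h1] at h
      · simp [hcb i j h1] at h
    have hle : fcvx v w c ≤ fcvx v w b := hmax (hS t ht0 ht1)
    rw [fcvx_eq_coe hw hc0 hcfin, fcvx_eq_coe hw hb hfin, EReal.coe_le_coe_iff, realObjective,
      realObjective] at hle
    have hy : ∀ j, ∑ i, w i * c i j = p j - t * d j := by
      intro j
      simp only [hc, hd, hp, mul_sub, Finset.sum_sub_distrib, Finset.mul_sum]
      rw [← Finset.sum_sub_distrib, ← Finset.sum_sub_distrib, ← Finset.sum_sub_distrib]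
      exact Finset.sum_congr rfl fun i _ => by ring
    have hA : ∑ i, ∑ j, w i * c i j * Real.log (v i j) = ∑ i, ∑ j, w i * b i j * Real.log (v i j)
        - t * ∑ i, ∑ j, w i * (x i j - b i j) * Real.log (v i j) := by
      simp only [Finset.mul_sum, ← Finset.sum_sub_distrib]
      exact Finset.sum_congr rfl fun i _ => Finset.sum_congr rfl fun j _ => by
        simp only [hc]; ring
    have hB : ∑ j, ∑ i, w i * c i j * Real.log (∑ i', w i' * c i' j)
        ≤ ∑ j, (p j * Real.log (p j) - t * (d j * Real.log (p j)) - t * d j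
          + t ^ 2 * (d j ^ 2 / p j)) := by
      refine Finset.sum_le_sum fun j _ => ?_
      rw [← Finset.sum_mul, hy]
      have := mul_log_le (hp0 j) (y := p j - t * d j)
        (by rw [← hy]; exact Finset.sum_nonneg fun i _ => mul_nonneg (hw i) (hc0 i j))
        (fun h => by
          rw [← hy]
          refine Finset.sum_eq_zero fun i _ => ?_
          have h1 := (Finset.sum_eq_zero_iff_of_nonneg
            (fun i _ => mul_nonneg (hw i) (hb i j))).mp h i (Finset.mem_univ i)
          rcases mul_eq_zero.mp h1 with h2 | h2
          · simp [h2]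
          · simp [hcb i j h2])
      have e : (p j - t * d j - p j) ^ 2 / p j = t ^ 2 * (d j ^ 2 / p j) := by ring
      rw [e] at this
      linarith
    have hC : ∑ j, ∑ i, w i * b i j * Real.log (∑ i', w i' * b i' j)
        = ∑ j, p j * Real.log (p j) :=
      Finset.sum_congr rfl fun j _ => by rw [← Finset.sum_mul]
    have hD : ∑ j, (p j * Real.log (p j) - t * (d j * Real.log (p j)) - t * d j
        + t ^ 2 * (d j ^ 2 / p j)) = ∑ j, p j * Real.log (p j)
          - t * (∑ i, ∑ j, w i * (x i j - b i j) * Real.log (p j)) + t ^ 2 * Q := by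
      rw [← hdlog, Finset.sum_add_distrib, Finset.sum_sub_distrib, Finset.sum_sub_distrib,
        ← Finset.mul_sum, ← Finset.mul_sum, ← Finset.mul_sum, hdsum]
      ring
    have hE : Δ = ∑ i, ∑ j, w i * (x i j - b i j) * Real.log (v i j)
        - ∑ i, ∑ j, w i * (x i j - b i j) * Real.log (p j) := by
      simp only [hΔ, ← Finset.sum_sub_distrib, mul_sub]
    have hfinal : 0 ≤ t * (Δ + t * Q) := by
      rw [hE]
      rw [hA, hC] at hle
      rw [hD] at hB
      nlinarith
    exact nonneg_of_mul_nonneg_right hfinal ht0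
  by_contra hneg
  push Not at hneg
  have h1 := key (min 1 (-Δ / (2 * (Q + 1)))) (lt_min one_pos (by
    apply div_pos <;> linarith)) (min_le_left _ _)
  have h2 : min 1 (-Δ / (2 * (Q + 1))) * Q ≤ -Δ / (2 * (Q + 1)) * (Q + 1) :=
    mul_le_mul (min_le_right _ _) (by linarith) hQ0 (by apply div_nonneg <;> linarith)
  have h3 : -Δ / (2 * (Q + 1)) * (Q + 1) = -Δ / 2 := by
    field_simp
  linarith

end Optimality

end NashWelfare
namespace NashWelfare

set_option linter.unusedSectionVars false

section Output

variable {A G : Type*} [Fintype A] [Fintype G]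

theorem isClosed_feasible : IsClosed (feasible A G) := by
  have : feasible A G = (⋂ i, ⋂ j, {b | 0 ≤ b i j}) ∩ ((⋂ i, {b | ∑ j, b i j = 1})
      ∩ ⋂ j, {b | ∑ i, b i j ≤ 1}) := by
    ext b
    simp [feasible]
  rw [this]
  refine (isClosed_iInter fun i => isClosed_iInter fun j => ?_).inter
    ((isClosed_iInter fun i => ?_).inter (isClosed_iInter fun j => ?_))
  · exact isClosed_le continuous_const (by fun_prop)
  · exact isClosed_eq (by fun_prop) continuous_const
  · exact isClosed_le (by fun_prop) continuous_const

theorem isCompact_feasible : IsCompact (feasible A G) := by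
  refine IsCompact.of_isClosed_subset (s := Set.Icc (fun _ _ => 0) fun _ _ => 1)
    isCompact_Icc isClosed_feasible fun b hb => ⟨fun i j => hb.1 i j, fun i j => ?_⟩
  rw [← hb.2.1 i]
  exact Finset.single_le_sum (fun j _ => hb.1 i j) (Finset.mem_univ j)

theorem exists_isRestrictedOptimum {v : A → G → ℝ} {w : A → ℝ} {b : A → G → ℝ}
    (hv : ∀ i j, 0 ≤ v i j) (hw : ∀ i, 0 ≤ w i) (hb : b ∈ feasible A G) :
    ∃ bs, IsRestrictedOptimum v w b bs := by
  set S : Set (A → G → ℝ) := {c | c ∈ feasible A G ∧ ∀ i j, b i j = 0 → c i j = 0} with hS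
  set F : Set (A → G → ℝ) := {c | ∀ i j, 0 < w i → v i j = 0 → c i j = 0} with hF
  have hfin : ∀ c ∈ S, (c ∈ F ↔ ∀ i j, 0 < w i * c i j → 0 < v i j) := by
    intro c hc
    refine ⟨fun h i j hij => (hv i j).lt_of_ne fun h0 => ?_, fun h i j hwi hvij => ?_⟩
    · have hwi : 0 < w i := (hw i).lt_of_ne fun h' => by simp [← h'] at hij
      rw [h i j hwi h0.symm, mul_zero] at hij
      exact lt_irrefl _ hij
    · by_contra hne
      have := h i j (mul_pos hwi ((hc.1.1 i j).lt_of_ne (Ne.symm hne)))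
      exact this.ne' hvij
  have hbot : ∀ c ∈ S, c ∉ F → fcvx v w c = ⊥ := fun c hc hcF =>
    fcvx_eq_bot hv ((hfin c hc).not.mp hcF)
  have hcoe : ∀ c ∈ S, c ∈ F → fcvx v w c = (realObjective v w c : EReal) := fun c hc hcF =>
    fcvx_eq_coe hw hc.1.1 ((hfin c hc).mp hcF)
  rcases (S ∩ F).eq_empty_or_nonempty with hempty | hne
  · refine ⟨b, fun c hc => ?_, hb, fun i j h => h⟩
    change fcvx v w c ≤ fcvx v w b
    rw [hbot c hc fun h => (Set.eq_empty_iff_forall_notMem.mp hempty c) ⟨hc, h⟩]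
    exact bot_le
  · have hclosed : IsClosed ({c : A → G → ℝ | ∀ i j, b i j = 0 → c i j = 0} ∩ F) := by
      have : ({c : A → G → ℝ | ∀ i j, b i j = 0 → c i j = 0} ∩ F)
          = ⋂ i, ⋂ j, {c | (b i j = 0 ∨ (0 < w i ∧ v i j = 0)) → c i j = 0} := by
        ext c
        simp only [hF, Set.mem_inter_iff, Set.mem_ofPred_eq, Set.mem_iInter]
        grind
      rw [this]
      refine isClosed_iInter fun i => isClosed_iInter fun j => ?_
      by_cases h : b i j = 0 ∨ (0 < w i ∧ v i j = 0)
      · simp only [h, true_imp_iff]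
        exact isClosed_eq (by fun_prop) continuous_const
      · simp [h]
    have hcomp : IsCompact (S ∩ F) := by
      have : S ∩ F = feasible A G ∩ ({c : A → G → ℝ | ∀ i j, b i j = 0 → c i j = 0} ∩ F) := by
        ext c
        simp [hS, and_assoc]
      rw [this]
      exact isCompact_feasible.inter_right hclosed
    have hcont : Continuous (realObjective v w) := by
      have : realObjective v w = fun c => (∑ i, ∑ j, w i * c i j * Real.log (v i j))
          + (-(∑ j, (∑ i, w i * c i j) * Real.log (∑ i', w i' * c i' j))
          + ∑ i, w i * Real.log (w i)) := by
        funext c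
        simp only [realObjective, Finset.sum_mul]
      rw [this]
      refine (by fun_prop : Continuous fun c : A → G → ℝ =>
        ∑ i, ∑ j, w i * c i j * Real.log (v i j)).add (Continuous.add (Continuous.neg ?_)
          continuous_const)
      exact continuous_finsetSum _ fun j _ => Real.continuous_mul_log.comp
        (by fun_prop : Continuous fun c : A → G → ℝ => ∑ i, w i * c i j)
    obtain ⟨bs, hbs, hmax⟩ := hcomp.exists_isMaxOn hne hcont.continuousOn
    refine ⟨bs, fun c hc => ?_, hbs.1.1, hbs.1.2⟩
    change fcvx v w c ≤ fcvx v w bs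
    by_cases hcF : c ∈ F
    · rw [hcoe c hc hcF, hcoe bs hbs.1 hbs.2, EReal.coe_le_coe_iff]
      exact hmax ⟨hc, hcF⟩
    · rw [hbot c hc hcF]
      exact bot_le

theorem leafItems_unique {bs : A → G → ℝ} {root : A → A} {i i' : A} {j : G}
    (h : j ∈ leafItems bs root i) (h' : j ∈ leafItems bs root i') : i = i' :=
  h'.2.2 i h.1

theorem exists_isRoundingOutput [Nonempty A] {v : A → G → ℝ} {w : A → ℝ} {b : A → G → ℝ}
    (hv : ∀ i j, 0 ≤ v i j) (hw : ∀ i, 0 ≤ w i) (hb : b ∈ feasible A G) :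
    ∃ σ, IsRoundingOutput v w b σ := by
  classical
  obtain ⟨bs, hbs⟩ := exists_isRestrictedOptimum hv hw hb
  obtain ⟨root, hroot⟩ := exists_isRooting (supportGraph bs)
  obtain ⟨M, hM, hmax⟩ := Set.exists_max_image {M | IsPrunedMatching bs root M}
    (matchingWeight v w bs root) (Set.toFinite _) ⟨fun _ => none, by simp [IsPrunedMatching]⟩
  have hσ : ∀ j, ∃ i, (∀ i', j ∈ leafItems bs root i' → i = i') ∧
      ∀ i', M i' = some j → i = i' := by
    intro j
    by_cases h1 : ∃ i, j ∈ leafItems bs root i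
    · obtain ⟨i, hi⟩ := h1
      exact ⟨i, fun i' h' => leafItems_unique hi h', fun i' h' => absurd hi ((hM.1 i' j h').2 i)⟩
    · push Not at h1
      by_cases h2 : ∃ i, M i = some j
      · obtain ⟨i, hi⟩ := h2
        exact ⟨i, fun i' h' => absurd h' (h1 i'), fun i' h' => hM.2 i i' j hi h'⟩
      · push Not at h2
        exact ⟨Classical.arbitrary A, fun i' h' => absurd h' (h1 i'),
          fun i' h' => absurd h' (h2 i')⟩
  choose σ hσ using hσ
  exact ⟨σ, bs, root, M, hbs, hroot, hM, hmax, fun i j h => (hσ j).1 i h,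
    fun i j h => (hσ j).2 i h⟩

/-- An assignment is worth at least what the agents get from disjoint leaf items and from matched
items. -/
theorem sum_elog_le_NSW {v : A → G → ℝ} {w : A → ℝ} {σ : G → A} (hv : ∀ i j, 0 ≤ v i j)
    (hw : ∀ i, 0 ≤ w i) (L : A → Set G) (M : A → Option G) (hL : ∀ i, ∀ j ∈ L i, σ j = i)
    (hM : ∀ i j, M i = some j → σ j = i) (hML : ∀ i j, M i = some j → j ∉ L i) :
    ∑ i, (w i : EReal) * elog ((M i).elim 0 (v i) + ∑ j, (L i).indicator (v i) j) ≤ NSW v w σ := by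
  classical
  refine Finset.sum_le_sum fun i _ => mul_le_mul_of_nonneg_left (elog_mono ?_)
    (EReal.coe_nonneg.mpr (hw i))
  have h0 : (M i).elim 0 (v i) = ∑ j, if M i = some j then v i j else 0 := by
    rcases M i with _ | j <;> simp
  rw [h0, ← Finset.sum_add_distrib]
  refine Finset.sum_le_sum fun j _ => ?_
  by_cases h1 : M i = some j
  · simp [h1, hML i j h1, hM i j h1]
  · by_cases h2 : j ∈ L i
    · simp [h1, h2, hL i j h2]
    · simp only [h1, if_false, h2, not_false_eq_true, Set.indicator_of_notMem, add_zero]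
      exact Set.indicator_nonneg (fun j _ => hv i j) j

theorem sum_indicator_eq [DecidableEq G] (L : Set G) [DecidablePred (· ∈ L)] (f : G → ℝ) :
    ∑ j, L.indicator f j = ∑ j ∈ Finset.univ.filter (· ∈ L), f j := by
  rw [Finset.sum_filter]
  exact Finset.sum_congr rfl fun j _ => by simp [Set.indicator_apply]

/-- The pruned forest of an optimum has a matching that meets the guarantee. -/
theorem exists_isPrunedMatching_ge [Nonempty A] {v : A → G → ℝ} {w : A → ℝ} {b bs : A → G → ℝ}
    {root : A → A} (hv : ∀ i j, 0 ≤ v i j) (hw : ∀ i, 0 ≤ w i) (hw1 : ∑ i, w i = 1)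
    (hacyc : (supportGraph bs).IsAcyclic) (hbs : IsRestrictedOptimum v w b bs)
    (hroot : IsRooting (supportGraph bs) root) (hfin : ∀ i j, 0 < w i * bs i j → 0 < v i j) :
    ∃ M, IsPrunedMatching bs root M ∧
      ((realObjective v w bs - (klUniform w + 2 * Real.log 2) : ℝ) : EReal)
        ≤ matchingWeight v w bs root M := by
  classical
  have hfeas := hbs.2.1
  obtain ⟨x, hx0, hxb, hrow, hcol, hload, hprune⟩ := exists_redistribution hfeas hacyc hroot
  have hopt := first_order_optimality hw hfeas.1 hx0 hxb
    (fun i => (hrow i).trans (hfeas.2.1 i).symm) hfin hbs.1 (by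
      intro t ht0 ht1
      refine ⟨⟨fun i j => ?_, fun i => ?_, fun j => ?_⟩, fun i j h => ?_⟩
      · have h1 := mul_le_mul_of_nonneg_left (hxb i j) ht0.le
        have h2 := mul_nonneg (sub_nonneg.mpr ht1) (hfeas.1 i j)
        linarith
      · rw [Finset.sum_sub_distrib, ← Finset.mul_sum, ← Finset.mul_sum, hrow, hfeas.2.1]
        ring
      · rw [Finset.sum_sub_distrib, ← Finset.mul_sum, ← Finset.mul_sum]
        have hq := hfeas.2.2 j
        have hq0 : 0 ≤ ∑ i, bs i j := Finset.sum_nonneg fun i _ => hfeas.1 i j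
        have hx1 : 0 ≤ ∑ i, x i j := Finset.sum_nonneg fun i _ => hx0 i j
        by_cases h : 1 / 2 ≤ ∑ i, bs i j
        · have := mul_le_mul_of_nonneg_left (hload j h) ht0.le
          linarith
        · have h1 := mul_nonneg ht0.le hx1
          have h2 := mul_le_mul_of_nonneg_right ht1 hq0
          linarith
      · have h1 := hbs.2.2 i j h
        have h2 := hxb i j
        rw [h1, mul_zero] at h2
        change (1 + t) * bs i j - t * x i j = 0
        rw [h1, le_antisymm h2 (hx0 i j)]
        ring)
  have hadj : ∀ i j, 0 < x i j → (prunedForest bs root).Adj (Sum.inl i) (Sum.inr j) := by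
    intro i j h
    have hb0 : 0 < bs i j := by linarith [hxb i j]
    rw [prunedForest, SimpleGraph.deleteEdges_adj]
    refine ⟨supportGraph_adj.mpr hb0, ?_⟩
    rintro ⟨i', j', hlt, hch, he⟩
    simp only [Sym2.eq_iff, Sum.inl.injEq, Sum.inr.injEq, reduceCtorEq, and_self, or_false] at he
    obtain ⟨rfl, rfl⟩ := he
    exact h.ne' (hprune i j hlt hch)
  have hadj' : ∀ i j, (prunedForest bs root).Adj (Sum.inl i) (Sum.inr j) → 0 < bs i j := by
    intro i j h
    rw [prunedForest, SimpleGraph.deleteEdges_adj] at h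
    exact supportGraph_adj.mp h.1
  obtain ⟨M, hM1, hM2, hM3, hM4⟩ := exists_matching_log_ge v w bs x 2
    (Finset.univ.filter fun j => (∃ i, (prunedForest bs root).Adj (Sum.inl i) (Sum.inr j)) ∧
      ∀ i, j ∉ leafItems bs root i)
    (fun i => Finset.univ.filter (· ∈ leafItems bs root i)) hv hw hw1 hfeas.1 hx0 two_pos hxb hrow
    (fun j _ => hcol j)
    (card_le_of_agentChild hacyc hroot _ (by
      intro j hj
      simp only [Finset.mem_filter, Finset.mem_univ, true_and] at hj
      obtain ⟨⟨i, hi⟩, hj⟩ := hj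
      rcases isItemChild_or_isAgentChild hacyc hroot (hadj' i j hi) with h | h
      · have := hj i
        simp only [leafItems, Set.mem_ofPred_eq, hi, h, true_and] at this
        push Not at this
        obtain ⟨i', hi', hne⟩ := this
        exact exists_agentChild_of_two hacyc hroot hne (hadj' i' j hi') (hadj' i j hi)
      · exact ⟨i, h⟩))
    (by
      intro i j h
      by_cases hj : ∃ i', j ∈ leafItems bs root i'
      · obtain ⟨i', hi'⟩ := hj
        right
        rw [hi'.2.2 i (hadj i j h)]
        simpa using hi'
      · push Not at hj
        left
        simp only [Finset.mem_filter, Finset.mem_univ, true_and]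
        exact ⟨⟨i, hadj i j h⟩, hj⟩)
    (by
      intro i j hj hjN
      simp only [Finset.mem_filter, Finset.mem_univ, true_and] at hj hjN
      exact hjN.2 i hj)
    (fun i j hwi hxi => hfin i j (mul_pos hwi (by linarith [hxb i j])))
  refine ⟨M, ⟨fun i j h => ⟨hadj i j (hM1 i j h).1, ?_⟩, hM2⟩, ?_⟩
  · have := (hM1 i j h).2
    simp only [Finset.mem_filter, Finset.mem_univ, true_and] at this
    exact this.2
  · simp only [matchingWeight, sum_indicator_eq]
    rw [sum_mul_elog hw hM3, EReal.coe_le_coe_iff]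
    refine le_trans ?_ hM4
    have hn : (0 : ℝ) < Fintype.card A := by exact_mod_cast Fintype.card_pos
    rw [realObjective_eq, klUniform_eq hw1, Real.log_mul (by positivity) two_ne_zero,
      Real.log_mul two_ne_zero hn.ne']
    linarith

theorem IsRoundingOutput.guarantee [Nonempty A] {v : A → G → ℝ} {w : A → ℝ} {b : A → G → ℝ}
    {σ : G → A} (hv : ∀ i j, 0 ≤ v i j) (hw : ∀ i, 0 ≤ w i) (hw1 : ∑ i, w i = 1)
    (hb : b ∈ feasible A G) (hacyc : (supportGraph b).IsAcyclic) (h : IsRoundingOutput v w b σ) :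
    Guarantee v w b σ := by
  obtain ⟨bs, root, M, hbs, hroot, hM, hmax, hσL, hσM⟩ := h
  have hfeas := hbs.2.1
  have hle : fcvx v w b ≤ fcvx v w bs := hbs.1 ⟨hb, fun i j h => h⟩
  have hacyc' : (supportGraph bs).IsAcyclic := by
    refine hacyc.anti ?_
    have hpos : ∀ i j, 0 < bs i j → 0 < b i j := fun i j h =>
      (hb.1 i j).lt_of_ne fun h' => h.ne' (hbs.2.2 i j h'.symm)
    rintro y z (⟨i, j, h, hy, hz⟩ | ⟨i, j, h, hy, hz⟩)
    · exact Or.inl ⟨i, j, hpos i j h, hy, hz⟩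
    · exact Or.inr ⟨i, j, hpos i j h, hy, hz⟩
  rw [Guarantee]
  by_cases hfin : ∀ i j, 0 < w i * bs i j → 0 < v i j
  · obtain ⟨M', hM', hge⟩ := exists_isPrunedMatching_ge hv hw hw1 hacyc' hbs hroot hfin
    rw [fcvx_eq_coe hw hfeas.1 hfin] at hle
    calc fcvx v w b - ((klUniform w + 2 * Real.log 2 + 1 / (2 * Real.exp 1) : ℝ) : EReal)
        ≤ (realObjective v w bs : EReal)
          - ((klUniform w + 2 * Real.log 2 + 1 / (2 * Real.exp 1) : ℝ) : EReal) :=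
          EReal.sub_le_sub hle le_rfl
      _ ≤ ((realObjective v w bs - (klUniform w + 2 * Real.log 2) : ℝ) : EReal) := by
          rw [← EReal.coe_sub, EReal.coe_le_coe_iff]
          have : 0 < 1 / (2 * Real.exp 1) := by positivity
          linarith
      _ ≤ matchingWeight v w bs root M := hge.trans (hmax M' hM')
      _ ≤ NSW v w σ := sum_elog_le_NSW hv hw _ M (fun i j hj => hσL i j hj) hσM
          fun i j hj => (hM.1 i j hj).2 i
  · rw [fcvx_eq_bot hv hfin] at hle
    rw [le_bot_iff.mp hle, EReal.bot_sub]
    exact bot_le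

end Output

end NashWelfare
namespace NashWelfare

namespace RAM

/-! ### A language of counting loops over arrays, compiled to the machine -/

section Bits

theorem add_lt_two_pow {x y a b : ℕ} (hx : x < 2 ^ a) (hy : y < 2 ^ b) :
    x + y < 2 ^ (a + b + 1) := by
  have h1 : (2 : ℕ) ^ a ≤ 2 ^ (a + b) := Nat.pow_le_pow_right two_pos (by omega)
  have h2 : (2 : ℕ) ^ b ≤ 2 ^ (a + b) := Nat.pow_le_pow_right two_pos (by omega)
  rw [pow_succ]
  omega

theorem lt_two_pow_of_le {x a b : ℕ} (hx : x < 2 ^ a) (h : a ≤ b) : x < 2 ^ b :=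
  hx.trans_le (Nat.pow_le_pow_right two_pos h)

theorem Op.eval_lt {o : Op} {x y a b : ℕ} (hx : x < 2 ^ a) (hy : y < 2 ^ b) :
    o.eval x y < 2 ^ (a + b + 1) := by
  cases o with
  | add => exact add_lt_two_pow hx hy
  | sub => exact lt_two_pow_of_le ((Nat.sub_le x y).trans_lt hx) (by omega)
  | mul =>
    refine lt_two_pow_of_le (b := a + b + 1) (a := a + b) ?_ (by omega)
    rw [pow_add]
    exact Nat.mul_lt_mul'' hx hy
  | div => exact lt_two_pow_of_le ((Nat.div_le_self x y).trans_lt hx) (by omega)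

/-- The bit length of the value of an expression, relative to that of the memory cells. -/
def Exp.width : Exp → ℕ
  | .const n => n.size + 1
  | .load _ => 1
  | .bin _ x y => x.width + y.width + 1

/-- The cost of an expression, relative to the bit length of the memory cells. -/
def Exp.weight : Exp → ℕ
  | .const n => n.size + 1
  | .load a => a.weight + a.width + 2
  | .bin _ x y => x.weight + y.weight + 2 * (x.width + y.width) + 2

theorem Exp.eval_lt {M : Memory} {β : ℕ} (hβ : 1 ≤ β) (hM : ∀ a, M a < 2 ^ β) (e : Exp) :
    e.eval M < 2 ^ (β * e.width) := by
  induction e with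
  | const n =>
    refine lt_two_pow_of_le (Nat.lt_size_self n) ?_
    simp only [Exp.width]
    nlinarith
  | load a => simpa [Exp.width, Exp.eval] using hM _
  | bin o x y hx hy =>
    refine lt_two_pow_of_le (Op.eval_lt hx hy) ?_
    simp only [Exp.width]
    nlinarith

theorem Exp.cost_le {M : Memory} {β : ℕ} (hβ : 1 ≤ β) (hM : ∀ a, M a < 2 ^ β) (e : Exp) :
    e.cost M ≤ β * e.weight := by
  induction e with
  | const n =>
    simp only [Exp.cost, Exp.weight]
    nlinarith
  | load a ha =>
    have h1 := Nat.size_le.mpr (Exp.eval_lt hβ hM a)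
    have h2 := Nat.size_le.mpr (hM (a.eval M))
    simp only [Exp.cost, Exp.weight]
    nlinarith
  | bin o x y hx hy =>
    have h1 := Nat.size_le.mpr (Exp.eval_lt hβ hM x)
    have h2 := Nat.size_le.mpr (Exp.eval_lt hβ hM y)
    have h3 := Nat.size_le.mpr (Exp.eval_lt hβ hM (.bin o x y))
    simp only [Exp.cost, Exp.weight, Exp.width, Exp.eval] at h3 ⊢
    nlinarith

/-- A bound for the relative cost of a store. -/
def storeWeight (a e : Exp) : ℕ := a.weight + e.weight + a.width + e.width + 1

theorem store_cost_le {M : Memory} {β : ℕ} (hβ : 1 ≤ β) (hM : ∀ a, M a < 2 ^ β) (a e : Exp) :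
    a.cost M + e.cost M + (a.eval M).size + (e.eval M).size + 1 ≤ β * storeWeight a e := by
  have h1 := Nat.size_le.mpr (Exp.eval_lt hβ hM a)
  have h2 := Nat.size_le.mpr (Exp.eval_lt hβ hM e)
  have h3 := Exp.cost_le hβ hM a
  have h4 := Exp.cost_le hβ hM e
  simp only [storeWeight]
  nlinarith

end Bits

/-- The contents of the arrays: `S a i` is the entry of array `a` at index `i`. -/
abbrev Store := ℕ → ℕ → ℕ

/-- Expressions over arrays and a read-only input. -/
inductive AExp
  | const (n : ℕ)
  | arr (a : ℕ) (i : AExp)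
  | inp (x : AExp)
  | bin (o : Op) (x y : AExp)

/-- The value of an expression; `I 0` is the length of the input. -/
def AExp.eval (I : ℕ → ℕ) (S : Store) : AExp → ℕ
  | .const n => n
  | .arr a i => S a (i.eval I S)
  | .inp x => I (x.eval I S % I 0)
  | .bin o x y => o.eval (x.eval I S) (y.eval I S)

/-- Replace one entry of an array. -/
def upd (S : Store) (a i x : ℕ) : Store := Function.update S a (Function.update (S a) i x)

/-- Commands: `forb v b c` runs `c` for the values `0, 1, …` of the variable `v` less than `b`. -/
inductive Cmd
  | skip
  | set (a : ℕ) (i e : AExp)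
  | seq (c d : Cmd)
  | cond (e : AExp) (c d : Cmd)
  | forb (v b : ℕ) (c : Cmd)

/-- The effect of a command. -/
def Cmd.eval (I : ℕ → ℕ) : Cmd → Store → Store
  | .skip, S => S
  | .set a i e, S => upd S a (i.eval I S) (e.eval I S)
  | .seq c d, S => d.eval I (c.eval I S)
  | .cond e c d, S => if e.eval I S ≠ 0 then c.eval I S else d.eval I S
  | .forb v b c, S => (fun S => upd (c.eval I S) v 0 (c.eval I S v 0 + 1))^[S b 0] (upd S v 0 0)

/-- The arrays that a command may change. -/
def Cmd.writes : Cmd → List ℕ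
  | .skip => []
  | .set a _ _ => [a]
  | .seq c d => c.writes ++ d.writes
  | .cond _ c d => c.writes ++ d.writes
  | .forb v _ c => v :: c.writes

theorem upd_of_ne {S : Store} {a a' i x : ℕ} (h : a' ≠ a) : upd S a i x a' = S a' := by
  simp [upd, h]

theorem upd_same (S : Store) (a i x : ℕ) : upd S a i x a i = x := by simp [upd]

theorem upd_apply (S : Store) (a i x a' i' : ℕ) :
    upd S a i x a' i' = if a' = a ∧ i' = i then x else S a' i' := by
  by_cases h : a' = a
  · subst h
    by_cases h' : i' = i
    · subst h'
      simp [upd]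
    · simp [upd, h']
  · simp [upd, h]

theorem Cmd.eval_frame (I : ℕ → ℕ) (c : Cmd) {a : ℕ} (ha : a ∉ c.writes) (S : Store) :
    c.eval I S a = S a := by
  induction c generalizing S with
  | skip => rfl
  | set b i e => exact upd_of_ne (by simpa [Cmd.writes] using ha)
  | seq c d hc hd =>
    simp only [Cmd.writes, List.mem_append, not_or] at ha
    rw [Cmd.eval, hd ha.2, hc ha.1]
  | cond e c d hc hd =>
    simp only [Cmd.writes, List.mem_append, not_or] at ha
    rw [Cmd.eval]
    split_ifs
    exacts [hc ha.1 S, hd ha.2 S]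
  | forb v b c hc =>
    simp only [Cmd.writes, List.mem_cons, not_or] at ha
    rw [Cmd.eval]
    generalize S b 0 = n
    have h0 : upd S v 0 0 a = S a := upd_of_ne ha.1
    induction n with
    | zero => exact h0
    | succ n ih => rw [Function.iterate_succ_apply', upd_of_ne ha.1, hc ha.2, ih]

/-- The rule for loops: `P k` holds before the `k`-th pass. -/
theorem Cmd.eval_forb (I : ℕ → ℕ) {v b : ℕ} {c : Cmd} (hv : v ∉ c.writes)
    (S : Store) (P : ℕ → Store → Prop) (h0 : P 0 (upd S v 0 0))
    (hstep : ∀ k S', k < S b 0 → S' v 0 = k →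
      (∀ a, a ≠ v → a ∉ c.writes → S' a = S a) → P k S' →
      P (k + 1) (upd (c.eval I S') v 0 (k + 1))) :
    P (S b 0) ((Cmd.forb v b c).eval I S) := by
  rw [Cmd.eval]
  have key : ∀ k, k ≤ S b 0 → ∀ S',
      S' = (fun S => upd (c.eval I S) v 0 (c.eval I S v 0 + 1))^[k] (upd S v 0 0) →
      P k S' ∧ S' v 0 = k ∧ ∀ a, a ≠ v → a ∉ c.writes → S' a = S a := by
    intro k
    induction k with
    | zero =>
      rintro _ S' rfl
      exact ⟨h0, upd_same _ _ _ _, fun a ha _ => upd_of_ne ha⟩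
    | succ k ih =>
      rintro hk S' rfl
      obtain ⟨h1, h2, h3⟩ := ih (by omega) _ rfl
      rw [Function.iterate_succ_apply']
      set S'' := (fun S => upd (c.eval I S) v 0 (c.eval I S v 0 + 1))^[k] (upd S v 0 0)
      have h4 : c.eval I S'' v 0 = k := by rw [c.eval_frame I hv, h2]
      rw [h4]
      refine ⟨hstep k S'' (by omega) h2 h3 h1, upd_same _ _ _ _, fun a ha ha' => ?_⟩
      rw [upd_of_ne ha, c.eval_frame I ha', h3 a ha ha']
  exact (key _ le_rfl _ rfl).1

/-- The number of arrays. -/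
def numArrays : ℕ := 64

/-- The address of an array entry: the arrays are interleaved behind the input. -/
def addrExp (a : ℕ) (i : Exp) : Exp :=
  .bin .add (.load (.const 0)) (.bin .add (.bin .mul (.const numArrays) i) (.const a))

/-- Compilation of expressions; addresses of the input are taken modulo its length. -/
def AExp.compile : AExp → Exp
  | .const n => .const n
  | .arr a i => .load (addrExp a i.compile)
  | .inp x => .load (.bin .sub x.compile
      (.bin .mul (.load (.const 0)) (.bin .div x.compile (.load (.const 0)))))
  | .bin o x y => .bin o x.compile y.compile

/-- Compilation of assignments. -/
def storeProg (a : ℕ) (i e : AExp) : Prog := .store (addrExp a i.compile) e.compile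

/-- Compilation of commands. -/
def Cmd.compile : Cmd → Prog
  | .skip => .skip
  | .set a i e => storeProg a i e
  | .seq c d => .seq c.compile d.compile
  | .cond e c d => .cond e.compile c.compile d.compile
  | .forb v b c => .seq (storeProg v (.const 0) (.const 0))
      (.loop (AExp.bin .sub (.arr b (.const 0)) (.arr v (.const 0))).compile
        (.seq c.compile (storeProg v (.const 0) (.bin .add (.arr v (.const 0)) (.const 1)))))

/-- The memory `M` holds the input `I` and the arrays `S`. -/
structure Rep (I : ℕ → ℕ) (S : Store) (M : Memory) : Prop where
  pos : 0 < I 0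
  inp : ∀ x < I 0, M x = I x
  arr : ∀ a < numArrays, ∀ i, M (I 0 + (numArrays * i + a)) = S a i

/-- Only existing arrays are read. -/
def AExp.wf : AExp → Bool
  | .const _ => true
  | .arr a i => decide (a < numArrays) && i.wf
  | .inp x => x.wf
  | .bin _ x y => x.wf && y.wf

variable {I : ℕ → ℕ} {S : Store} {M : Memory}

theorem Rep.eval_addrExp (h : Rep I S M) (a : ℕ) (e : Exp) :
    (addrExp a e).eval M = I 0 + (numArrays * e.eval M + a) := by
  simp [addrExp, Exp.eval, Op.eval, h.inp 0 h.pos]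

theorem Rep.eval_compile (h : Rep I S M) {e : AExp} (he : e.wf = true) :
    e.compile.eval M = e.eval I S := by
  induction e with
  | const n => rfl
  | arr a i hi =>
    simp only [AExp.wf, Bool.and_eq_true, decide_eq_true_eq] at he
    rw [AExp.compile, Exp.eval, h.eval_addrExp, hi he.2, h.arr a he.1, AExp.eval]
  | inp x hx =>
    simp only [AExp.wf] at he
    have h0 := h.inp 0 h.pos
    rw [AExp.eval, ← hx he, ← h.inp _ (Nat.mod_lt _ h.pos), Nat.mod_def]
    simp only [AExp.compile, Exp.eval, Op.eval, h0]
  | bin o x y hx hy =>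
    simp only [AExp.wf, Bool.and_eq_true] at he
    rw [AExp.compile, Exp.eval, AExp.eval, hx he.1, hy he.2]

theorem addr_inj {a a' i i' : ℕ} (ha : a < numArrays) (ha' : a' < numArrays)
    (h : numArrays * i' + a' = numArrays * i + a) : a' = a ∧ i' = i := by
  simp only [numArrays] at *
  omega

theorem Rep.store (h : Rep I S M) {a : ℕ} (ha : a < numArrays) (i x : ℕ) :
    Rep I (upd S a i x) (Function.update M (I 0 + (numArrays * i + a)) x) := by
  refine ⟨h.pos, fun y hy => ?_, fun a' ha' i' => ?_⟩
  · rw [Function.update_of_ne (by omega), h.inp y hy]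
  · rw [upd_apply, Function.update_apply]
    by_cases hc : a' = a ∧ i' = i
    · rw [if_pos hc, if_pos (by rw [hc.1, hc.2])]
    · rw [if_neg hc, if_neg fun h' => hc (addr_inj ha ha' (by omega)), h.arr a' ha' i']

/-- All cells are bounded if the input and the arrays are. -/
theorem Rep.lt (h : Rep I S M) {β : ℕ} (hI : ∀ x, I x < 2 ^ β) (hS : ∀ a i, S a i < 2 ^ β) :
    ∀ x, M x < 2 ^ β := by
  intro x
  rcases lt_or_ge x (I 0) with hx | hx
  · rw [h.inp x hx]
    exact hI x
  · have := h.arr ((x - I 0) % numArrays) (Nat.mod_lt _ (by decide)) ((x - I 0) / numArrays)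
    rw [Nat.div_add_mod, Nat.add_sub_cancel' hx] at this
    rw [this]
    exact hS _ _

theorem Rep.runs_store (h : Rep I S M) {β : ℕ} (hβ : 1 ≤ β) (hI : ∀ x, I x < 2 ^ β)
    (hS : ∀ a i, S a i < 2 ^ β) {a : ℕ} (ha : a < numArrays) {i e : AExp} (hi : i.wf = true)
    (he : e.wf = true) :
    ∃ M' t, Runs (storeProg a i e) M M' t ∧ Rep I (upd S a (i.eval I S) (e.eval I S)) M' ∧
      t ≤ β * storeWeight (addrExp a i.compile) e.compile := by
  refine ⟨_, _, Runs.store _ _ _, ?_, store_cost_le hβ (h.lt hI hS) _ _⟩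
  rw [h.eval_addrExp, h.eval_compile hi, h.eval_compile he]
  exact h.store ha _ _

/-! ### Automatic time bounds

Arrays of class `2` hold loop counters, those of class `1` hold coefficients, and those of class
`0` hold the results of computations that are linear in entries of class `0`. -/

/-- Expressions without entries of class `0`. -/
def AExp.coef (cls : ℕ → ℕ) : AExp → Bool
  | .const _ => true
  | .arr a _ => decide (cls a ≠ 0)
  | .inp _ => true
  | .bin _ x y => x.coef cls && y.coef cls

/-- Expressions linear in the entries of class `0`. -/
def AExp.lin (cls : ℕ → ℕ) : AExp → Bool
  | .const _ => true
  | .arr _ _ => true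
  | .inp _ => true
  | .bin .add x y => x.lin cls && y.lin cls
  | .bin .sub x _ => x.lin cls
  | .bin .mul x y => (x.lin cls && y.coef cls) || (x.coef cls && y.lin cls)
  | .bin .div x _ => x.lin cls

/-- The growth caused by an expression. -/
def AExp.growth : AExp → ℕ
  | .const n => n.size + 1
  | .arr _ _ => 1
  | .inp _ => 1
  | .bin _ x y => x.growth + y.growth + 1

/-- The bounds on the input and on the arrays. -/
structure Bounded (cls : ℕ → ℕ) (β N : ℕ) (I : ℕ → ℕ) (S : Store) : Prop where
  one_le : 1 ≤ N
  le : N ≤ β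
  inp : ∀ x, I x < 2 ^ N
  big : ∀ a i, S a i < 2 ^ β
  coef : ∀ a i, cls a ≠ 0 → S a i < 2 ^ N
  counter : ∀ a i, cls a = 2 → S a i ≤ N

variable {cls : ℕ → ℕ} {β N : ℕ}

theorem Bounded.inp' (h : Bounded cls β N I S) (x : ℕ) : I x < 2 ^ β :=
  lt_two_pow_of_le (h.inp x) h.le

theorem Bounded.mono (h : Bounded cls β N I S) {β' : ℕ} (hβ : β ≤ β') : Bounded cls β' N I S :=
  ⟨h.one_le, h.le.trans hβ, h.inp, fun a i => lt_two_pow_of_le (h.big a i) hβ, h.coef, h.counter⟩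

theorem Bounded.coef_lt (h : Bounded cls β N I S) {e : AExp} (he : e.coef cls = true) :
    e.eval I S < 2 ^ (N * e.growth) := by
  have hN := h.one_le
  induction e with
  | const n =>
    refine lt_two_pow_of_le (Nat.lt_size_self n) ?_
    simp only [AExp.growth]
    nlinarith
  | arr a i _ =>
    simp only [AExp.coef, decide_eq_true_eq] at he
    simpa [AExp.growth, AExp.eval] using h.coef a _ he
  | inp x _ => simpa [AExp.growth, AExp.eval] using h.inp _
  | bin o x y hx hy =>
    simp only [AExp.coef, Bool.and_eq_true] at he
    refine lt_two_pow_of_le (Op.eval_lt (hx he.1) (hy he.2)) ?_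
    simp only [AExp.growth]
    nlinarith

theorem Bounded.lin_lt (h : Bounded cls β N I S) {e : AExp} (he : e.lin cls = true) :
    e.eval I S < 2 ^ (β + N * e.growth) := by
  have hN := h.one_le
  induction e with
  | const n =>
    refine lt_two_pow_of_le (Nat.lt_size_self n) ?_
    simp only [AExp.growth]
    nlinarith
  | arr a i _ => exact lt_two_pow_of_le (h.big a _) (by omega)
  | inp x _ => exact lt_two_pow_of_le (h.inp' _) (by omega)
  | bin o x y hx hy =>
    have hg : AExp.growth (.bin o x y) = x.growth + y.growth + 1 := rfl
    rw [hg]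
    cases o with
    | add =>
      simp only [AExp.lin, Bool.and_eq_true] at he
      have h1 := lt_two_pow_of_le (hx he.1)
        (by nlinarith : β + N * x.growth ≤ β + N * (x.growth + y.growth))
      have h2 := lt_two_pow_of_le (hy he.2)
        (by nlinarith : β + N * y.growth ≤ β + N * (x.growth + y.growth))
      have h3 : AExp.eval I S (.bin .add x y) < 2 ^ (β + N * (x.growth + y.growth) + 1) := by
        rw [pow_succ]
        simp only [AExp.eval, Op.eval]
        omega
      exact lt_two_pow_of_le h3 (by nlinarith)
    | sub =>
      exact lt_two_pow_of_le ((Nat.sub_le _ _).trans_lt (hx he)) (by nlinarith)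
    | mul =>
      simp only [AExp.lin, Bool.or_eq_true, Bool.and_eq_true] at he
      have h3 : AExp.eval I S (.bin .mul x y) < 2 ^ (β + N * (x.growth + y.growth)) := by
        rcases he with he | he
        · have := Nat.mul_lt_mul'' (hx he.1) (h.coef_lt he.2)
          rw [← pow_add] at this
          exact this.trans_eq (by ring)
        · have := Nat.mul_lt_mul'' (h.coef_lt he.1) (hy he.2)
          rw [← pow_add] at this
          exact this.trans_eq (by ring)
      exact lt_two_pow_of_le h3 (by nlinarith)
    | div =>
      exact lt_two_pow_of_le ((Nat.div_le_self _ _).trans_lt (hx he)) (by nlinarith)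

/-- The commands to which the time bound applies. -/
def Cmd.ok (cls : ℕ → ℕ) : Cmd → Bool
  | .skip => true
  | .set a i e => decide (a < numArrays) && decide (cls a = 0) && i.wf && e.wf && e.lin cls
  | .seq c d => c.ok cls && d.ok cls
  | .cond e c d => e.wf && c.ok cls && d.ok cls
  | .forb v b c => decide (v < numArrays) && decide (b < numArrays) && decide (cls v = 2) &&
      decide (cls b = 2) && decide (v ≠ b) && !(c.writes.contains v) && !(c.writes.contains b) &&
      c.ok cls

/-- The costs of the test and of the increment of a loop. -/
def loopWeight (v b : ℕ) : ℕ :=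
  (AExp.bin .sub (.arr b (.const 0)) (.arr v (.const 0))).compile.weight
    + storeWeight (addrExp v (AExp.const 0).compile)
      (AExp.bin .add (.arr v (.const 0)) (.const 1)).compile
    + storeWeight (addrExp v (AExp.const 0).compile) (AExp.const 0).compile + 2

/-- The time, and the growth of the numbers, for loop bounds at most `N`. -/
def Cmd.time : Cmd → ℕ → ℕ
  | .skip, _ => 1
  | .set a i e, N => N * e.growth + storeWeight (addrExp a i.compile) e.compile
  | .seq c d, N => c.time N + d.time N + 1
  | .cond e c d, N => e.compile.weight + c.time N + d.time N + 1
  | .forb v b c, N => N * (c.time N + loopWeight v b) + 2 * loopWeight v b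

theorem Bounded.upd_big (h : Bounded cls β N I S) {a : ℕ} (ha : cls a = 0) (i : ℕ) {x β' : ℕ}
    (hβ : β ≤ β') (hx : x < 2 ^ β') : Bounded cls β' N I (upd S a i x) := by
  refine ⟨h.one_le, h.le.trans hβ, h.inp, fun a' i' => ?_, fun a' i' h' => ?_, fun a' i' h' => ?_⟩
  · rw [upd_apply]
    split_ifs
    exacts [hx, lt_two_pow_of_le (h.big a' i') hβ]
  · rw [upd_of_ne (by rintro rfl; exact h' ha)]
    exact h.coef a' i' h'
  · rw [upd_of_ne (by rintro rfl; omega)]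
    exact h.counter a' i' h'

theorem Bounded.upd_counter (h : Bounded cls β N I S) (a i : ℕ) {x : ℕ} (hx : x ≤ N) :
    Bounded cls β N I (upd S a i x) := by
  have hx' : x < 2 ^ N := hx.trans_lt Nat.lt_two_pow_self
  refine ⟨h.one_le, h.le, h.inp, fun a' i' => ?_, fun a' i' h' => ?_, fun a' i' h' => ?_⟩
  · rw [upd_apply]
    split_ifs
    exacts [lt_two_pow_of_le hx' h.le, h.big a' i']
  · rw [upd_apply]
    split_ifs
    exacts [hx', h.coef a' i' h']
  · rw [upd_apply]
    split_ifs
    exacts [hx, h.counter a' i' h']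

theorem Cmd.runs_loop {c : Cmd} {v b T : ℕ} (hv : v < numArrays) (hb : b < numArrays)
    (hcb : cls b = 2) (hvb : v ≠ b) (hvc : v ∉ c.writes) (hbc : b ∉ c.writes)
    (hc : ∀ (β : ℕ) (S : Store) (M : Memory), Rep I S M → Bounded cls β N I S →
      ∃ M' t, Runs c.compile M M' t ∧ Rep I (c.eval I S) M' ∧
        Bounded cls (β + T) N I (c.eval I S) ∧ t ≤ T * (β + T)) (r : ℕ) :
    ∀ (β : ℕ) (S : Store) (M : Memory), Rep I S M → Bounded cls β N I S → S v 0 + r = S b 0 →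
      ∃ M' t, Runs (.loop (AExp.bin .sub (.arr b (.const 0)) (.arr v (.const 0))).compile
          (.seq c.compile (storeProg v (.const 0) (.bin .add (.arr v (.const 0)) (.const 1)))))
          M M' t ∧
        Rep I ((fun S => upd (c.eval I S) v 0 (c.eval I S v 0 + 1))^[r] S) M' ∧
        Bounded cls (β + r * (T + loopWeight v b)) N I
          ((fun S => upd (c.eval I S) v 0 (c.eval I S v 0 + 1))^[r] S) ∧
        t ≤ (r * (T + loopWeight v b) + loopWeight v b) * (β + r * (T + loopWeight v b)) := by
  have hwf : (AExp.bin .sub (.arr b (.const 0)) (.arr v (.const 0))).wf = true := by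
    simp [AExp.wf, hv, hb]
  have hwf' : (AExp.bin .add (.arr v (.const 0)) (.const 1)).wf = true := by
    simp [AExp.wf, hv]
  induction r with
  | zero =>
    intro β S M hR hB hr
    have hβ : 1 ≤ β := hB.one_le.trans hB.le
    refine ⟨M, _, Runs.loopStop ?_, hR, by simpa using hB, ?_⟩
    · rw [hR.eval_compile hwf]
      simp only [AExp.eval, Op.eval]
      omega
    · have := Exp.cost_le hβ (hR.lt hB.inp' hB.big)
        (AExp.bin .sub (.arr b (.const 0)) (.arr v (.const 0))).compile
      simp only [zero_mul, zero_add, add_zero, loopWeight]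
      nlinarith
  | succ r ih =>
    intro β S M hR hB hr
    have hβ : 1 ≤ β := hB.one_le.trans hB.le
    obtain ⟨M₁, t₁, hrun₁, hR₁, hB₁, ht₁⟩ := hc β S M hR hB
    obtain ⟨M₂, t₂, hrun₂, hR₂, ht₂⟩ := hR₁.runs_store (hB₁.one_le.trans hB₁.le) hB₁.inp'
      hB₁.big hv (i := .const 0) rfl hwf'
    have e : upd (c.eval I S) v (AExp.eval I (c.eval I S) (.const 0))
        (AExp.eval I (c.eval I S) (.bin .add (.arr v (.const 0)) (.const 1)))
        = upd (c.eval I S) v 0 (c.eval I S v 0 + 1) := rfl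
    rw [e] at hR₂
    have hcv : c.eval I S v 0 = S v 0 := by rw [c.eval_frame I hvc]
    have hbv : S b 0 ≤ N := hB.counter b 0 hcb
    have hB₂ : Bounded cls (β + T) N I (upd (c.eval I S) v 0 (c.eval I S v 0 + 1)) :=
      hB₁.upd_counter v 0 (by omega)
    obtain ⟨M₃, t₃, hrun₃, hR₃, hB₃, ht₃⟩ := ih (β + T) _ M₂ hR₂ hB₂ (by
      rw [upd_same, upd_of_ne hvb.symm, c.eval_frame I hbc, hcv]
      omega)
    refine ⟨M₃, _, Runs.loopStep ?_ (Runs.seq hrun₁ hrun₂) hrun₃, ?_, ?_, ?_⟩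
    · rw [hR.eval_compile hwf]
      simp only [AExp.eval, Op.eval]
      omega
    · rwa [Function.iterate_succ_apply]
    · rw [Function.iterate_succ_apply]
      exact hB₃.mono (by nlinarith)
    · have h1 := Exp.cost_le hβ (hR.lt hB.inp' hB.big)
        (AExp.bin .sub (.arr b (.const 0)) (.arr v (.const 0))).compile
      have hκ : (AExp.bin .sub (.arr b (.const 0)) (.arr v (.const 0))).compile.weight
          + storeWeight (addrExp v (AExp.const 0).compile)
          (AExp.bin .add (.arr v (.const 0)) (.const 1)).compile + 2 ≤ loopWeight v b := by
        rw [loopWeight]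
        omega
      generalize (AExp.bin .sub (.arr b (.const 0)) (.arr v (.const 0))).compile.weight = κ₁ at *
      generalize storeWeight (addrExp v (AExp.const 0).compile)
        (AExp.bin .add (.arr v (.const 0)) (.const 1)).compile = κ₂ at *
      generalize loopWeight v b = K at *
      generalize hBdef : β + (r + 1) * (T + K) = B
      replace hBdef := hBdef.symm
      have hB0 : β ≤ B := by rw [hBdef]; omega
      have hB1 : β + T ≤ B := by rw [hBdef]; nlinarith
      have hB2 : β + T + r * (T + K) ≤ B := by rw [hBdef]; nlinarith
      have g1 : β * κ₁ ≤ κ₁ * B := by nlinarith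
      have g2 : T * (β + T) ≤ T * B := Nat.mul_le_mul_left _ hB1
      have g3 : (β + T) * κ₂ ≤ κ₂ * B := by nlinarith
      have g4 : (r * (T + K) + K) * (β + T + r * (T + K)) ≤ (r * (T + K) + K) * B :=
        Nat.mul_le_mul_left _ hB2
      have g5 : 2 ≤ 2 * B := by omega
      have g6 : (κ₁ + T + κ₂ + 2 + (r * (T + K) + K)) * B ≤ ((r + 1) * (T + K) + K) * B := by
        refine Nat.mul_le_mul_right _ ?_
        rw [add_mul, one_mul]
        omega
      have g7 : (κ₁ + T + κ₂ + 2 + (r * (T + K) + K)) * B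
          = κ₁ * B + T * B + κ₂ * B + 2 * B + (r * (T + K) + K) * B := by ring
      omega

/-- Compiled commands run correctly and within the time bound. -/
theorem Cmd.runs {c : Cmd} (hok : c.ok cls = true) :
    ∀ {β : ℕ} {S : Store} {M : Memory}, Rep I S M → Bounded cls β N I S →
      ∃ M' t, Runs c.compile M M' t ∧ Rep I (c.eval I S) M' ∧
        Bounded cls (β + c.time N) N I (c.eval I S) ∧ t ≤ c.time N * (β + c.time N) := by
  induction c with
  | skip =>
    intro β S M hR hB
    exact ⟨M, 1, Runs.skip M, hR, hB.mono (by omega), by simp only [Cmd.time]; omega⟩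
  | set a i e =>
    intro β S M hR hB
    simp only [Cmd.ok, Bool.and_eq_true, decide_eq_true_eq] at hok
    obtain ⟨⟨⟨⟨ha, hcl⟩, hi⟩, he⟩, hl⟩ := hok
    obtain ⟨M', t, h1, h2, h3⟩ := hR.runs_store (hB.one_le.trans hB.le) hB.inp' hB.big ha hi he
    refine ⟨M', t, h1, h2, hB.upd_big hcl _ (by omega)
      (lt_two_pow_of_le (hB.lin_lt hl) ?_), ?_⟩
    · simp only [Cmd.time]
      omega
    · simp only [Cmd.time]
      refine h3.trans ?_
      rw [mul_comm]
      exact Nat.mul_le_mul (by omega) (by omega)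
  | seq c d hc hd =>
    intro β S M hR hB
    simp only [Cmd.ok, Bool.and_eq_true] at hok
    obtain ⟨M₁, t₁, hrun₁, hR₁, hB₁, ht₁⟩ := hc hok.1 hR hB
    obtain ⟨M₂, t₂, hrun₂, hR₂, hB₂, ht₂⟩ := hd hok.2 hR₁ hB₁
    refine ⟨M₂, _, Runs.seq hrun₁ hrun₂, hR₂, hB₂.mono ?_, ?_⟩
    · simp only [Cmd.time]
      omega
    · simp only [Cmd.time]
      nlinarith
  | cond e c d hc hd =>
    intro β S M hR hB
    simp only [Cmd.ok, Bool.and_eq_true] at hok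
    have h1 := Exp.cost_le (hB.one_le.trans hB.le) (hR.lt hB.inp' hB.big) e.compile
    have h2 := hR.eval_compile hok.1.1
    have h3 : 1 ≤ β := hB.one_le.trans hB.le
    by_cases he : e.eval I S = 0
    · obtain ⟨M₂, t₂, hrun₂, hR₂, hB₂, ht₂⟩ := hd hok.2 hR hB
      refine ⟨M₂, _, Runs.condFalse (h2.trans he) hrun₂, ?_, ?_, ?_⟩
      · simpa [Cmd.eval, he] using hR₂
      · simp only [Cmd.eval, he, ne_eq, not_true_eq_false, if_false]
        exact hB₂.mono (by simp only [Cmd.time]; omega)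
      · simp only [Cmd.time]
        nlinarith
    · obtain ⟨M₂, t₂, hrun₂, hR₂, hB₂, ht₂⟩ := hc hok.1.2 hR hB
      refine ⟨M₂, _, Runs.condTrue (fun h => he (h2.symm.trans h)) hrun₂, ?_, ?_, ?_⟩
      · simpa [Cmd.eval, he] using hR₂
      · simp only [Cmd.eval, ne_eq, he, not_false_eq_true, if_true]
        exact hB₂.mono (by simp only [Cmd.time]; omega)
      · simp only [Cmd.time]
        nlinarith
  | forb v b c hc =>
    intro β S M hR hB
    simp only [Cmd.ok, Bool.and_eq_true, decide_eq_true_eq, Bool.not_eq_true',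
      List.contains_eq_mem, decide_eq_false_iff_not] at hok
    obtain ⟨⟨⟨⟨⟨⟨⟨hv, hb⟩, hcv⟩, hcb⟩, hvb⟩, hvc⟩, hbc⟩, hok⟩ := hok
    have hβ : 1 ≤ β := hB.one_le.trans hB.le
    obtain ⟨M₁, t₁, hrun₁, hR₁, ht₁⟩ := hR.runs_store hβ hB.inp' hB.big hv
      (i := .const 0) (e := .const 0) rfl rfl
    have hR₁' : Rep I (upd S v 0 0) M₁ := hR₁
    have hB₁ := hB.upd_counter v 0 (Nat.zero_le N)
    obtain ⟨M₂, t₂, hrun₂, hR₂, hB₂, ht₂⟩ := Cmd.runs_loop (T := c.time N) hv hb hcb hvb hvc hbc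
      (fun β S M => hc hok) (S b 0) β _ M₁ hR₁' hB₁ (by
        rw [upd_same, upd_of_ne hvb.symm]
        omega)
    have hbN : S b 0 ≤ N := hB.counter b 0 hcb
    have hmul : S b 0 * (c.time N + loopWeight v b) ≤ N * (c.time N + loopWeight v b) :=
      Nat.mul_le_mul_right _ hbN
    refine ⟨M₂, _, Runs.seq hrun₁ hrun₂, hR₂, hB₂.mono ?_, ?_⟩
    · simp only [Cmd.time]
      omega
    · have hκ : storeWeight (addrExp v (AExp.const 0).compile) (AExp.const 0).compile + 1
          ≤ loopWeight v b := by
        simp only [loopWeight]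
        omega
      simp only [Cmd.time]
      generalize storeWeight (addrExp v (AExp.const 0).compile) (AExp.const 0).compile = κ at *
      generalize loopWeight v b = K at *
      generalize N * (c.time N + K) = R at *
      have g1 : (S b 0 * (c.time N + K) + K) * (β + S b 0 * (c.time N + K))
          ≤ (R + K) * (β + (R + 2 * K)) := Nat.mul_le_mul (by omega) (by omega)
      have g2 : β * κ + 1 ≤ K * (β + (R + 2 * K)) := by nlinarith
      have g3 : (R + 2 * K) * (β + (R + 2 * K)) = (R + K) * (β + (R + 2 * K))
          + K * (β + (R + 2 * K)) := by ring
      omega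

theorem Cmd.exists_polynomial_time (c : Cmd) : ∃ p : Polynomial ℕ, ∀ N, c.time N = p.eval N := by
  induction c with
  | skip => exact ⟨1, fun N => by simp [Cmd.time]⟩
  | set a i e =>
    exact ⟨.X * .C e.growth + .C (storeWeight (addrExp a i.compile) e.compile),
      fun N => by simp [Cmd.time]⟩
  | seq c d hc hd =>
    obtain ⟨p, hp⟩ := hc
    obtain ⟨q, hq⟩ := hd
    exact ⟨p + q + 1, fun N => by simp [Cmd.time, hp, hq]⟩
  | cond e c d hc hd =>
    obtain ⟨p, hp⟩ := hc
    obtain ⟨q, hq⟩ := hd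
    exact ⟨.C e.compile.weight + p + q + 1, fun N => by simp [Cmd.time, hp, hq]⟩
  | forb v b c hc =>
    obtain ⟨p, hp⟩ := hc
    exact ⟨.X * (p + .C (loopWeight v b)) + .C (2 * loopWeight v b),
      fun N => by simp [Cmd.time, hp]⟩

end RAM

end NashWelfare
namespace NashWelfare

/-! ### Maximum weight matchings in forests by eliminating agents -/

section Elimination

/-- `M` matches agents to items below `m` along the edges `h`. -/
def IsMatching (m : ℕ) (h : ℕ → ℕ → Prop) (M : ℕ → Option ℕ) : Prop :=
  (∀ i j, M i = some j → j < m ∧ h i j) ∧ ∀ i i' j, M i = some j → M i' = some j → i = i'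

open Classical in
/-- The items with a neighbour in `U`. -/
noncomputable def openItems (m : ℕ) (h : ℕ → ℕ → Prop) (U : Finset ℕ) : Finset ℕ :=
  (Finset.range m).filter fun j => ∃ i ∈ U, h i j

/-- Agent `i` earns `a i` if it is unmatched and `c i j` if it is matched to `j`. -/
def earning (a : ℕ → ℕ) (c : ℕ → ℕ → ℕ) (i : ℕ) (o : Option ℕ) : ℕ := o.elim (a i) (c i)

open Classical in
/-- The tables `C` and `D` after the agents outside `U` have been eliminated: `C j` and `D j` are
the best earnings of the agents below item `j` without and with the use of `j`; at index `m`, `C`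
accounts for the agents that are below no item. -/
structure TableInv (n m : ℕ) (h : ℕ → ℕ → Prop) (a : ℕ → ℕ) (c : ℕ → ℕ → ℕ) (U : Finset ℕ)
    (C D : ℕ → ℕ) : Prop where
  le : ∀ j ∈ openItems m h U, C j ≤ D j
  complete : ∀ M, IsMatching m h M → ∑ i ∈ Finset.range n \ U, earning a c i (M i)
    ≤ C m + ∑ j ∈ openItems m h U, if ∃ i ∈ Finset.range n \ U, M i = some j then D j else C j
  sound : ∀ Z : Finset ℕ, ∃ M, IsMatching m h M ∧
    (∀ i j, M i = some j → i ∈ Finset.range n \ U ∧ (j ∈ openItems m h U → j ∉ Z)) ∧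
    ∑ i ∈ Finset.range n \ U, earning a c i (M i)
      = C m + ∑ j ∈ openItems m h U, if j ∈ Z then C j else D j

variable {n m : ℕ} {h : ℕ → ℕ → Prop} {a : ℕ → ℕ} {c : ℕ → ℕ → ℕ} {U : Finset ℕ} {C D : ℕ → ℕ}

theorem mem_openItems {j : ℕ} : j ∈ openItems m h U ↔ j < m ∧ ∃ i ∈ U, h i j := by
  simp [openItems]

theorem TableInv.init : TableInv n m h a c (Finset.range n) (fun _ => 0) fun _ => 0 := by
  refine ⟨fun _ _ => le_rfl, fun M _ => by simp, fun Z => ⟨fun _ => none, ?_, ?_, ?_⟩⟩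
  · exact ⟨fun i j h => by simp at h, fun i i' j h => by simp at h⟩
  · exact fun i j h => by simp at h
  · simp

open Classical in
/-- The children of agent `i`: the items whose only neighbour in `U` is `i`. -/
noncomputable def childItems (m : ℕ) (h : ℕ → ℕ → Prop) (U : Finset ℕ) (i : ℕ) : Finset ℕ :=
  (Finset.range m).filter fun j => h i j ∧ ∀ i' ∈ U, h i' j → i' = i

theorem mem_childItems {i j : ℕ} :
    j ∈ childItems m h U i ↔ j < m ∧ h i j ∧ ∀ i' ∈ U, h i' j → i' = i := by
  simp [childItems]

/-- The elimination of agent `i`, all of whose items except possibly `p` are its children. -/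
structure IsElimination (m : ℕ) (h : ℕ → ℕ → Prop) (a : ℕ → ℕ) (c : ℕ → ℕ → ℕ) (U : Finset ℕ)
    (i p T₀ : ℕ) (C D C' D' : ℕ → ℕ) : Prop where
  parent : ∀ j < m, h i j → j ∉ childItems m h U i → j = p
  shared : p ∉ childItems m h U i ∧ (p = m ∨ p < m ∧ h i p)
  ge_unmatched : ∑ j ∈ childItems m h U i, D j + a i ≤ T₀
  ge_matched : ∀ j ∈ childItems m h U i, ∑ k ∈ (childItems m h U i).erase j, D k + C j + c i j ≤ T₀
  attained : T₀ = ∑ j ∈ childItems m h U i, D j + a i ∨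
    ∃ j ∈ childItems m h U i, T₀ = ∑ k ∈ (childItems m h U i).erase j, D k + C j + c i j
  other : ∀ j ≠ p, C' j = C j ∧ D' j = D j
  low : C' p = C p + T₀
  high : p < m → D' p = max (D p + T₀) (C p + (∑ j ∈ childItems m h U i, D j + c i p))

theorem openItems_eq_union {i : ℕ} (hi : i ∈ U) :
    openItems m h U = childItems m h U i ∪ openItems m h (U.erase i) := by
  ext j
  simp only [Finset.mem_union, mem_openItems, mem_childItems, Finset.mem_erase]
  constructor
  · rintro ⟨hj, k, hk, hkj⟩
    by_cases hex : ∃ i', (i' ≠ i ∧ i' ∈ U) ∧ h i' j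
    · exact Or.inr ⟨hj, hex⟩
    · push Not at hex
      have : k = i := by
        by_contra hne
        exact hex k ⟨hne, hk⟩ hkj
      subst this
      refine Or.inl ⟨hj, hkj, fun i' hi' hij => ?_⟩
      by_contra hne
      exact hex i' ⟨hne, hi'⟩ hij
  · rintro (⟨hj, hij, _⟩ | ⟨hj, k, ⟨_, hk⟩, hkj⟩)
    exacts [⟨hj, i, hi, hij⟩, ⟨hj, k, hk, hkj⟩]

theorem disjoint_childItems {i : ℕ} :
    Disjoint (childItems m h U i) (openItems m h (U.erase i)) := by
  rw [Finset.disjoint_left]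
  intro j hj hj'
  obtain ⟨_, k, hk, hkj⟩ := mem_openItems.mp hj'
  exact (Finset.mem_erase.mp hk).1 ((mem_childItems.mp hj).2.2 k (Finset.mem_erase.mp hk).2 hkj)

theorem sum_openItems {i : ℕ} (hi : i ∈ U) (f : ℕ → ℕ) :
    ∑ j ∈ openItems m h U, f j
      = ∑ j ∈ childItems m h U i, f j + ∑ j ∈ openItems m h (U.erase i), f j := by
  rw [openItems_eq_union hi, Finset.sum_union disjoint_childItems]

theorem range_sdiff_erase {i : ℕ} (hi : i ∈ U) (hin : i < n) :
    Finset.range n \ U.erase i = insert i (Finset.range n \ U) := by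
  ext k
  simp only [Finset.mem_sdiff, Finset.mem_range, Finset.mem_erase, Finset.mem_insert]
  by_cases hk : k = i
  · subst hk
    simp [hin]
  · simp [hk]

variable {i p T₀ : ℕ} {C' D' : ℕ → ℕ}

theorem IsElimination.mem_openItems (hE : IsElimination m h a c U i p T₀ C D C' D') (hp : p < m) :
    p ∈ openItems m h (U.erase i) := by
  obtain ⟨h1, h2 | h2⟩ := hE.shared
  · omega
  · rw [mem_childItems] at h1
    push Not at h1
    obtain ⟨k, hk, hkp, hne⟩ := h1 hp h2.2
    exact NashWelfare.mem_openItems.mpr ⟨hp, k, Finset.mem_erase.mpr ⟨hne, hk⟩, hkp⟩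

theorem TableInv.step_le (hT : TableInv n m h a c U C D) (hi : i ∈ U)
    (hE : IsElimination m h a c U i p T₀ C D C' D') :
    ∀ j ∈ openItems m h (U.erase i), C' j ≤ D' j := by
  intro j hj
  by_cases hjp : j = p
  · subst hjp
    have hjm := (mem_openItems.mp hj).1
    have h1 := hT.le j (by rw [openItems_eq_union hi]; exact Finset.mem_union_right _ hj)
    rw [hE.low, hE.high hjm]
    exact (Nat.add_le_add_right h1 _).trans (le_max_left _ _)
  · rw [(hE.other j hjp).1, (hE.other j hjp).2]
    exact hT.le j (by rw [openItems_eq_union hi]; exact Finset.mem_union_right _ hj)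

theorem TableInv.step_complete (hT : TableInv n m h a c U C D) (hi : i ∈ U) (hin : i < n)
    (hE : IsElimination m h a c U i p T₀ C D C' D') (M : ℕ → Option ℕ) (hM : IsMatching m h M) :
    ∑ k ∈ Finset.range n \ U.erase i, earning a c k (M k) ≤ C' m +
      ∑ j ∈ openItems m h (U.erase i),
        @ite _ (∃ k ∈ Finset.range n \ U.erase i, M k = some j) (Classical.propDecidable _)
          (D' j) (C' j) := by
  classical
  have hiE : i ∉ Finset.range n \ U := by simp [hi]
  have hold := hT.complete M hM
  rw [range_sdiff_erase hi hin, Finset.sum_insert hiE]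
  rw [sum_openItems hi] at hold
  set E := Finset.range n \ U with hEdef
  set f : ℕ → ℕ := fun j => if ∃ k ∈ E, M k = some j then D j else C j with hf
  set f' : ℕ → ℕ := fun j => if ∃ k ∈ insert i E, M k = some j then D' j else C' j with hf'
  have hsum : ∑ j ∈ openItems m h (U.erase i),
      @ite _ (∃ k ∈ insert i E, M k = some j) (Classical.propDecidable _) (D' j) (C' j)
      = ∑ j ∈ openItems m h (U.erase i), f' j :=
    Finset.sum_congr rfl fun j _ => by simp only [hf']; congr
  have hsum0 : ∑ k ∈ E, earning a c k (M k) ≤ C m + (∑ j ∈ childItems m h U i, f j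
      + ∑ j ∈ openItems m h (U.erase i), f j) := by
    convert hold using 4
  rw [hsum]
  have hCle : ∀ j ∈ childItems m h U i, f j ≤ D j := by
    intro j hj
    simp only [hf]
    split_ifs
    exacts [le_rfl, hT.le j (by rw [openItems_eq_union hi]; exact Finset.mem_union_left _ hj)]
  have hSD : ∑ j ∈ childItems m h U i, f j ≤ ∑ j ∈ childItems m h U i, D j :=
    Finset.sum_le_sum hCle
  have hunused : ∀ j, M i = some j → f j = C j := by
    intro j hj
    simp only [hf]
    rw [if_neg]
    rintro ⟨k, hk, hkj⟩
    exact hiE (hM.2 k i j hkj hj ▸ hk)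
  have hlow : M i ≠ some p → ∑ j ∈ childItems m h U i, f j + earning a c i (M i) ≤ T₀ := by
    intro hne
    rcases hMi : M i with _ | j
    · exact (Nat.add_le_add_right hSD _).trans hE.ge_unmatched
    · have hj : j ∈ childItems m h U i := by
        by_contra hcon
        have := hE.parent j (hM.1 i j hMi).1 (hM.1 i j hMi).2 hcon
        exact hne (this ▸ hMi)
      refine le_trans ?_ (hE.ge_matched j hj)
      rw [← Finset.sum_erase_add _ _ hj, hunused j hMi]
      refine Nat.add_le_add_right (Nat.add_le_add_right (Finset.sum_le_sum fun k hk => ?_) _) _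
      exact hCle k (Finset.mem_of_mem_erase hk)
  have hsame : ∀ j, j ≠ p → M i ≠ some j → f' j = f j := by
    intro j hjp hne
    simp only [hf, hf', (hE.other j hjp).1, (hE.other j hjp).2, Finset.exists_mem_insert, hne,
      false_or]
  have hsame' : ∀ j ∈ openItems m h (U.erase i), j ≠ p → f' j = f j := by
    intro j hj hjp
    refine hsame j hjp fun hMi => ?_
    refine hjp (hE.parent j (hM.1 i j hMi).1 (hM.1 i j hMi).2 fun hc => ?_)
    exact Finset.disjoint_left.mp disjoint_childItems hc hj
  rcases hE.shared.2 with hpm | ⟨hpm, hip⟩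
  · have h1 : M i ≠ some p := fun hMi => by
      have := (hM.1 i p hMi).1
      omega
    have h2 := hlow h1
    have h3 : ∑ j ∈ openItems m h (U.erase i), f' j = ∑ j ∈ openItems m h (U.erase i), f j :=
      Finset.sum_congr rfl fun j hj => hsame' j hj fun hjp => by
        have := (mem_openItems.mp hj).1
        omega
    have h4 := hE.low
    rw [hpm] at h4
    rw [h3, h4]
    omega
  · have hpO := hE.mem_openItems hpm
    have hCm : C' m = C m := (hE.other m (by omega)).1
    have h3 : ∑ j ∈ (openItems m h (U.erase i)).erase p, f' j
        = ∑ j ∈ (openItems m h (U.erase i)).erase p, f j :=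
      Finset.sum_congr rfl fun j hj =>
        hsame' j (Finset.mem_of_mem_erase hj) (Finset.ne_of_mem_erase hj)
    rw [← Finset.sum_erase_add _ _ hpO] at hsum0
    rw [← Finset.sum_erase_add _ f' hpO, h3, hCm]
    by_cases hMi : M i = some p
    · have h4 : f p = C p := hunused p hMi
      have h5 : f' p = D' p := by
        simp only [hf']
        rw [if_pos ⟨i, Finset.mem_insert_self _ _, hMi⟩]
      have h6 : C p + (∑ j ∈ childItems m h U i, D j + c i p) ≤ D' p := by
        rw [hE.high hpm]
        exact le_max_right _ _
      have h7 : earning a c i (M i) = c i p := by rw [hMi]; rfl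
      omega
    · have h2 := hlow hMi
      have h5 : f p + T₀ ≤ f' p := by
        simp only [hf, hf', Finset.exists_mem_insert, hMi, false_or]
        split_ifs
        · rw [hE.high hpm]
          exact le_max_left _ _
        · rw [hE.low]
      omega

theorem TableInv.step_sound (hT : TableInv n m h a c U C D) (hi : i ∈ U) (hin : i < n)
    (hE : IsElimination m h a c U i p T₀ C D C' D') (Z : Finset ℕ) :
    ∃ M, IsMatching m h M ∧
      (∀ k j, M k = some j → k ∈ Finset.range n \ U.erase i ∧
        (j ∈ openItems m h (U.erase i) → j ∉ Z)) ∧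
      ∑ k ∈ Finset.range n \ U.erase i, earning a c k (M k)
        = C' m + ∑ j ∈ openItems m h (U.erase i), if j ∈ Z then C' j else D' j := by
  classical
  have hiE : i ∉ Finset.range n \ U := by simp [hi]
  -- extend a matching of the old tables by `o`
  have key : ∀ (Z₀ : Finset ℕ) (o : Option ℕ),
      (∀ j, o = some j → j < m ∧ h i j ∧ j ∈ Z₀) →
      (∀ j ∈ openItems m h (U.erase i), j ∈ Z → j ∈ Z₀ ∧ o ≠ some j) →
      ∃ M, IsMatching m h M ∧
        (∀ k j, M k = some j → k ∈ Finset.range n \ U.erase i ∧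
          (j ∈ openItems m h (U.erase i) → j ∉ Z)) ∧
        ∑ k ∈ Finset.range n \ U.erase i, earning a c k (M k)
          = earning a c i o + (C m + (∑ j ∈ childItems m h U i, (if j ∈ Z₀ then C j else D j)
            + ∑ j ∈ openItems m h (U.erase i), if j ∈ Z₀ then C j else D j)) := by
    intro Z₀ o ho hZ
    obtain ⟨M, hM, hMZ, hMsum⟩ := hT.sound Z₀
    have hni : M i = none := by
      rcases hMi : M i with _ | j
      · rfl
      · exact absurd (hMZ i j hMi).1 hiE
    have hav : ∀ k j, M k = some j → o ≠ some j := by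
      intro k j hk hoj
      obtain ⟨hjm, hij, hjZ⟩ := ho j hoj
      exact (hMZ k j hk).2 (NashWelfare.mem_openItems.mpr ⟨hjm, i, hi, hij⟩) hjZ
    refine ⟨Function.update M i o, ⟨?_, ?_⟩, ?_, ?_⟩
    · intro k j hk
      rw [Function.update_apply] at hk
      split_ifs at hk with hki
      · subst hki
        exact ⟨(ho j hk).1, (ho j hk).2.1⟩
      · exact hM.1 k j hk
    · intro k k' j hk hk'
      rw [Function.update_apply] at hk hk'
      split_ifs at hk hk' with h1 h2 h2
      · rw [h1, h2]
      · exact absurd hk (hav k' j hk')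
      · exact absurd hk' (hav k j hk)
      · exact hM.2 k k' j hk hk'
    · intro k j hk
      rw [range_sdiff_erase hi hin]
      rw [Function.update_apply] at hk
      split_ifs at hk with hki
      · exact ⟨hki ▸ Finset.mem_insert_self _ _, fun hj hjZ => (hZ j hj hjZ).2 hk⟩
      · refine ⟨Finset.mem_insert_of_mem (hMZ k j hk).1, fun hj hjZ => ?_⟩
        refine (hMZ k j hk).2 ?_ (hZ j hj hjZ).1
        rw [openItems_eq_union hi]
        exact Finset.mem_union_right _ hj
    · rw [range_sdiff_erase hi hin, Finset.sum_insert hiE, Function.update_self,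
        ← sum_openItems hi, ← hMsum]
      congr 1
      refine Finset.sum_congr rfl fun k hk => ?_
      rw [Function.update_of_ne (fun hki : k = i => hiE (hki ▸ hk))]
  set O := openItems m h (U.erase i) with hO
  have hch : ∀ j ∈ childItems m h U i, j ∉ O := fun j hj =>
    Finset.disjoint_left.mp disjoint_childItems hj
  -- the case in which the parent item is not given to `i`
  have low : (p < m → p ∉ Z → D' p = D p + T₀) → ∃ M, IsMatching m h M ∧
      (∀ k j, M k = some j → k ∈ Finset.range n \ U.erase i ∧ (j ∈ O → j ∉ Z)) ∧
      ∑ k ∈ Finset.range n \ U.erase i, earning a c k (M k)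
        = C' m + ∑ j ∈ O, if j ∈ Z then C' j else D' j := by
    intro hD
    have hval : T₀ + (C m + ∑ j ∈ O, if j ∈ Z then C j else D j)
        = C' m + ∑ j ∈ O, if j ∈ Z then C' j else D' j := by
      rcases hE.shared.2 with hpm | ⟨hpm, hip⟩
      · have h4 := hE.low
        rw [hpm] at h4
        rw [h4]
        have : ∑ j ∈ O, (if j ∈ Z then C' j else D' j) = ∑ j ∈ O, if j ∈ Z then C j else D j := by
          refine Finset.sum_congr rfl fun j hj => ?_
          have := (NashWelfare.mem_openItems.mp hj).1
          rw [(hE.other j (by omega)).1, (hE.other j (by omega)).2]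
        omega
      · have hpO : p ∈ O := hE.mem_openItems hpm
        rw [(hE.other m (by omega)).1, ← Finset.sum_erase_add _ _ hpO,
          ← Finset.sum_erase_add _ _ hpO]
        have h3 : ∑ j ∈ O.erase p, (if j ∈ Z then C' j else D' j)
            = ∑ j ∈ O.erase p, if j ∈ Z then C j else D j := by
          refine Finset.sum_congr rfl fun j hj => ?_
          have hne := Finset.ne_of_mem_erase hj
          rw [(hE.other j hne).1, (hE.other j hne).2]
        have h4 : (if p ∈ Z then C' p else D' p) = (if p ∈ Z then C p else D p) + T₀ := by
          split_ifs with hpZ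
          · exact hE.low
          · exact hD hpm hpZ
        omega
    rcases hE.attained with h0 | ⟨j₀, hj₀, h0⟩
    · obtain ⟨M, h1, h2, h3⟩ := key (Z ∩ O) none (by simp)
        (fun j hj hjZ => ⟨Finset.mem_inter.mpr ⟨hjZ, hj⟩, by simp⟩)
      refine ⟨M, h1, h2, h3.trans ?_⟩
      have h5 : ∑ j ∈ childItems m h U i, (if j ∈ Z ∩ O then C j else D j)
          = ∑ j ∈ childItems m h U i, D j :=
        Finset.sum_congr rfl fun j hj => if_neg fun h' => hch j hj (Finset.mem_inter.mp h').2
      have h6 : ∑ j ∈ O, (if j ∈ Z ∩ O then C j else D j) = ∑ j ∈ O, if j ∈ Z then C j else D j :=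
        Finset.sum_congr rfl fun j hj => by simp [hj]
      rw [h5, h6, ← hval, h0]
      simp only [earning, Option.elim_none]
      omega
    · have hj₀' := mem_childItems.mp hj₀
      obtain ⟨M, h1, h2, h3⟩ := key (insert j₀ (Z ∩ O)) (some j₀)
        (by
          rintro j hj
          obtain rfl := Option.some.inj hj
          exact ⟨hj₀'.1, hj₀'.2.1, Finset.mem_insert_self _ _⟩)
        (fun j hj hjZ => ⟨Finset.mem_insert_of_mem (Finset.mem_inter.mpr ⟨hjZ, hj⟩), fun h' =>
          hch j₀ hj₀ (Option.some.inj h' ▸ hj)⟩)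
      refine ⟨M, h1, h2, h3.trans ?_⟩
      have h5 : ∑ j ∈ childItems m h U i, (if j ∈ insert j₀ (Z ∩ O) then C j else D j)
          = ∑ j ∈ (childItems m h U i).erase j₀, D j + C j₀ := by
        rw [← Finset.sum_erase_add _ _ hj₀, if_pos (Finset.mem_insert_self _ _)]
        congr 1
        refine Finset.sum_congr rfl fun j hj => if_neg fun h' => ?_
        rcases Finset.mem_insert.mp h' with h' | h'
        · exact Finset.ne_of_mem_erase hj h'
        · exact hch j (Finset.mem_of_mem_erase hj) (Finset.mem_inter.mp h').2
      have h6 : ∑ j ∈ O, (if j ∈ insert j₀ (Z ∩ O) then C j else D j)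
          = ∑ j ∈ O, if j ∈ Z then C j else D j := by
        refine Finset.sum_congr rfl fun j hj => ?_
        have hne : j ≠ j₀ := fun h' => hch j₀ hj₀ (h' ▸ hj)
        simp [hj, hne]
      rw [h5, h6, ← hval, h0]
      simp only [earning, Option.elim_some]
      omega
  by_cases hcase : p < m ∧ p ∉ Z ∧ D' p = C p + (∑ j ∈ childItems m h U i, D j + c i p)
  · obtain ⟨hpm, hpZ, hDp⟩ := hcase
    have hpO : p ∈ O := hE.mem_openItems hpm
    have hip : h i p := by
      rcases hE.shared.2 with h' | h'
      · omega
      · exact h'.2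
    obtain ⟨M, h1, h2, h3⟩ := key (insert p (Z ∩ O)) (some p)
      (by
        rintro j hj
        obtain rfl := Option.some.inj hj
        exact ⟨hpm, hip, Finset.mem_insert_self _ _⟩)
      (fun j hj hjZ => ⟨Finset.mem_insert_of_mem (Finset.mem_inter.mpr ⟨hjZ, hj⟩), fun h' =>
        hpZ (Option.some.inj h' ▸ hjZ)⟩)
    refine ⟨M, h1, h2, h3.trans ?_⟩
    have h5 : ∑ j ∈ childItems m h U i, (if j ∈ insert p (Z ∩ O) then C j else D j)
        = ∑ j ∈ childItems m h U i, D j := by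
      refine Finset.sum_congr rfl fun j hj => if_neg fun h' => ?_
      rcases Finset.mem_insert.mp h' with h' | h'
      · exact hE.shared.1 (h' ▸ hj)
      · exact hch j hj (Finset.mem_inter.mp h').2
    rw [h5, (hE.other m (by omega)).1, ← Finset.sum_erase_add _ _ hpO,
      ← Finset.sum_erase_add _ _ hpO, if_pos (Finset.mem_insert_self _ _), if_neg hpZ, hDp]
    have h6 : ∑ j ∈ O.erase p, (if j ∈ insert p (Z ∩ O) then C j else D j)
        = ∑ j ∈ O.erase p, if j ∈ Z then C' j else D' j := by
      refine Finset.sum_congr rfl fun j hj => ?_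
      have hne := Finset.ne_of_mem_erase hj
      rw [(hE.other j hne).1, (hE.other j hne).2]
      simp [hne, Finset.mem_of_mem_erase hj]
    rw [h6]
    simp only [earning, Option.elim_some]
    omega
  · refine low fun hpm hpZ => ?_
    have h1 := hE.high hpm
    rcases max_choice (D p + T₀) (C p + (∑ j ∈ childItems m h U i, D j + c i p)) with h2 | h2
    · rw [h1, h2]
    · exact absurd ⟨hpm, hpZ, h1.trans h2⟩ hcase

theorem TableInv.step (hT : TableInv n m h a c U C D) (hi : i ∈ U) (hin : i < n)
    (hE : IsElimination m h a c U i p T₀ C D C' D') : TableInv n m h a c (U.erase i) C' D' := by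
  refine ⟨hT.step_le hi hE, fun M hM => ?_, hT.step_sound hi hin hE⟩
  refine (hT.step_complete hi hin hE M hM).trans (le_of_eq ?_)
  congr 1
  exact Finset.sum_congr rfl fun j _ => by congr

/-- After all eliminations the table holds the maximum weight of a matching. -/
theorem TableInv.final (hT : TableInv n m h a c ∅ C D) :
    (∃ M, IsMatching m h M ∧ (∀ i j, M i = some j → i < n) ∧
      ∑ i ∈ Finset.range n, earning a c i (M i) = C m) ∧
    ∀ M, IsMatching m h M → ∑ i ∈ Finset.range n, earning a c i (M i) ≤ C m := by
  have hO : openItems m h ∅ = ∅ := by simp [openItems]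
  refine ⟨?_, fun M hM => ?_⟩
  · obtain ⟨M, h1, h2, h3⟩ := hT.sound ∅
    rw [hO, Finset.sum_empty, Finset.sdiff_empty] at h3
    exact ⟨M, h1, fun i j hij => by simpa using (h2 i j hij).1, h3⟩
  · have := hT.complete M hM
    rw [hO, Finset.sum_empty, Finset.sdiff_empty] at this
    exact this

end Elimination

end NashWelfare
namespace NashWelfare

namespace RAM

/-! ### The program -/

instance : Add AExp := ⟨AExp.bin Op.add⟩
instance : Sub AExp := ⟨AExp.bin Op.sub⟩
instance : Mul AExp := ⟨AExp.bin Op.mul⟩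
instance : Div AExp := ⟨AExp.bin Op.div⟩
instance AExp.instOfNat (k : ℕ) : OfNat AExp k := ⟨AExp.const k⟩

/-- A variable is the first entry of an array. -/
def AExp.var (a : ℕ) : AExp := .arr a (.const 0)

section EvalLemmas

variable (I : ℕ → ℕ) (S : Store) (x y : AExp) (a : ℕ)

@[simp] theorem AExp.eval_add : (x + y).eval I S = x.eval I S + y.eval I S := rfl
@[simp] theorem AExp.eval_sub : (x - y).eval I S = x.eval I S - y.eval I S := rfl
@[simp] theorem AExp.eval_mul : (x * y).eval I S = x.eval I S * y.eval I S := rfl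
@[simp] theorem AExp.eval_div : (x / y).eval I S = x.eval I S / y.eval I S := rfl
@[simp] theorem AExp.eval_zero : (0 : AExp).eval I S = 0 := rfl
@[simp] theorem AExp.eval_one : (1 : AExp).eval I S = 1 := rfl
@[simp] theorem AExp.eval_two : (2 : AExp).eval I S = 2 := rfl
@[simp] theorem AExp.eval_three : (3 : AExp).eval I S = 3 := rfl
@[simp] theorem AExp.eval_var : (AExp.var a).eval I S = S a 0 := rfl
@[simp] theorem AExp.eval_arr : (AExp.arr a x).eval I S = S a (x.eval I S) := rfl
@[simp] theorem AExp.eval_inp : (AExp.inp x).eval I S = I (x.eval I S % I 0) := rfl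

variable (i e : AExp) (c d : Cmd)

@[simp] theorem Cmd.eval_skip : Cmd.skip.eval I S = S := rfl
@[simp] theorem Cmd.eval_set : (Cmd.set a i e).eval I S = upd S a (i.eval I S) (e.eval I S) := rfl
@[simp] theorem Cmd.eval_seq : (Cmd.seq c d).eval I S = d.eval I (c.eval I S) := rfl
theorem Cmd.eval_cond : (Cmd.cond e c d).eval I S
    = if e.eval I S ≠ 0 then c.eval I S else d.eval I S := rfl

end EvalLemmas

/-- Assignment to a variable. -/
def Cmd.assign (a : ℕ) (e : AExp) : Cmd := .set a 0 e

infixr:60 " ;; " => Cmd.seq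
infix:62 " ≔ " => Cmd.assign

@[simp] theorem Cmd.eval_assign (I : ℕ → ℕ) (S : Store) (a : ℕ) (e : AExp) :
    (a ≔ e).eval I S = upd S a 0 (e.eval I S) := rfl

section Loops

variable {I : ℕ → ℕ} {v b : ℕ} {c : Cmd}

/-- A loop that updates the value of a variable. -/
theorem Cmd.eval_forb_acc (hv : v ∉ c.writes) {x : ℕ} (hx : x ≠ v) (S : Store) (g : ℕ → ℕ)
    (h0 : S x 0 = g 0)
    (hstep : ∀ k S', k < S b 0 → S' v 0 = k → (∀ a, a ≠ v → a ∉ c.writes → S' a = S a) →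
      S' x 0 = g k → c.eval I S' x 0 = g (k + 1)) :
    (Cmd.forb v b c).eval I S x 0 = g (S b 0) := by
  refine Cmd.eval_forb I hv S (fun k S' => S' x 0 = g k) ?_ ?_
  · rw [upd_of_ne hx, h0]
  · intro k S' hk hv' hf hP
    rw [upd_of_ne hx]
    exact hstep k S' hk hv' hf hP

/-- A loop that fills an array. -/
theorem Cmd.eval_forb_table (hv : v ∉ c.writes) {x : ℕ} (hx : x ≠ v) (S : Store) (f : ℕ → ℕ)
    (hstep : ∀ k S', k < S b 0 → S' v 0 = k → (∀ a, a ≠ v → a ∉ c.writes → S' a = S a) →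
      c.eval I S' x = Function.update (S' x) k (f k)) (i : ℕ) :
    (Cmd.forb v b c).eval I S x i = if i < S b 0 then f i else S x i := by
  refine Cmd.eval_forb I hv S (fun k S' => S' x i = if i < k then f i else S x i) ?_ ?_
  · rw [upd_of_ne hx, if_neg (by omega)]
  · intro k S' hk hv' hf hP
    rw [upd_of_ne hx, hstep k S' hk hv' hf, Function.update_apply, hP]
    by_cases hik : i = k
    · subst hik
      simp
    · simp only [hik, if_false]
      congr 1
      simp only [eq_iff_iff]
      omega

end Loops

/- The arrays of the program. -/
notation "rg_n" => 0
notation "rg_m" => 1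
notation "rg_nm" => 2
notation "rg_K" => 3
notation "rg_m1" => 4
notation "rg_len" => 5
notation "rg_r" => 6
notation "rg_i" => 7
notation "rg_j" => 8
notation "rg_k" => 9
notation "rg_den" => 11
notation "rg_v" => 12
notation "rg_h" => 13
notation "rg_x" => 14
notation "rg_bx" => 15
notation "rg_w" => 16
notation "rg_pw" => 17
notation "rg_big" => 18
notation "rg_huge" => 19
notation "rg_alive" => 20
notation "rg_C" => 21
notation "rg_D" => 22
notation "rg_u" => 23
notation "rg_al" => 24
notation "rg_sel" => 25
notation "rg_cnt" => 26
notation "rg_par" => 27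
notation "rg_sd" => 28
notation "rg_t0" => 29
notation "rg_t1" => 30
notation "rg_acc" => 31
notation "rg_tmp" => 32
notation "rg_arg" => 33
notation "rg_cand" => 34
notation "rg_deg" => 35
notation "rg_own" => 36
notation "rg_out" => 37
notation "rg_code" => 38
notation "rg_s" => 39
notation "rg_o" => 40

open AExp Cmd

/-- The common denominator. -/
def denCmd : Cmd := rg_den ≔ 1 ;; forb rg_j rg_K (rg_den ≔ var rg_den * inp (2 * var rg_j + 3))

/-- The integral values. -/
def valCmd : Cmd := forb rg_j rg_nm
  (.set rg_v (var rg_j) (inp (2 * var rg_j + 2) * (var rg_den / inp (2 * var rg_j + 3))))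

/-- The sum of all integral values. -/
def sumCmd : Cmd := rg_x ≔ 0 ;; forb rg_j rg_nm (rg_x ≔ var rg_x + arr rg_v (var rg_j))

/-- The scaled common denominator. -/
def scaleCmd : Cmd := rg_bx ≔ var rg_den ;; forb rg_j rg_m1 (rg_bx ≔ var rg_bx * (var rg_n + 1))

/-- The integral weights. -/
def weightCmd : Cmd := forb rg_i rg_n (.set rg_w (var rg_i)
  (inp (2 * (var rg_nm + var rg_i) + 2) * (var rg_bx / inp (2 * (var rg_nm + var rg_i) + 3))))

/-- The powers of `n + 1`. -/
def powCmd : Cmd := rg_big ≔ 1 ;; forb rg_j rg_m1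
  (.set rg_pw (var rg_j) (var rg_big) ;; rg_big ≔ var rg_big * (var rg_n + 1))

/-- The reward for a positive value. -/
def hugeCmd : Cmd := rg_huge ≔ var rg_big ;; forb rg_k rg_len
  (forb rg_i rg_n (rg_huge ≔ var rg_huge + arr rg_w (var rg_i)))

/-- The input cell for an edge of the support graph. -/
def edgeExp (t : AExp) : AExp := inp (2 * (var rg_nm + var rg_n + t) + 2)

/-- The degrees and a neighbour of every item. -/
def degCmd : Cmd := forb rg_j rg_m
  (rg_s ≔ 0 ;; rg_o ≔ 0 ;;
    forb rg_i rg_n (.cond (edgeExp (var rg_i * var rg_m + var rg_j))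
      (rg_s ≔ var rg_s + 1 ;; rg_o ≔ var rg_i) skip) ;;
    .set rg_deg (var rg_j) (var rg_s) ;; .set rg_own (var rg_j) (var rg_o))

/-- The edges at items that are not leaves. -/
def nonleafCmd : Cmd := forb rg_j rg_nm
  (.cond (edgeExp (var rg_j))
    (.cond (arr rg_deg (var rg_j - var rg_j / var rg_m * var rg_m) - 1)
      (.set rg_h (var rg_j) 1) (.set rg_h (var rg_j) 0)) (.set rg_h (var rg_j) 0))

/-- The values of the leaf items. -/
def leafCmd : Cmd := forb rg_i rg_n
  (rg_s ≔ 0 ;;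
    forb rg_j rg_m (.cond (edgeExp (var rg_i * var rg_m + var rg_j))
      (.cond (arr rg_deg (var rg_j) - 1) skip
        (rg_s ≔ var rg_s + arr rg_v (var rg_i * var rg_m + var rg_j))) skip) ;;
    .set rg_u (var rg_i) (var rg_s))

/-- The codes of the matched pairs. -/
def codeCmd : Cmd := forb rg_j rg_nm (.set rg_code (var rg_j)
  ((var rg_j / var rg_m + 1) * arr rg_pw (var rg_j - var rg_j / var rg_m * var rg_m)))

/-- All agents are alive. -/
def aliveCmd : Cmd := forb rg_i rg_n (.set rg_alive (var rg_i) 1)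

/-- The earnings of the selected agent from the value `x`. -/
def gainCmd (x : AExp) : Cmd :=
  rg_arg ≔ x ;; rg_tmp ≔ var rg_arg ;; rg_acc ≔ 0 ;;
  forb rg_k rg_len (.cond (var rg_tmp)
    (rg_tmp ≔ var rg_tmp / 2 ;; rg_acc ≔ var rg_acc + arr rg_w (var rg_sel)) skip) ;;
  .cond (var rg_arg) (.cond (arr rg_w (var rg_sel)) (rg_acc ≔ var rg_acc + var rg_huge) skip) skip

/-- The numbers of alive neighbours of the items. -/
def countCmd : Cmd := forb rg_j rg_m
  (rg_s ≔ 0 ;;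
    forb rg_i rg_n (.cond (arr rg_alive (var rg_i))
      (rg_s ≔ var rg_s + arr rg_h (var rg_i * var rg_m + var rg_j)) skip) ;;
    .set rg_al (var rg_j) (var rg_s))

/-- Select an alive agent with at most one item that has another alive neighbour. -/
def selectCmd : Cmd := rg_sel ≔ 0 ;; forb rg_i rg_n
  (.cond (arr rg_alive (var rg_i))
    (rg_cnt ≔ 0 ;;
      forb rg_j rg_m (.cond (arr rg_h (var rg_i * var rg_m + var rg_j))
        (.cond (arr rg_al (var rg_j) - 1) (rg_cnt ≔ var rg_cnt + 1) skip) skip) ;;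
      .cond (var rg_cnt - 1) skip (rg_sel ≔ var rg_i)) skip)

/-- The parent item of the selected agent. -/
def parentCmd : Cmd := rg_par ≔ var rg_m ;; forb rg_j rg_m
  (.cond (arr rg_h (var rg_sel * var rg_m + var rg_j))
    (.cond (arr rg_al (var rg_j) - 1) (rg_par ≔ var rg_j) skip) skip)

/-- The earnings below the children of the selected agent. -/
def belowCmd : Cmd := rg_sd ≔ 0 ;; forb rg_j rg_m
  (.cond (arr rg_h (var rg_sel * var rg_m + var rg_j))
    (.cond (arr rg_al (var rg_j) - 1) skip (rg_sd ≔ var rg_sd + arr rg_D (var rg_j))) skip)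

/-- The best earnings if the selected agent does not get its parent item. -/
def lowCmd : Cmd :=
  gainCmd (arr rg_u (var rg_sel)) ;; rg_t0 ≔ var rg_sd + var rg_acc ;;
  forb rg_j rg_m (.cond (arr rg_h (var rg_sel * var rg_m + var rg_j))
    (.cond (arr rg_al (var rg_j) - 1) skip
      (gainCmd (arr rg_u (var rg_sel) + arr rg_v (var rg_sel * var rg_m + var rg_j)) ;;
        rg_cand ≔ var rg_sd - arr rg_D (var rg_j) + arr rg_C (var rg_j)
          + (var rg_acc + arr rg_code (var rg_sel * var rg_m + var rg_j)) ;;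
        .cond (var rg_cand - var rg_t0) (rg_t0 ≔ var rg_cand) skip)) skip)

/-- The best earnings if the selected agent gets its parent item. -/
def highCmd : Cmd :=
  gainCmd (arr rg_u (var rg_sel) + arr rg_v (var rg_sel * var rg_m + var rg_par)) ;;
  rg_t1 ≔ var rg_sd + (var rg_acc + arr rg_code (var rg_sel * var rg_m + var rg_par))

/-- The update of the tables. -/
def updateCmd : Cmd :=
  rg_cand ≔ arr rg_D (var rg_par) + var rg_t0 ;;
  .cond (arr rg_C (var rg_par) + var rg_t1 - var rg_cand)
    (rg_cand ≔ arr rg_C (var rg_par) + var rg_t1) skip ;;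
  .set rg_D (var rg_par) (var rg_cand) ;;
  .set rg_C (var rg_par) (arr rg_C (var rg_par) + var rg_t0) ;;
  .set rg_alive (var rg_sel) 0

/-- The elimination of one agent. -/
def roundCmd : Cmd :=
  countCmd ;; selectCmd ;; parentCmd ;; belowCmd ;; lowCmd ;; highCmd ;; updateCmd

/-- The owners of the items. -/
def outCmd : Cmd := forb rg_j rg_m
  (.cond (arr rg_deg (var rg_j) - 1)
    (.set rg_out (var rg_j) (arr rg_C (var rg_m) / arr rg_pw (var rg_j)
      - arr rg_C (var rg_m) / arr rg_pw (var rg_j) / (var rg_n + 1) * (var rg_n + 1) - 1))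
    (.set rg_out (var rg_j) (arr rg_own (var rg_j))))

/-- The preparations. -/
def prepCmd : Cmd :=
  scaleCmd ;; weightCmd ;; powCmd ;; hugeCmd ;; degCmd ;; nonleafCmd ;; leafCmd ;; codeCmd ;;
  aliveCmd

/-- The first phase. -/
def phaseA : Cmd := denCmd ;; valCmd ;; sumCmd

/-- The second phase. -/
def phaseB : Cmd := prepCmd ;; forb rg_r rg_n roundCmd ;; outCmd

/-- The classes of the arrays. -/
def arrayClass (a : ℕ) : ℕ := if a ≤ 10 then 2 else 0

theorem phaseA_ok : phaseA.ok arrayClass = true := by decide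

theorem phaseB_ok : phaseB.ok arrayClass = true := by decide

end RAM

end NashWelfare
namespace NashWelfare

namespace RAM

open AExp Cmd

/-! ### The effect of the preparations -/

section Preparations

variable {I : ℕ → ℕ} {S : Store}

theorem denCmd_spec {K : ℕ} (hK : S rg_K 0 = K) (hI : 2 * K + 2 ≤ I 0) :
    denCmd.eval I S rg_den 0 = ∏ t ∈ Finset.range K, I (2 * t + 3) := by
  rw [denCmd, eval_seq]
  refine (eval_forb_acc (by decide) (by decide) _
    (fun k => ∏ t ∈ Finset.range k, I (2 * t + 3)) ?_ ?_).trans ?_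
  · simp [upd_apply]
  · intro k S' hk hv hf hx
    have hk' : k < K := by simpa [upd_apply, hK] using hk
    rw [Finset.prod_range_succ, ← hx]
    simp [upd_apply, hv, Nat.mod_eq_of_lt (show 2 * k + 3 < I 0 by omega)]
  · simp [upd_apply, hK]

theorem valCmd_spec {N d : ℕ} (hN : S rg_nm 0 = N) (hd : S rg_den 0 = d) (hI : 2 * N + 2 ≤ I 0)
    {t : ℕ} (ht : t < N) : valCmd.eval I S rg_v t = I (2 * t + 2) * (d / I (2 * t + 3)) := by
  rw [valCmd]
  refine (eval_forb_table (by decide) (by decide) _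
    (fun t => I (2 * t + 2) * (d / I (2 * t + 3))) ?_ t).trans ?_
  · intro k S' hk hv hf
    rw [hN] at hk
    have h1 : S' rg_den 0 = d := by rw [hf rg_den (by decide) (by decide), hd]
    simp [upd, hv, h1, Nat.mod_eq_of_lt (show 2 * k + 3 < I 0 by omega),
      Nat.mod_eq_of_lt (show 2 * k + 2 < I 0 by omega)]
  · rw [hN, if_pos ht]

theorem sumCmd_spec {N : ℕ} {f : ℕ → ℕ} (hN : S rg_nm 0 = N) (hf : ∀ t < N, S rg_v t = f t) :
    sumCmd.eval I S rg_x 0 = ∑ t ∈ Finset.range N, f t := by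
  rw [sumCmd, eval_seq]
  refine (eval_forb_acc (by decide) (by decide) _
    (fun k => ∑ t ∈ Finset.range k, f t) ?_ ?_).trans ?_
  · simp [upd_apply]
  · intro k S' hk hv hS hx
    have hk' : k < N := by simpa [upd_apply, hN] using hk
    have h1 : S' rg_v k = f k := by
      rw [hS rg_v (by decide) (by decide), ← hf k hk']
      simp [upd_apply]
    rw [Finset.sum_range_succ, ← hx, ← h1]
    simp [upd_apply, hv]
  · simp [upd_apply, hN]

theorem scaleCmd_spec {n m d : ℕ} (hn : S rg_n 0 = n) (hm : S rg_m1 0 = m + 1)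
    (hd : S rg_den 0 = d) : scaleCmd.eval I S rg_bx 0 = d * (n + 1) ^ (m + 1) := by
  rw [scaleCmd, eval_seq]
  refine (eval_forb_acc (by decide) (by decide) _
    (fun k => d * (n + 1) ^ k) ?_ ?_).trans ?_
  · simp [upd_apply, hd]
  · intro k S' hk hv hS hx
    have h1 : S' rg_n 0 = n := by
      rw [hS rg_n (by decide) (by decide), ← hn]
      simp [upd_apply]
    rw [pow_succ, ← mul_assoc, ← hx]
    simp [upd_apply, h1]
  · simp [upd_apply, hm]

theorem weightCmd_spec {n N d : ℕ} (hn : S rg_n 0 = n) (hN : S rg_nm 0 = N) (hd : S rg_bx 0 = d)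
    (hI : 2 * (N + n) + 2 ≤ I 0) {i : ℕ} (hi : i < n) :
    weightCmd.eval I S rg_w i = I (2 * (N + i) + 2) * (d / I (2 * (N + i) + 3)) := by
  rw [weightCmd]
  refine (eval_forb_table (by decide) (by decide) _
    (fun i => I (2 * (N + i) + 2) * (d / I (2 * (N + i) + 3))) ?_ i).trans ?_
  · intro k S' hk hv hf
    rw [hn] at hk
    have h1 : S' rg_bx 0 = d := by rw [hf rg_bx (by decide) (by decide), hd]
    have h2 : S' rg_nm 0 = N := by rw [hf rg_nm (by decide) (by decide), hN]
    simp [upd, hv, h1, h2, Nat.mod_eq_of_lt (show 2 * (N + k) + 3 < I 0 by omega),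
      Nat.mod_eq_of_lt (show 2 * (N + k) + 2 < I 0 by omega)]
  · rw [hn, if_pos hi]

theorem powCmd_spec {n m : ℕ} (hn : S rg_n 0 = n) (hm : S rg_m1 0 = m + 1) :
    powCmd.eval I S rg_big 0 = (n + 1) ^ (m + 1) ∧
      ∀ j < m + 1, powCmd.eval I S rg_pw j = (n + 1) ^ j := by
  have hb : (rg_big ≔ 1).eval I S rg_m1 0 = m + 1 := by simp [upd_apply, hm]
  rw [powCmd, eval_seq, ← hb]
  refine eval_forb I (by decide) _ (fun k S' => S' rg_big 0 = (n + 1) ^ k ∧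
    ∀ j < k, S' rg_pw j = (n + 1) ^ j) ?_ ?_
  · simp [upd_apply]
  · intro k S' hk hv hS ⟨h1, h2⟩
    have h3 : S' rg_n 0 = n := by
      rw [hS rg_n (by decide) (by decide), ← hn]
      simp [upd_apply]
    refine ⟨by simp [upd_apply, h1, h3, pow_succ], fun j hj => ?_⟩
    by_cases hjk : j = k
    · subst hjk
      simp [upd_apply, hv, h1]
    · simp [upd_apply, hv, hjk, h2 j (by omega)]

theorem hugeCmd_spec {n l B : ℕ} {w : ℕ → ℕ} (hn : S rg_n 0 = n) (hl : S rg_len 0 = l)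
    (hB : S rg_big 0 = B) (hw : ∀ i < n, S rg_w i = w i) :
    hugeCmd.eval I S rg_huge 0 = B + l * ∑ i ∈ Finset.range n, w i := by
  rw [hugeCmd, eval_seq]
  refine (eval_forb_acc (by decide) (by decide) _
    (fun k => B + k * ∑ i ∈ Finset.range n, w i) ?_ ?_).trans ?_
  · simp [upd_apply, hB]
  · intro k S' hk hv hS hx
    have h1 : S' rg_n 0 = n := by
      rw [hS rg_n (by decide) (by decide), ← hn]
      simp [upd_apply]
    refine (eval_forb_acc (by decide) (by decide) _
      (fun i => B + k * ∑ i ∈ Finset.range n, w i + ∑ i ∈ Finset.range i, w i) ?_ ?_).trans ?_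
    · simpa using hx
    · intro i S'' hi hv' hS' hx'
      rw [h1] at hi
      have h2 : S'' rg_w i = w i := by
        rw [hS' rg_w (by decide) (by decide), hS rg_w (by decide) (by decide), ← hw i hi]
        simp [upd_apply]
      rw [Finset.sum_range_succ, ← add_assoc, ← hx', ← h2]
      simp [upd_apply, hv']
    · rw [h1]
      ring
  · simp [upd_apply, hl]

/-- The positions of the edges in the input. -/
def edgeCell (n N t : ℕ) : ℕ := 2 * (N + n + t) + 2

theorem edgeExp_eval {n N : ℕ} (hn : S rg_n 0 = n) (hN : S rg_nm 0 = N)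
    (hI : 2 * (N + n + N) + 2 ≤ I 0) {t : AExp} (ht : t.eval I S < N) :
    (edgeExp t).eval I S = I (edgeCell n N (t.eval I S)) := by
  simp only [edgeExp, eval_inp, eval_add, eval_mul, eval_two, eval_var, hn, hN, edgeCell]
  rw [Nat.mod_eq_of_lt (by omega)]

theorem mul_add_lt {n m i j : ℕ} (hi : i < n) (hj : j < m) : i * m + j < n * m := by
  have : (i + 1) * m ≤ n * m := Nat.mul_le_mul_right m hi
  rw [add_mul, one_mul] at this
  omega

theorem degCmd_spec {n m : ℕ} (hn : S rg_n 0 = n) (hm : S rg_m 0 = m) (hN : S rg_nm 0 = n * m)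
    (hI : 2 * (n * m + n + n * m) + 2 ≤ I 0) {j : ℕ} (hj : j < m) :
    degCmd.eval I S rg_deg j
        = ((Finset.range n).filter fun i => I (edgeCell n (n * m) (i * m + j)) ≠ 0).card ∧
      (0 < n → degCmd.eval I S rg_own j < n) ∧
      ∀ i < n, I (edgeCell n (n * m) (i * m + j)) ≠ 0 →
        I (edgeCell n (n * m) (degCmd.eval I S rg_own j * m + j)) ≠ 0 := by
  have key : ∀ j < S rg_m 0, degCmd.eval I S rg_deg j
        = ((Finset.range n).filter fun i => I (edgeCell n (n * m) (i * m + j)) ≠ 0).card ∧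
      (0 < n → degCmd.eval I S rg_own j < n) ∧
      ∀ i < n, I (edgeCell n (n * m) (i * m + j)) ≠ 0 →
        I (edgeCell n (n * m) (degCmd.eval I S rg_own j * m + j)) ≠ 0 := by
    rw [degCmd]
    refine eval_forb I (by decide) _ (fun k S' => ∀ j < k, S' rg_deg j
        = ((Finset.range n).filter fun i => I (edgeCell n (n * m) (i * m + j)) ≠ 0).card ∧
      (0 < n → S' rg_own j < n) ∧
      ∀ i < n, I (edgeCell n (n * m) (i * m + j)) ≠ 0 →
        I (edgeCell n (n * m) (S' rg_own j * m + j)) ≠ 0) (by simp) ?_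
    intro k S' hk hv hS hP
    rw [hm] at hk
    simp only [eval_seq]
    set S₁ := (rg_o ≔ 0).eval I ((rg_s ≔ 0).eval I S') with hS₁
    set S₂ := (forb rg_i rg_n (.cond (edgeExp (var rg_i * var rg_m + var rg_j))
      (rg_s ≔ var rg_s + 1 ;; rg_o ≔ var rg_i) skip)).eval I S₁ with hS₂
    have hn₁ : S₁ rg_n 0 = n := by
      simp [hS₁, upd_apply, hS rg_n (by decide) (by decide), hn]
    have hloop : S₂ rg_s 0
          = ((Finset.range n).filter fun i => I (edgeCell n (n * m) (i * m + k)) ≠ 0).card ∧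
        (0 < n → S₂ rg_o 0 < n) ∧
        ∀ i < n, I (edgeCell n (n * m) (i * m + k)) ≠ 0 →
          I (edgeCell n (n * m) (S₂ rg_o 0 * m + k)) ≠ 0 := by
      have := eval_forb I (v := rg_i) (b := rg_n) (c := .cond (edgeExp (var rg_i * var rg_m
          + var rg_j)) (rg_s ≔ var rg_s + 1 ;; rg_o ≔ var rg_i) skip) (by decide) S₁
        (fun r S'' => S'' rg_s 0
          = ((Finset.range r).filter fun i => I (edgeCell n (n * m) (i * m + k)) ≠ 0).card ∧
        (0 < n → S'' rg_o 0 < n) ∧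
        ∀ i < r, I (edgeCell n (n * m) (i * m + k)) ≠ 0 →
          I (edgeCell n (n * m) (S'' rg_o 0 * m + k)) ≠ 0) (by simp [hS₁, upd_apply]) (by
          intro r S'' hr hv' hS' ⟨h1, h2, h3⟩
          rw [hn₁] at hr
          have e1 : S'' rg_m 0 = m := by
            rw [hS' rg_m (by decide) (by decide), ← hm, ← hS rg_m (by decide) (by decide)]
            simp [hS₁, upd_apply]
          have e2 : S'' rg_j 0 = k := by
            rw [hS' rg_j (by decide) (by decide), ← hv]
            simp [hS₁, upd_apply]
          have e3 : S'' rg_n 0 = n := by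
            rw [hS' rg_n (by decide) (by decide), hn₁]
          have e4 : S'' rg_nm 0 = n * m := by
            rw [hS' rg_nm (by decide) (by decide), ← hN, ← hS rg_nm (by decide) (by decide)]
            simp [hS₁, upd_apply]
          have e5 : (edgeExp (var rg_i * var rg_m + var rg_j)).eval I S''
              = I (edgeCell n (n * m) (r * m + k)) := by
            rw [edgeExp_eval e3 e4 hI] <;> simp only [eval_add, eval_mul, eval_var, hv', e1, e2]
            exact mul_add_lt hr hk
          rw [eval_cond, e5, Finset.range_add_one, Finset.filter_insert]
          by_cases hedge : I (edgeCell n (n * m) (r * m + k)) = 0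
          · simp only [hedge, ne_eq, not_true_eq_false, if_false, eval_skip]
            refine ⟨by simpa [upd_apply] using h1, by simpa [upd_apply] using h2, ?_⟩
            intro i hi hi'
            have hir : i ≠ r := by
              rintro rfl
              exact hi' hedge
            simpa [upd_apply] using h3 i (by omega) hi'
          · simp only [ne_eq, hedge, not_false_eq_true, if_true, eval_seq, eval_assign]
            rw [Finset.card_insert_of_notMem (by simp)]
            refine ⟨by simp [upd_apply, h1], by simp [upd_apply, hv', hr], ?_⟩
            intro i hi hi'
            simpa [upd_apply, hv'] using hedge)
      rw [hn₁] at this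
      exact this
    have hj₂ : S₂ rg_j 0 = k := by
      rw [hS₂, eval_frame I _ (by decide), ← hv]
      simp [hS₁, upd_apply]
    have hdeg₂ : S₂ rg_deg = S' rg_deg := by
      rw [hS₂, eval_frame I _ (by decide)]
      simp [hS₁, upd]
    have hown₂ : S₂ rg_own = S' rg_own := by
      rw [hS₂, eval_frame I _ (by decide)]
      simp [hS₁, upd]
    intro j hj
    by_cases hjk : j = k
    · subst hjk
      simpa [upd_apply, hj₂] using hloop
    · simpa [upd_apply, hj₂, hjk, hdeg₂, hown₂] using hP j (by omega)
  exact key j (by rw [hm]; exact hj)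

theorem mod_exp {m t : ℕ} : t - t / m * m = t % m := by
  rw [Nat.mod_def, mul_comm]

theorem nonleafCmd_spec {n m : ℕ} {deg : ℕ → ℕ} (hn : S rg_n 0 = n) (hm : S rg_m 0 = m)
    (hN : S rg_nm 0 = n * m) (hI : 2 * (n * m + n + n * m) + 2 ≤ I 0)
    (hdeg : ∀ j < m, S rg_deg j = deg j) {i j : ℕ} (hi : i < n) (hj : j < m) :
    nonleafCmd.eval I S rg_h (i * m + j)
      = if I (edgeCell n (n * m) (i * m + j)) ≠ 0 ∧ 2 ≤ deg j then 1 else 0 := by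
  rw [nonleafCmd]
  refine (eval_forb_table (by decide) (by decide) _
    (fun t => if I (edgeCell n (n * m) t) ≠ 0 ∧ 2 ≤ deg (t % m) then 1 else 0) ?_ _).trans ?_
  · intro k S' hk hv hf
    rw [hN] at hk
    have hm0 : 0 < m := by
      rcases Nat.eq_zero_or_pos m with h | h
      · simp [h] at hk
      · exact h
    have e1 : (edgeExp (var rg_j)).eval I S' = I (edgeCell n (n * m) k) := by
      rw [edgeExp_eval (by rw [hf rg_n (by decide) (by decide), hn])
        (by rw [hf rg_nm (by decide) (by decide), hN]) hI (by simpa [hv] using hk)]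
      simp [hv]
    have e2 : S' rg_deg (k % m) = deg (k % m) := by
      rw [hf rg_deg (by decide) (by decide), hdeg _ (Nat.mod_lt _ hm0)]
    have e3 : S' rg_m 0 = m := by rw [hf rg_m (by decide) (by decide), hm]
    rw [eval_cond, e1, eval_cond]
    simp only [eval_sub, eval_arr, eval_var, eval_div, eval_mul, hv, e3, mod_exp, e2, eval_zero, eval_one,
      eval_set]
    by_cases h1 : I (edgeCell n (n * m) k) = 0
    · simp [h1, upd]
    · by_cases h2 : 2 ≤ deg (k % m)
      · simp [h1, h2, upd, show deg (k % m) - 1 ≠ 0 by omega]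
      · simp [h1, h2, upd, show deg (k % m) - 1 = 0 by omega]
  · rw [hN, if_pos (mul_add_lt hi hj)]
    rw [show (i * m + j) % m = j by rw [mul_comm, Nat.mul_add_mod, Nat.mod_eq_of_lt hj]]

theorem leafCmd_spec {n m : ℕ} {deg f : ℕ → ℕ} (hn : S rg_n 0 = n) (hm : S rg_m 0 = m)
    (hN : S rg_nm 0 = n * m) (hI : 2 * (n * m + n + n * m) + 2 ≤ I 0)
    (hdeg : ∀ j < m, S rg_deg j = deg j) (hf : ∀ t < n * m, S rg_v t = f t) {i : ℕ} (hi : i < n) :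
    leafCmd.eval I S rg_u i = ∑ j ∈ Finset.range m,
      if I (edgeCell n (n * m) (i * m + j)) ≠ 0 ∧ ¬ 2 ≤ deg j then f (i * m + j) else 0 := by
  rw [leafCmd]
  refine (eval_forb_table (by decide) (by decide) _ (fun i => ∑ j ∈ Finset.range m,
      if I (edgeCell n (n * m) (i * m + j)) ≠ 0 ∧ ¬ 2 ≤ deg j then f (i * m + j) else 0)
      ?_ _).trans ?_
  · intro k S' hk hv hS
    rw [hn] at hk
    simp only [eval_seq]
    set S₁ := (rg_s ≔ 0).eval I S' with hS₁
    set S₂ := (forb rg_j rg_m (.cond (edgeExp (var rg_i * var rg_m + var rg_j))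
      (.cond (arr rg_deg (var rg_j) - 1) skip
        (rg_s ≔ var rg_s + arr rg_v (var rg_i * var rg_m + var rg_j))) skip)).eval I S₁ with hS₂
    have hm₁ : S₁ rg_m 0 = m := by
      simp [hS₁, upd_apply, hS rg_m (by decide) (by decide), hm]
    have hloop : S₂ rg_s 0 = ∑ j ∈ Finset.range m,
        if I (edgeCell n (n * m) (k * m + j)) ≠ 0 ∧ ¬ 2 ≤ deg j then f (k * m + j) else 0 := by
      rw [hS₂]
      refine (eval_forb_acc (by decide) (by decide) _ (fun r => ∑ j ∈ Finset.range r,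
        if I (edgeCell n (n * m) (k * m + j)) ≠ 0 ∧ ¬ 2 ≤ deg j then f (k * m + j) else 0)
        ?_ ?_).trans ?_
      · simp [hS₁, upd_apply]
      · intro r S'' hr hv' hS' hx
        rw [hm₁] at hr
        have e0 : ∀ a, a ≠ rg_j → a ≠ rg_s → S'' a = S' a := by
          intro a ha ha'
          rw [hS' a ha (by simpa [Cmd.writes, Cmd.assign] using ha'), hS₁, eval_assign,
            upd_of_ne ha']
        have hlt := mul_add_lt hk hr
        have e1 : S'' rg_m 0 = m := by
          rw [e0 _ (by decide) (by decide), hS rg_m (by decide) (by decide), hm]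
        have e2 : S'' rg_i 0 = k := by rw [e0 _ (by decide) (by decide), hv]
        have e3 : S'' rg_n 0 = n := by
          rw [e0 _ (by decide) (by decide), hS rg_n (by decide) (by decide), hn]
        have e4 : S'' rg_nm 0 = n * m := by
          rw [e0 _ (by decide) (by decide), hS rg_nm (by decide) (by decide), hN]
        have e5 : (edgeExp (var rg_i * var rg_m + var rg_j)).eval I S''
            = I (edgeCell n (n * m) (k * m + r)) := by
          rw [edgeExp_eval e3 e4 hI] <;> simp only [eval_add, eval_mul, eval_var, hv', e1, e2]
          exact hlt
        have e6 : S'' rg_deg r = deg r := by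
          rw [e0 _ (by decide) (by decide), hS rg_deg (by decide) (by decide), hdeg r hr]
        have e7 : S'' rg_v (k * m + r) = f (k * m + r) := by
          rw [e0 _ (by decide) (by decide), hS rg_v (by decide) (by decide), hf _ hlt]
        rw [eval_cond, e5, eval_cond, Finset.sum_range_succ, ← hx]
        simp only [eval_sub, eval_arr, eval_var, eval_one, hv', e6]
        by_cases h1 : I (edgeCell n (n * m) (k * m + r)) = 0
        · simp [h1]
        · by_cases h2 : 2 ≤ deg r
          · simp [h1, h2, show deg r - 1 ≠ 0 by omega]
          · simp [h1, h2, show deg r - 1 = 0 by omega, upd_apply, hv', e1, e2, e7]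
      · rw [hm₁]
    have hi₂ : S₂ rg_i 0 = k := by
      rw [hS₂, eval_frame I _ (by decide), ← hv]
      simp [hS₁, upd_apply]
    have hu₂ : S₂ rg_u = S' rg_u := by
      rw [hS₂, eval_frame I _ (by decide)]
      simp [hS₁, upd]
    simp [upd, hi₂, hu₂, hloop]
  · rw [hn, if_pos hi]

theorem codeCmd_spec {n m : ℕ} (hm : S rg_m 0 = m) (hN : S rg_nm 0 = n * m)
    (hpw : ∀ j < m + 1, S rg_pw j = (n + 1) ^ j) {i j : ℕ} (hi : i < n) (hj : j < m) :
    codeCmd.eval I S rg_code (i * m + j) = (i + 1) * (n + 1) ^ j := by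
  rw [codeCmd]
  refine (eval_forb_table (by decide) (by decide) _
    (fun t => (t / m + 1) * (n + 1) ^ (t % m)) ?_ _).trans ?_
  · intro k S' hk hv hf
    have e1 : S' rg_pw (k % m) = (n + 1) ^ (k % m) := by
      rw [hf rg_pw (by decide) (by decide), hpw]
      have := Nat.mod_lt k (show 0 < m by omega)
      omega
    have e2 : S' rg_m 0 = m := by rw [hf rg_m (by decide) (by decide), hm]
    simp [upd, hv, e2, mod_exp, e1]
  · rw [hN, if_pos (mul_add_lt hi hj)]
    have h1 : (i * m + j) / m = i := by
      rw [mul_comm, Nat.mul_add_div (by omega), Nat.div_eq_of_lt hj, add_zero]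
    have h2 : (i * m + j) % m = j := by
      rw [mul_comm, Nat.mul_add_mod, Nat.mod_eq_of_lt hj]
    simp only [h1, h2]

theorem aliveCmd_spec {n : ℕ} (hn : S rg_n 0 = n) {i : ℕ} (hi : i < n) :
    aliveCmd.eval I S rg_alive i = 1 := by
  rw [aliveCmd]
  refine (eval_forb_table (by decide) (by decide) _ (fun _ => 1) ?_ _).trans ?_
  · intro k S' hk hv hf
    simp [upd, hv]
  · rw [hn, if_pos hi]

end Preparations

end RAM

end NashWelfare
namespace NashWelfare

namespace RAM

open AExp Cmd

/-! ### The effect of the elimination of one agent -/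

/-- The data of the matching problem that the program solves. -/
structure Params where
  /-- the number of agents -/
  n : ℕ
  /-- the number of items -/
  m : ℕ
  /-- a bound on the bit lengths of the values -/
  len : ℕ
  /-- the reward for a positive value -/
  huge : ℕ
  /-- the edges -/
  edge : ℕ → ℕ
  /-- the weights of the agents -/
  weight : ℕ → ℕ
  /-- the values of the leaf items -/
  base : ℕ → ℕ
  /-- the values of the pairs -/
  value : ℕ → ℕ
  /-- the codes of the pairs -/
  code : ℕ → ℕ

namespace Params

variable (P : Params)

/-- The edge relation. -/
def Adj (i j : ℕ) : Prop := P.edge (i * P.m + j) ≠ 0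

/-- The earnings of agent `i` from the value `x`. -/
def gain (i x : ℕ) : ℕ :=
  P.weight i * min P.len x.size + if x ≠ 0 ∧ P.weight i ≠ 0 then P.huge else 0

/-- The earnings of an unmatched agent. -/
def single (i : ℕ) : ℕ := P.gain i (P.base i)

/-- The earnings of a matched agent. -/
def paired (i j : ℕ) : ℕ :=
  P.gain i (P.base i + P.value (i * P.m + j)) + P.code (i * P.m + j)

/-- The number of neighbours of item `j` in `U`. -/
def count (U : Finset ℕ) (j : ℕ) : ℕ := ∑ i ∈ U, P.edge (i * P.m + j)

/-- The store contains the data. -/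
structure Holds (S : Store) : Prop where
  n : S rg_n 0 = P.n
  m : S rg_m 0 = P.m
  len : S rg_len 0 = P.len
  huge : S rg_huge 0 = P.huge
  edge : ∀ i < P.n, ∀ j < P.m, S rg_h (i * P.m + j) = P.edge (i * P.m + j)
  weight : ∀ i < P.n, S rg_w i = P.weight i
  base : ∀ i < P.n, S rg_u i = P.base i
  value : ∀ i < P.n, ∀ j < P.m, S rg_v (i * P.m + j) = P.value (i * P.m + j)
  code : ∀ i < P.n, ∀ j < P.m, S rg_code (i * P.m + j) = P.code (i * P.m + j)

variable {P}

theorem Holds.congr {S S' : Store} (h : P.Holds S)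
    (hS : ∀ a ∈ [rg_n, rg_m, rg_len, rg_huge, rg_h, rg_w, rg_u, rg_v, rg_code], S' a = S a) :
    P.Holds S' where
  n := by rw [hS _ (by decide), h.n]
  m := by rw [hS _ (by decide), h.m]
  len := by rw [hS _ (by decide), h.len]
  huge := by rw [hS _ (by decide), h.huge]
  edge i hi j hj := by rw [hS _ (by decide), h.edge i hi j hj]
  weight i hi := by rw [hS _ (by decide), h.weight i hi]
  base i hi := by rw [hS _ (by decide), h.base i hi]
  value i hi j hj := by rw [hS _ (by decide), h.value i hi j hj]
  code i hi j hj := by rw [hS _ (by decide), h.code i hi j hj]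

theorem Holds.eval {S : Store} (h : P.Holds S) (I : ℕ → ℕ) {c : Cmd}
    (hc : ∀ a ∈ [rg_n, rg_m, rg_len, rg_huge, rg_h, rg_w, rg_u, rg_v, rg_code], a ∉ c.writes) :
    P.Holds (c.eval I S) :=
  h.congr fun a ha => c.eval_frame I (hc a ha) S

end Params

section Round

variable {I : ℕ → ℕ} {S : Store} {P : Params}

theorem gainCmd_spec (hP : P.Holds S) (x : AExp) {i : ℕ} (hi : i < P.n) (hsel : S rg_sel 0 = i) :
    (gainCmd x).eval I S rg_acc 0 = P.gain i (x.eval I S) := by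
  simp only [gainCmd, eval_seq]
  set y := x.eval I S with hy
  set S₁ := (rg_acc ≔ 0).eval I ((rg_tmp ≔ var rg_arg).eval I ((rg_arg ≔ x).eval I S)) with hS₁
  set S₂ := (forb rg_k rg_len (.cond (var rg_tmp)
    (rg_tmp ≔ var rg_tmp / 2 ;; rg_acc ≔ var rg_acc + arr rg_w (var rg_sel)) skip)).eval I S₁
    with hS₂
  have e1 : ∀ a, a ≠ rg_arg → a ≠ rg_tmp → a ≠ rg_acc → S₁ a = S a := by
    intro a h1 h2 h3
    simp only [hS₁, eval_assign]
    rw [upd_of_ne h3, upd_of_ne h2, upd_of_ne h1]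
  have hloop : S₂ rg_tmp 0 = y / 2 ^ P.len ∧ S₂ rg_acc 0 = P.weight i * min P.len y.size := by
    have hl : S₁ rg_len 0 = P.len := by rw [e1 _ (by decide) (by decide) (by decide), hP.len]
    have := eval_forb I (v := rg_k) (b := rg_len) (c := .cond (var rg_tmp)
      (rg_tmp ≔ var rg_tmp / 2 ;; rg_acc ≔ var rg_acc + arr rg_w (var rg_sel)) skip) (by decide) S₁
      (fun k S' => S' rg_tmp 0 = y / 2 ^ k ∧ S' rg_acc 0 = P.weight i * min k y.size)
      (by simp [hS₁, upd_apply, hy]) (by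
        intro k S' hk hv hf ⟨h1, h2⟩
        have hw : S' rg_w (S' rg_sel 0) = P.weight i := by
          rw [hf rg_w (by decide) (by decide), hf rg_sel (by decide) (by decide),
            e1 rg_w (by decide) (by decide) (by decide),
            e1 rg_sel (by decide) (by decide) (by decide), hsel, hP.weight i hi]
        rw [eval_cond, eval_var, h1]
        by_cases h0 : y / 2 ^ k = 0
        · have h3 : y.size ≤ k := by
            rw [Nat.size_le]
            exact (Nat.div_eq_zero_iff.mp h0).resolve_left (by positivity)
          simp only [h0, ne_eq, not_true_eq_false, if_false, eval_skip]
          constructor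
          · simp only [upd_apply, show ¬ (rg_tmp = rg_k ∧ _) from by simp, h1, pow_succ]
            rw [← Nat.div_div_eq_div_mul, h0]
            simp
          · simp [upd_apply, h2, Nat.min_eq_right h3, Nat.min_eq_right (h3.trans k.le_succ)]
        · have h3 : k < y.size := by
            rw [Nat.lt_size]
            by_contra hcon
            exact h0 (Nat.div_eq_of_lt (by omega))
          simp only [ne_eq, h0, not_false_eq_true, if_true, eval_seq, eval_assign]
          constructor
          · simp [upd_apply, h1, pow_succ, Nat.div_div_eq_div_mul]
          · have hw' : S' 16 (S' 25 0) = P.weight i := hw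
            simp [upd_apply, h2, hw', Nat.min_eq_left h3.le, Nat.min_eq_left (show k + 1 ≤ y.size
              from h3)]
            ring)
    rwa [hl] at this
  have e2 : ∀ a, a ∉ (forb rg_k rg_len (.cond (var rg_tmp) (rg_tmp ≔ var rg_tmp / 2 ;;
      rg_acc ≔ var rg_acc + arr rg_w (var rg_sel)) skip)).writes → S₂ a = S₁ a :=
    fun a ha => eval_frame I _ ha S₁
  have harg : S₂ rg_arg 0 = y := by
    rw [e2 _ (by decide)]
    simp [hS₁, upd_apply, hy]
  have hw : S₂ rg_w (S₂ rg_sel 0) = P.weight i := by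
    rw [e2 rg_w (by decide), e2 rg_sel (by decide), e1 rg_w (by decide) (by decide) (by decide),
      e1 rg_sel (by decide) (by decide) (by decide), hsel, hP.weight i hi]
  have hhuge : S₂ rg_huge 0 = P.huge := by
    rw [e2 _ (by decide), e1 _ (by decide) (by decide) (by decide), hP.huge]
  rw [eval_cond, eval_var, harg, eval_cond, eval_arr, eval_var, hw, Params.gain]
  by_cases h1 : y = 0
  · simp [h1, hloop.2]
  · by_cases h2 : P.weight i = 0
    · simp [h1, h2, hloop.2]
    · simp [h1, h2, hloop.2, hhuge, upd_apply]

theorem countCmd_spec (hP : P.Holds S) {U : Finset ℕ} (hU : U ⊆ Finset.range P.n)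
    (hal : ∀ i < P.n, S rg_alive i = if i ∈ U then 1 else 0) {j : ℕ} (hj : j < P.m) :
    countCmd.eval I S rg_al j = P.count U j := by
  rw [countCmd]
  refine (eval_forb_table (by decide) (by decide) _ (P.count U) ?_ _).trans ?_
  · intro k S' hk hv hS
    rw [hP.m] at hk
    simp only [eval_seq]
    set S₁ := (rg_s ≔ 0).eval I S' with hS₁
    set S₂ := (forb rg_i rg_n (.cond (arr rg_alive (var rg_i))
      (rg_s ≔ var rg_s + arr rg_h (var rg_i * var rg_m + var rg_j)) skip)).eval I S₁ with hS₂
    have hn₁ : S₁ rg_n 0 = P.n := by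
      simp [hS₁, upd_apply, hS rg_n (by decide) (by decide), hP.n]
    have hloop : S₂ rg_s 0 = P.count U k := by
      have hcount : P.count U k
          = ∑ i ∈ Finset.range P.n, if i ∈ U then P.edge (i * P.m + k) else 0 := by
        rw [Params.count, Finset.sum_ite_mem, Finset.inter_eq_right.mpr hU]
      rw [hS₂, hcount]
      refine (eval_forb_acc (by decide) (by decide) _ (fun r => ∑ i ∈ Finset.range r,
        if i ∈ U then P.edge (i * P.m + k) else 0) ?_ ?_).trans ?_
      · simp [hS₁, upd_apply]
      · intro r S'' hr hv' hS' hx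
        rw [hn₁] at hr
        have e0 : ∀ a, a ≠ rg_i → a ≠ rg_s → S'' a = S' a := by
          intro a ha ha'
          rw [hS' a ha (by simpa [Cmd.writes, Cmd.assign] using ha'), hS₁, eval_assign,
            upd_of_ne ha']
        have e1 : S'' rg_m 0 = P.m := by
          rw [e0 _ (by decide) (by decide), hS rg_m (by decide) (by decide), hP.m]
        have e2 : S'' rg_j 0 = k := by rw [e0 _ (by decide) (by decide), hv]
        have e3 : S'' rg_alive r = if r ∈ U then 1 else 0 := by
          rw [e0 _ (by decide) (by decide), hS rg_alive (by decide) (by decide), hal r hr]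
        have e4 : S'' rg_h (r * P.m + k) = P.edge (r * P.m + k) := by
          rw [e0 _ (by decide) (by decide), hS rg_h (by decide) (by decide), hP.edge r hr k hk]
        rw [eval_cond, eval_arr, eval_var, hv', e3, Finset.sum_range_succ, ← hx]
        by_cases h1 : r ∈ U
        · simp [h1, upd_apply, hv', e1, e2, e4]
        · simp [h1]
      · rw [hn₁]
    have hj₂ : S₂ rg_j 0 = k := by
      rw [hS₂, eval_frame I _ (by decide), ← hv]
      simp [hS₁, upd_apply]
    have hu₂ : S₂ rg_al = S' rg_al := by
      rw [hS₂, eval_frame I _ (by decide)]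
      simp [hS₁, upd]
    simp [upd, hj₂, hu₂, hloop]
  · rw [hP.m, if_pos hj]

/-- The items of agent `i` that have another neighbour in `U`. -/
def Params.sharedItems (P : Params) (U : Finset ℕ) (i : ℕ) : Finset ℕ :=
  (Finset.range P.m).filter fun j => P.edge (i * P.m + j) ≠ 0 ∧ 2 ≤ P.count U j

theorem selectCmd_spec (hP : P.Holds S) {U : Finset ℕ} (hU : U ⊆ Finset.range P.n)
    (hal : ∀ i < P.n, S rg_alive i = if i ∈ U then 1 else 0)
    (hcnt : ∀ j < P.m, S rg_al j = P.count U j)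
    (hex : ∃ i ∈ U, (P.sharedItems U i).card ≤ 1) :
    selectCmd.eval I S rg_sel 0 ∈ U ∧
      (P.sharedItems U (selectCmd.eval I S rg_sel 0)).card ≤ 1 := by
  have hn : (rg_sel ≔ 0).eval I S rg_n 0 = P.n := by simp [upd_apply, hP.n]
  have key : (∃ i < P.n, i ∈ U ∧ (P.sharedItems U i).card ≤ 1) →
      selectCmd.eval I S rg_sel 0 ∈ U ∧
      (P.sharedItems U (selectCmd.eval I S rg_sel 0)).card ≤ 1 := by
    rw [selectCmd, eval_seq, ← hn]
    refine eval_forb I (by decide) _ (fun r S' => (∃ i < r, i ∈ U ∧ (P.sharedItems U i).card ≤ 1) →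
      S' rg_sel 0 ∈ U ∧ (P.sharedItems U (S' rg_sel 0)).card ≤ 1) (by simp) ?_
    intro r S' hr hv hS hI
    rw [hn] at hr
    have e0 : ∀ a, a ≠ rg_i → a ≠ rg_cnt → a ≠ rg_sel → a ≠ rg_j → S' a = S a := by
      intro a ha ha' h1 h2
      rw [hS a ha (by simp [Cmd.writes, Cmd.assign, *]), eval_assign, upd_of_ne h1]
    have ea : S' rg_alive r = if r ∈ U then 1 else 0 := by
      rw [e0 _ (by decide) (by decide) (by decide) (by decide), hal r hr]
    rw [eval_cond, eval_arr, eval_var, hv, ea]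
    by_cases hrU : r ∈ U
    · simp only [hrU, if_true, ne_eq, one_ne_zero, not_false_eq_true, eval_seq]
      set S₁ := (rg_cnt ≔ 0).eval I S' with hS₁
      set S₂ := (forb rg_j rg_m (.cond (arr rg_h (var rg_i * var rg_m + var rg_j))
        (.cond (arr rg_al (var rg_j) - 1) (rg_cnt ≔ var rg_cnt + 1) skip) skip)).eval I S₁ with hS₂
      have hm₁ : S₁ rg_m 0 = P.m := by
        simp [hS₁, upd_apply, e0 rg_m (by decide) (by decide) (by decide) (by decide), hP.m]
      have hloop : S₂ rg_cnt 0 = (P.sharedItems U r).card := by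
        rw [hS₂, Params.sharedItems]
        refine (eval_forb_acc (by decide) (by decide) _ (fun k => ((Finset.range k).filter fun j =>
          P.edge (r * P.m + j) ≠ 0 ∧ 2 ≤ P.count U j).card) ?_ ?_).trans ?_
        · simp [hS₁, upd_apply]
        · intro k S'' hk hv' hS' hx
          rw [hm₁] at hk
          have e5 : ∀ a, a ≠ rg_j → a ≠ rg_cnt → S'' a = S' a := by
            intro a ha ha'
            rw [hS' a ha (by simpa [Cmd.writes, Cmd.assign] using ha'), hS₁, eval_assign,
              upd_of_ne ha']
          have e1 : S'' rg_m 0 = P.m := by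
            rw [e5 _ (by decide) (by decide), e0 _ (by decide) (by decide) (by decide) (by decide),
              hP.m]
          have e2 : S'' rg_i 0 = r := by rw [e5 _ (by decide) (by decide), hv]
          have e3 : S'' rg_al k = P.count U k := by
            rw [e5 _ (by decide) (by decide), e0 _ (by decide) (by decide) (by decide) (by decide),
              hcnt k hk]
          have e4 : S'' rg_h (r * P.m + k) = P.edge (r * P.m + k) := by
            rw [e5 _ (by decide) (by decide), e0 _ (by decide) (by decide) (by decide) (by decide),
              hP.edge r hr k hk]
          rw [eval_cond, eval_cond, Finset.range_add_one, Finset.filter_insert]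
          simp only [eval_sub, eval_arr, eval_var, eval_add, eval_mul, eval_one, hv', e1, e2, e3, e4]
          by_cases h1 : P.edge (r * P.m + k) = 0
          · simp only [h1, ne_eq, not_true_eq_false, false_and, if_false, eval_skip]
            exact hx
          · by_cases h2 : 2 ≤ P.count U k
            · simp only [ne_eq, h1, not_false_eq_true, h2, and_self, if_true,
                show P.count U k - 1 ≠ 0 by omega, eval_assign]
              rw [Finset.card_insert_of_notMem (by simp), ← hx]
              simp [upd_apply]
            · simp only [ne_eq, h1, not_false_eq_true, h2, and_false, if_true,
                show P.count U k - 1 = 0 by omega, if_false, not_true_eq_false, eval_skip]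
              exact hx
        · rw [hm₁]
      have hi₂ : S₂ rg_i 0 = r := by
        rw [hS₂, eval_frame I _ (by decide), ← hv]
        simp [hS₁, upd_apply]
      have hs₂ : S₂ rg_sel = S' rg_sel := by
        rw [hS₂, eval_frame I _ (by decide)]
        simp [hS₁, upd]
      rw [eval_cond, eval_sub, eval_var, hloop, eval_one]
      by_cases hc : (P.sharedItems U r).card ≤ 1
      · intro _
        simp only [show (P.sharedItems U r).card - 1 = 0 by omega, ne_eq, not_true_eq_false,
          if_false, eval_assign, eval_var, hi₂]
        rw [upd_of_ne (by decide), upd_same]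
        exact ⟨hrU, hc⟩
      · rintro ⟨i, hi, hiU, hi'⟩
        simp only [show (P.sharedItems U r).card - 1 ≠ 0 by omega, ne_eq, not_false_eq_true,
          if_true, eval_skip]
        rw [upd_of_ne (by decide), hs₂]
        refine hI ⟨i, ?_, hiU, hi'⟩
        have : i ≠ r := by
          rintro rfl
          exact hc hi'
        omega
    · rintro ⟨i, hi, hiU, hi'⟩
      simp only [hrU, if_false, ne_eq, not_true_eq_false, eval_skip]
      rw [upd_of_ne (by decide)]
      refine hI ⟨i, ?_, hiU, hi'⟩
      have : i ≠ r := by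
        rintro rfl
        exact hrU hiU
      omega
  obtain ⟨i, hi, hi'⟩ := hex
  exact key ⟨i, Finset.mem_range.mp (hU hi), hi, hi'⟩

theorem parentCmd_spec (hP : P.Holds S) {U : Finset ℕ}
    (hcnt : ∀ j < P.m, S rg_al j = P.count U j) {i : ℕ} (hi : i < P.n) (hsel : S rg_sel 0 = i) :
    (parentCmd.eval I S rg_par 0 = P.m ∧ P.sharedItems U i = ∅) ∨
      parentCmd.eval I S rg_par 0 ∈ P.sharedItems U i := by
  have hm : (rg_par ≔ var rg_m).eval I S rg_m 0 = P.m := by simp [upd_apply, hP.m]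
  have key : (parentCmd.eval I S rg_par 0 = P.m ∧ ∀ j < P.m, j ∉ P.sharedItems U i) ∨
      parentCmd.eval I S rg_par 0 ∈ P.sharedItems U i := by
    nth_rewrite 2 [← hm]
    rw [parentCmd, eval_seq]
    refine eval_forb I (by decide) _ (fun k S' =>
      (S' rg_par 0 = P.m ∧ ∀ j < k, j ∉ P.sharedItems U i) ∨ S' rg_par 0 ∈ P.sharedItems U i)
      (by simp [upd_apply, hP.m]) ?_
    intro k S' hk hv hS hI
    rw [hm] at hk
    have e0 : ∀ a, a ≠ rg_j → a ≠ rg_par → S' a = S a := by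
      intro a ha ha'
      rw [hS a ha (by simpa [Cmd.writes, Cmd.assign] using ha'), eval_assign, upd_of_ne ha']
    have e1 : S' rg_m 0 = P.m := by rw [e0 _ (by decide) (by decide), hP.m]
    have e2 : S' rg_sel 0 = i := by rw [e0 _ (by decide) (by decide), hsel]
    have e3 : S' rg_al k = P.count U k := by rw [e0 _ (by decide) (by decide), hcnt k hk]
    have e4 : S' rg_h (i * P.m + k) = P.edge (i * P.m + k) := by
      rw [e0 _ (by decide) (by decide), hP.edge i hi k hk]
    have hkmem : k ∈ P.sharedItems U i ↔ P.edge (i * P.m + k) ≠ 0 ∧ 2 ≤ P.count U k := by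
      simp [Params.sharedItems, hk]
    have hold : k ∉ P.sharedItems U i → (upd S' rg_j 0 (k + 1) rg_par 0 = P.m ∧
        ∀ j < k + 1, j ∉ P.sharedItems U i) ∨
          upd S' rg_j 0 (k + 1) rg_par 0 ∈ P.sharedItems U i := by
      intro hk'
      rw [upd_of_ne (by decide)]
      refine hI.imp_left fun h => ⟨h.1, fun j hj => ?_⟩
      rcases Nat.lt_succ_iff_lt_or_eq.mp hj with h1 | rfl
      exacts [h.2 j h1, hk']
    rw [eval_cond, eval_cond]
    simp only [eval_sub, eval_arr, eval_var, eval_add, eval_mul, eval_one, hv, e1, e2, e3, e4]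
    by_cases h1 : P.edge (i * P.m + k) = 0
    · simp only [h1, ne_eq, not_true_eq_false, if_false, eval_skip]
      simpa [hv] using hold (by rw [hkmem]; simp [h1])
    · by_cases h2 : 2 ≤ P.count U k
      · right
        simp only [ne_eq, h1, not_false_eq_true, if_true,
          show P.count U k - 1 ≠ 0 by omega, eval_assign, eval_var, hv]
        rw [upd_of_ne (by decide), upd_same, hkmem]
        exact ⟨h1, h2⟩
      · simp only [ne_eq, h1, not_false_eq_true, if_true,
          show P.count U k - 1 = 0 by omega, if_false, not_true_eq_false, eval_skip]
        simpa [hv] using hold (by rw [hkmem]; simp [h2])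
  refine key.imp_left fun h => ⟨h.1, Finset.eq_empty_of_forall_notMem fun j hj => ?_⟩
  exact h.2 j (by simpa using (Finset.mem_filter.mp hj).1) hj

/-- The items of agent `i` that have no other neighbour in `U`. -/
def Params.ownItems (P : Params) (U : Finset ℕ) (i : ℕ) : Finset ℕ :=
  (Finset.range P.m).filter fun j => P.edge (i * P.m + j) ≠ 0 ∧ ¬ 2 ≤ P.count U j

theorem belowCmd_spec (hP : P.Holds S) {U : Finset ℕ}
    (hcnt : ∀ j < P.m, S rg_al j = P.count U j) {i : ℕ} (hi : i < P.n) (hsel : S rg_sel 0 = i) :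
    belowCmd.eval I S rg_sd 0 = ∑ j ∈ P.ownItems U i, S rg_D j := by
  rw [belowCmd, eval_seq, Params.ownItems]
  refine (eval_forb_acc (by decide) (by decide) _ (fun k => ∑ j ∈ (Finset.range k).filter fun j =>
    P.edge (i * P.m + j) ≠ 0 ∧ ¬ 2 ≤ P.count U j, S rg_D j) ?_ ?_).trans ?_
  · simp [upd_apply]
  · intro k S' hk hv hS hx
    have hk : k < P.m := by simpa [upd_apply, hP.m] using hk
    have e0 : ∀ a, a ≠ rg_j → a ≠ rg_sd → S' a = S a := by
      intro a ha ha'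
      rw [hS a ha (by simpa [Cmd.writes, Cmd.assign] using ha'), eval_assign, upd_of_ne ha']
    have e1 : S' rg_m 0 = P.m := by rw [e0 _ (by decide) (by decide), hP.m]
    have e2 : S' rg_sel 0 = i := by rw [e0 _ (by decide) (by decide), hsel]
    have e3 : S' rg_al k = P.count U k := by rw [e0 _ (by decide) (by decide), hcnt k hk]
    have e4 : S' rg_h (i * P.m + k) = P.edge (i * P.m + k) := by
      rw [e0 _ (by decide) (by decide), hP.edge i hi k hk]
    have e5 : S' rg_D k = S rg_D k := by rw [e0 _ (by decide) (by decide)]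
    rw [eval_cond, eval_cond, Finset.range_add_one, Finset.filter_insert]
    simp only [eval_sub, eval_arr, eval_var, eval_add, eval_mul, eval_one, hv, e1, e2, e3, e4]
    by_cases h1 : P.edge (i * P.m + k) = 0
    · simp only [h1, ne_eq, not_true_eq_false, false_and, if_false, eval_skip]
      exact hx
    · by_cases h2 : 2 ≤ P.count U k
      · simp only [ne_eq, h1, not_false_eq_true, h2, not_true_eq_false, and_false, if_true,
          show P.count U k - 1 ≠ 0 by omega, if_false, eval_skip]
        exact hx
      · simp only [ne_eq, h1, not_false_eq_true, h2, and_self, if_true,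
          show P.count U k - 1 = 0 by omega, if_false, not_true_eq_false, eval_assign]
        rw [Finset.sum_insert (by simp), ← hx, add_comm]
        simp [upd_apply, hv, e5]
  · simp [upd_apply, hP.m]

/-- The earnings below agent `i` if it gets its child item `j`. -/
def Params.candidate (P : Params) (C D : ℕ → ℕ) (s i j : ℕ) : ℕ := s - D j + C j + P.paired i j

theorem lowCmd_spec (hP : P.Holds S) {U : Finset ℕ}
    (hcnt : ∀ j < P.m, S rg_al j = P.count U j) {i s : ℕ} (hi : i < P.n) (hsel : S rg_sel 0 = i)
    (hsd : S rg_sd 0 = s) :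
    s + P.single i ≤ lowCmd.eval I S rg_t0 0 ∧
    (∀ j ∈ P.ownItems U i, P.candidate (S rg_C) (S rg_D) s i j ≤ lowCmd.eval I S rg_t0 0) ∧
    (lowCmd.eval I S rg_t0 0 = s + P.single i ∨
      ∃ j ∈ P.ownItems U i, lowCmd.eval I S rg_t0 0 = P.candidate (S rg_C) (S rg_D) s i j) := by
  simp only [lowCmd, eval_seq]
  set S₁ := (rg_t0 ≔ var rg_sd + var rg_acc).eval I ((gainCmd (arr rg_u (var rg_sel))).eval I S)
    with hS₁
  have f1 : ∀ a, a ∉ (gainCmd (arr rg_u (var rg_sel))).writes → a ≠ rg_t0 → S₁ a = S a := by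
    intro a ha ha'
    rw [hS₁, eval_assign, upd_of_ne ha', eval_frame I _ ha]
  have hsd₁ : (gainCmd (arr rg_u (var rg_sel))).eval I S rg_sd = S rg_sd :=
    eval_frame I _ (by decide) S
  have ht₁ : S₁ rg_t0 0 = s + P.single i := by
    rw [hS₁, eval_assign, upd_same, eval_add, eval_var, eval_var, gainCmd_spec hP _ hi hsel,
      hsd₁, hsd]
    simp [Params.single, hsel, hP.base i hi]
  have hm : S₁ rg_m 0 = P.m := by rw [f1 _ (by decide) (by decide), hP.m]
  let Q : ℕ → Store → Prop := fun k S' => s + P.single i ≤ S' rg_t0 0 ∧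
    (∀ j ∈ (Finset.range k).filter fun j => P.edge (i * P.m + j) ≠ 0 ∧ ¬ 2 ≤ P.count U j,
      P.candidate (S rg_C) (S rg_D) s i j ≤ S' rg_t0 0) ∧
    (S' rg_t0 0 = s + P.single i ∨
      ∃ j ∈ (Finset.range k).filter fun j => P.edge (i * P.m + j) ≠ 0 ∧ ¬ 2 ≤ P.count U j,
        S' rg_t0 0 = P.candidate (S rg_C) (S rg_D) s i j)
  refine show Q P.m _ from ?_
  rw [← hm]
  refine eval_forb I (by decide) S₁ Q ?_ ?_
  · simp [Q, upd_apply, ht₁]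
  · intro k S' hk hv hS ⟨h1, h2, h3⟩
    rw [hm] at hk
    have e0 : ∀ a, a ≠ rg_j → a ∉ lowCmd.writes → S' a = S a := by
      intro a ha ha'
      rw [hS a ha (fun hcon => ha' (by simp only [lowCmd, Cmd.writes, List.mem_append]; tauto)), f1]
      · exact fun hcon => ha' (by simp only [lowCmd, Cmd.writes, List.mem_append]; tauto)
      · rintro rfl
        exact ha' (by decide)
    have hP' : P.Holds S' := hP.congr fun a ha => by
      refine e0 a ?_ ?_ <;> revert a <;> decide
    have e2 : S' rg_sel 0 = i := by rw [e0 _ (by decide) (by decide), hsel]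
    have e3 : S' rg_al k = P.count U k := by rw [e0 _ (by decide) (by decide), hcnt k hk]
    have hskip : ¬ (P.edge (i * P.m + k) ≠ 0 ∧ ¬ 2 ≤ P.count U k) →
        s + P.single i ≤ upd S' rg_j 0 (k + 1) rg_t0 0 ∧
        (∀ j ∈ (Finset.range (k + 1)).filter fun j =>
          P.edge (i * P.m + j) ≠ 0 ∧ ¬ 2 ≤ P.count U j,
          P.candidate (S rg_C) (S rg_D) s i j ≤ upd S' rg_j 0 (k + 1) rg_t0 0) ∧
        (upd S' rg_j 0 (k + 1) rg_t0 0 = s + P.single i ∨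
          ∃ j ∈ (Finset.range (k + 1)).filter fun j =>
            P.edge (i * P.m + j) ≠ 0 ∧ ¬ 2 ≤ P.count U j,
            upd S' rg_j 0 (k + 1) rg_t0 0 = P.candidate (S rg_C) (S rg_D) s i j) := by
      intro hnot
      rw [upd_of_ne (by decide), Finset.range_add_one, Finset.filter_insert, if_neg hnot]
      exact ⟨h1, h2, h3⟩
    rw [eval_cond, eval_cond]
    simp only [eval_sub, eval_arr, eval_var, eval_add, eval_mul, eval_one, hv, hP'.m, e2, e3,
      hP'.edge i hi k hk]
    by_cases g1 : P.edge (i * P.m + k) = 0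
    · simp only [g1, ne_eq, not_true_eq_false, if_false, eval_skip]
      exact hskip (by simp [g1])
    · by_cases g2 : 2 ≤ P.count U k
      · simp only [ne_eq, g1, not_false_eq_true, if_true,
          show P.count U k - 1 ≠ 0 by omega, eval_skip]
        exact hskip (by simp [g2])
      · simp only [ne_eq, g1, not_false_eq_true, if_true,
          show P.count U k - 1 = 0 by omega, if_false, not_true_eq_false, eval_seq]
        set S₂ := (gainCmd (arr rg_u (var rg_sel) + arr rg_v (var rg_sel * var rg_m
          + var rg_j))).eval I S' with hS₂
        have f2 : ∀ a, a ∉ (gainCmd (arr rg_u (var rg_sel) + arr rg_v (var rg_sel * var rg_m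
          + var rg_j))).writes → S₂ a = S' a := fun a ha =>
            eval_frame I _ ha S'
        have hacc : S₂ rg_acc 0 = P.gain i (P.base i + P.value (i * P.m + k)) := by
          rw [hS₂, gainCmd_spec hP' _ hi e2]
          simp [e2, hP'.base i hi, hP'.m, hv, hP'.value i hi k hk]
        set S₃ := (rg_cand ≔ var rg_sd - arr rg_D (var rg_j) + arr rg_C (var rg_j)
          + (var rg_acc + arr rg_code (var rg_sel * var rg_m + var rg_j))).eval I S₂ with hS₃
        have hcand : S₃ rg_cand 0 = P.candidate (S rg_C) (S rg_D) s i k := by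
          rw [hS₃, eval_assign, upd_same]
          simp only [eval_sub, eval_arr, eval_var, eval_add, eval_mul]
          rw [hacc, f2 rg_sd (by decide), f2 rg_D (by decide), f2 rg_j (by decide),
            f2 rg_C (by decide), f2 rg_code (by decide), f2 rg_sel (by decide),
            f2 rg_m (by decide), hv, e2, hP'.m, hP'.code i hi k hk, e0 rg_sd (by decide)
            (by decide), e0 rg_D (by decide) (by decide), e0 rg_C (by decide) (by decide), hsd]
          rfl
        have ht₃ : S₃ rg_t0 0 = S' rg_t0 0 := by
          rw [hS₃, eval_assign, upd_of_ne (by decide), f2 _ (by decide)]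
        simp only [Q]
        have hins : ((Finset.range (k + 1)).filter fun j =>
            P.edge (i * P.m + j) ≠ 0 ∧ ¬ 2 ≤ P.count U j)
            = insert k ((Finset.range k).filter fun j =>
              P.edge (i * P.m + j) ≠ 0 ∧ ¬ 2 ≤ P.count U j) := by
          rw [Finset.range_add_one, Finset.filter_insert, if_pos ⟨g1, g2⟩]
        rw [eval_cond, eval_sub, eval_var, eval_var, hcand, ht₃, upd_of_ne (by decide), hins]
        simp only [Finset.forall_mem_insert, Finset.exists_mem_insert]
        by_cases g3 : P.candidate (S rg_C) (S rg_D) s i k ≤ S' rg_t0 0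
        · rw [if_neg (by simpa using Nat.sub_eq_zero_of_le g3), eval_skip, ht₃]
          exact ⟨h1, ⟨g3, h2⟩, h3.imp_right Or.inr⟩
        · rw [if_pos (by omega), eval_assign, upd_same, eval_var, hcand]
          exact ⟨by omega, ⟨le_rfl, fun j hj => (h2 j hj).trans (by omega)⟩, Or.inr (Or.inl rfl)⟩

end Round

end RAM

end NashWelfare
namespace NashWelfare

namespace RAM

open AExp Cmd

section Round

variable {I : ℕ → ℕ} {S : Store} {P : Params}

theorem highCmd_spec (hP : P.Holds S) {i s j : ℕ} (hi : i < P.n) (hsel : S rg_sel 0 = i)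
    (hsd : S rg_sd 0 = s) (hpar : S rg_par 0 = j) (hj : j < P.m) :
    highCmd.eval I S rg_t1 0 = s + P.paired i j := by
  simp only [highCmd, eval_seq]
  set S₁ := (gainCmd (arr rg_u (var rg_sel) + arr rg_v (var rg_sel * var rg_m
    + var rg_par))).eval I S with hS₁
  have f1 : ∀ a, a ∉ (gainCmd (arr rg_u (var rg_sel) + arr rg_v (var rg_sel * var rg_m
    + var rg_par))).writes → S₁ a = S a := fun a ha => eval_frame I _ ha S
  have hacc : S₁ rg_acc 0 = P.gain i (P.base i + P.value (i * P.m + j)) := by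
    rw [hS₁, gainCmd_spec hP _ hi hsel]
    simp [hsel, hP.base i hi, hP.m, hpar, hP.value i hi j hj]
  rw [eval_assign, upd_same]
  simp only [eval_arr, eval_var, eval_add, eval_mul]
  rw [hacc, f1 rg_sd (by decide), f1 rg_code (by decide), f1 rg_sel (by decide),
    f1 rg_m (by decide), f1 rg_par (by decide), hsel, hP.m, hpar, hP.code i hi j hj, hsd]
  rfl

theorem updateCmd_spec {i j t₀ t₁ : ℕ} (hsel : S rg_sel 0 = i) (hpar : S rg_par 0 = j)
    (h₀ : S rg_t0 0 = t₀) (h₁ : S rg_t1 0 = t₁) :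
    updateCmd.eval I S rg_C = Function.update (S rg_C) j (S rg_C j + t₀) ∧
    updateCmd.eval I S rg_D = Function.update (S rg_D) j (max (S rg_D j + t₀) (S rg_C j + t₁)) ∧
    updateCmd.eval I S rg_alive = Function.update (S rg_alive) i 0 := by
  simp only [updateCmd, eval_seq, eval_cond, eval_sub, eval_add, eval_arr, eval_var, eval_assign,
    eval_set, eval_skip]
  by_cases h : S rg_C j + t₁ ≤ S rg_D j + t₀
  · have h' : S rg_C j + t₁ - (S rg_D j + t₀) = 0 := by omega
    simp [upd, hsel, hpar, h₀, h₁, h', max_eq_left h]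
  · have h' : S rg_C j + t₁ - (S rg_D j + t₀) ≠ 0 := by omega
    simp [upd, hsel, hpar, h₀, h₁, h', max_eq_right (le_of_not_ge h)]

/-- The state of the elimination when the agents in `U` are left. -/
structure Eliminating (P : Params) (U : Finset ℕ) (S : Store) : Prop where
  holds : P.Holds S
  subset : U ⊆ Finset.range P.n
  alive : ∀ i < P.n, S rg_alive i = if i ∈ U then 1 else 0
  tables : TableInv P.n P.m P.Adj P.single P.paired U (S rg_C) (S rg_D)

theorem Params.childItems_eq {U : Finset ℕ} {i : ℕ} (hi : i ∈ U)
    (hedge : ∀ i ∈ U, ∀ j < P.m, P.edge (i * P.m + j) ≤ 1) :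
    childItems P.m P.Adj U i = P.ownItems U i := by
  ext j
  rw [mem_childItems, Params.ownItems, Finset.mem_filter, Finset.mem_range]
  refine and_congr_right fun hj => and_congr_right fun hij => ?_
  rw [Params.Adj] at hij
  have h1 := hedge i hi j hj
  rw [Params.count, ← Finset.add_sum_erase _ _ hi]
  constructor
  · intro h
    rw [Finset.sum_eq_zero]
    · omega
    · intro k hk
      by_contra hne
      exact (Finset.mem_erase.mp hk).1 (h k (Finset.mem_erase.mp hk).2 hne)
  · intro h k hk hkj
    by_contra hne
    have := Finset.single_le_sum (f := fun k => P.edge (k * P.m + j)) (fun _ _ => Nat.zero_le _)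
      (Finset.mem_erase.mpr ⟨hne, hk⟩)
    have h2 : P.edge (k * P.m + j) ≠ 0 := hkj
    omega

theorem roundCmd_spec {U : Finset ℕ} (hS : Eliminating P U S)
    (hedge : ∀ i < P.n, ∀ j < P.m, P.edge (i * P.m + j) ≤ 1)
    (hex : ∃ i ∈ U, (P.sharedItems U i).card ≤ 1) :
    ∃ i ∈ U, Eliminating P (U.erase i) (roundCmd.eval I S) := by
  simp only [roundCmd, eval_seq]
  set S₁ := countCmd.eval I S with hS₁
  set S₂ := selectCmd.eval I S₁ with hS₂
  set S₃ := parentCmd.eval I S₂ with hS₃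
  set S₄ := belowCmd.eval I S₃ with hS₄
  set S₅ := lowCmd.eval I S₄ with hS₅
  set S₆ := highCmd.eval I S₅ with hS₆
  have f1 : ∀ a, a ∉ countCmd.writes → S₁ a = S a := fun a ha => eval_frame I _ ha S
  have f2 : ∀ a, a ∉ selectCmd.writes → S₂ a = S₁ a := fun a ha => eval_frame I _ ha S₁
  have f3 : ∀ a, a ∉ parentCmd.writes → S₃ a = S₂ a := fun a ha => eval_frame I _ ha S₂
  have f4 : ∀ a, a ∉ belowCmd.writes → S₄ a = S₃ a := fun a ha => eval_frame I _ ha S₃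
  have f5 : ∀ a, a ∉ lowCmd.writes → S₅ a = S₄ a := fun a ha => eval_frame I _ ha S₄
  have f6 : ∀ a, a ∉ highCmd.writes → S₆ a = S₅ a := fun a ha => eval_frame I _ ha S₅
  have p1 : P.Holds S₁ := hS.holds.eval I (by decide)
  have p2 : P.Holds S₂ := p1.eval I (by decide)
  have p3 : P.Holds S₃ := p2.eval I (by decide)
  have p4 : P.Holds S₄ := p3.eval I (by decide)
  have p5 : P.Holds S₅ := p4.eval I (by decide)
  have p6 : P.Holds S₆ := p5.eval I (by decide)
  have p7 : P.Holds (updateCmd.eval I S₆) := p6.eval I (by decide)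
  have hcnt : ∀ j < P.m, S₁ rg_al j = P.count U j :=
    fun j hj => countCmd_spec hS.holds hS.subset hS.alive hj
  have hal₁ : ∀ i < P.n, S₁ rg_alive i = if i ∈ U then 1 else 0 := by
    rw [f1 _ (by decide)]
    exact hS.alive
  obtain ⟨hiU, hcard⟩ := selectCmd_spec (I := I) p1 hS.subset hal₁ hcnt hex
  rw [← hS₂] at hiU hcard
  generalize hi : S₂ rg_sel 0 = i at hiU hcard
  have hin : i < P.n := Finset.mem_range.mp (hS.subset hiU)
  have hcnt₂ : ∀ j < P.m, S₂ rg_al j = P.count U j := by rwa [f2 _ (by decide)]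
  have hpar := parentCmd_spec (I := I) p2 hcnt₂ hin hi
  rw [← hS₃] at hpar
  generalize hp : S₃ rg_par 0 = p at hpar
  have hcnt₃ : ∀ j < P.m, S₃ rg_al j = P.count U j := by rwa [f3 _ (by decide)]
  have hi₃ : S₃ rg_sel 0 = i := by rwa [f3 _ (by decide)]
  have hsd := belowCmd_spec (I := I) p3 hcnt₃ hin hi₃
  rw [← hS₄] at hsd
  have hcnt₄ : ∀ j < P.m, S₄ rg_al j = P.count U j := by rwa [f4 _ (by decide)]
  have hi₄ : S₄ rg_sel 0 = i := by rwa [f4 _ (by decide)]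
  have hlow := lowCmd_spec (I := I) p4 hcnt₄ hin hi₄ hsd
  rw [← hS₅] at hlow
  have hi₅ : S₅ rg_sel 0 = i := by rwa [f5 _ (by decide)]
  have hp₅ : S₅ rg_par 0 = p := by rwa [f5 _ (by decide), f4 _ (by decide)]
  have hsd₅ : S₅ rg_sd 0 = ∑ j ∈ P.ownItems U i, S₃ rg_D j := by rwa [f5 _ (by decide)]
  have hhigh : p < P.m → S₆ rg_t1 0 = _ := fun hpm => highCmd_spec (I := I) p5 hin hi₅ hsd₅ hp₅ hpm
  obtain ⟨u1, u2, u3⟩ := updateCmd_spec (I := I) (S := S₆) (i := i) (j := p)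
    (by rw [f6 _ (by decide), hi₅]) (by rw [f6 _ (by decide), hp₅]) rfl rfl
  have hD₃ : S₃ rg_D = S rg_D := by
    rw [f3 _ (by decide), f2 _ (by decide), f1 _ (by decide)]
  have hD₄ : S₄ rg_D = S rg_D := by rw [f4 _ (by decide), hD₃]
  have hD₆ : S₆ rg_D = S rg_D := by rw [f6 _ (by decide), f5 _ (by decide), hD₄]
  have hC₄ : S₄ rg_C = S rg_C := by
    rw [f4 _ (by decide), f3 _ (by decide), f2 _ (by decide), f1 _ (by decide)]
  have hC₆ : S₆ rg_C = S rg_C := by rw [f6 _ (by decide), f5 _ (by decide), hC₄]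
  have ht₆ : S₆ rg_t0 0 = S₅ rg_t0 0 := by rw [f6 _ (by decide)]
  have hal₆ : S₆ rg_alive = S rg_alive := by
    rw [f6 _ (by decide), f5 _ (by decide), f4 _ (by decide), f3 _ (by decide), f2 _ (by decide),
      f1 _ (by decide)]
  rw [hD₃] at hhigh
  rw [hD₃, hD₄, hC₄] at hlow
  rw [hC₆, ht₆] at u1
  rw [hC₆, hD₆, ht₆] at u2
  rw [hal₆] at u3
  have hch := P.childItems_eq hiU fun k hk => hedge k (Finset.mem_range.mp (hS.subset hk))
  have hcand : ∀ j ∈ P.ownItems U i, P.candidate (S rg_C) (S rg_D)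
      (∑ j ∈ P.ownItems U i, S rg_D j) i j
      = ∑ k ∈ (P.ownItems U i).erase j, S rg_D k + S rg_C j + P.paired i j := by
    intro j hj
    rw [Params.candidate, ← Finset.sum_erase_add _ _ hj, Nat.add_sub_cancel]
  have hE : IsElimination P.m P.Adj P.single P.paired U i p (S₅ rg_t0 0) (S rg_C) (S rg_D)
      (updateCmd.eval I S₆ rg_C) (updateCmd.eval I S₆ rg_D) := by
    refine ⟨?_, ?_, ?_, ?_, ?_, ?_, ?_, ?_⟩
    · intro j hj hij hnot
      have hjs : j ∈ P.sharedItems U i := by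
        rw [hch, Params.ownItems, Finset.mem_filter] at hnot
        rw [Params.sharedItems, Finset.mem_filter]
        refine ⟨Finset.mem_range.mpr hj, hij, ?_⟩
        by_contra hcon
        exact hnot ⟨Finset.mem_range.mpr hj, hij, hcon⟩
      rcases hpar with ⟨_, h0⟩ | hps
      · rw [h0] at hjs
        simp at hjs
      · exact Finset.card_le_one.mp hcard j hjs p hps
    · rw [hch, Params.ownItems, Finset.mem_filter]
      rcases hpar with ⟨h0, _⟩ | hps
      · exact ⟨fun h => by simp [h0] at h, Or.inl h0⟩
      · rw [Params.sharedItems, Finset.mem_filter] at hps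
        exact ⟨fun h => h.2.2 hps.2.2, Or.inr ⟨Finset.mem_range.mp hps.1, hps.2.1⟩⟩
    · rw [hch]
      exact hlow.1
    · rw [hch]
      intro j hj
      rw [← hcand j hj]
      exact hlow.2.1 j hj
    · rw [hch]
      refine hlow.2.2.imp_right ?_
      rintro ⟨j, hj, h⟩
      exact ⟨j, hj, h.trans (hcand j hj)⟩
    · intro j hj
      rw [u1, u2, Function.update_of_ne hj, Function.update_of_ne hj]
      exact ⟨rfl, rfl⟩
    · rw [u1, Function.update_self]
    · intro hpm
      rw [u2, Function.update_self, hhigh hpm, hch]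
  refine ⟨i, hiU, p7, (Finset.erase_subset _ _).trans hS.subset, ?_, hS.tables.step hiU hin hE⟩
  intro k hk
  rw [u3, Function.update_apply]
  by_cases hki : k = i
  · simp [hki]
  · simp [hki, hS.alive k hk]

theorem eliminate_spec (hS : Eliminating P (Finset.range P.n) S)
    (hedge : ∀ i < P.n, ∀ j < P.m, P.edge (i * P.m + j) ≤ 1)
    (hex : ∀ U ⊆ Finset.range P.n, U.Nonempty → ∃ i ∈ U, (P.sharedItems U i).card ≤ 1) :
    Eliminating P ∅ ((forb rg_r rg_n roundCmd).eval I S) := by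
  have key : ∃ U, U.card + P.n = P.n ∧ Eliminating P U ((forb rg_r rg_n roundCmd).eval I S) := by
    have := eval_forb I (v := rg_r) (b := rg_n) (c := roundCmd) (by decide) S
      (fun k S' => ∃ U : Finset ℕ, U.card + k = P.n ∧ Eliminating P U S') ?_ ?_
    · rwa [hS.holds.n] at this
    · refine ⟨_, Finset.card_range _, hS.holds.congr ?_, hS.subset, ?_, ?_⟩
      · intro a ha
        exact upd_of_ne (by revert a; decide)
      · rw [upd_of_ne (by decide)]
        exact hS.alive
      · rw [upd_of_ne (by decide), upd_of_ne (by decide)]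
        exact hS.tables
    · rintro k S' hk - - ⟨U, hU, hS'⟩
      rw [hS.holds.n] at hk
      obtain ⟨i, hi, hE⟩ := roundCmd_spec (I := I) hS' hedge (hex U hS'.subset
        (Finset.card_pos.mp (by omega)))
      refine ⟨U.erase i, ?_, hE.holds.congr ?_, hE.subset, ?_, ?_⟩
      · have := Finset.card_erase_add_one hi
        omega
      · intro a ha
        exact upd_of_ne (by revert a; decide)
      · rw [upd_of_ne (by decide)]
        exact hE.alive
      · rw [upd_of_ne (by decide), upd_of_ne (by decide)]
        exact hE.tables
  obtain ⟨U, hU, hE⟩ := key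
  rw [Finset.card_eq_zero.mp (show U.card = 0 by omega)] at hE
  exact hE

theorem outCmd_spec {n m : ℕ} (hn : S rg_n 0 = n) (hm : S rg_m 0 = m)
    (hpw : ∀ j < m + 1, S rg_pw j = (n + 1) ^ j) {j : ℕ} (hj : j < m) :
    outCmd.eval I S rg_out j = if 2 ≤ S rg_deg j then S rg_C m / (n + 1) ^ j % (n + 1) - 1
      else S rg_own j := by
  rw [outCmd]
  refine (eval_forb_table (by decide) (by decide) _ (fun j => if 2 ≤ S rg_deg j then
    S rg_C m / (n + 1) ^ j % (n + 1) - 1 else S rg_own j) ?_ _).trans ?_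
  · intro k S' hk hv hS
    rw [hm] at hk
    have e1 : S' rg_m 0 = m := by rw [hS _ (by decide) (by decide), hm]
    have e2 : S' rg_n 0 = n := by rw [hS _ (by decide) (by decide), hn]
    have e3 : S' rg_pw k = (n + 1) ^ k := by
      rw [hS _ (by decide) (by decide), hpw k (by omega)]
    have e4 : S' rg_C m = S rg_C m := by rw [hS _ (by decide) (by decide)]
    have e5 : S' rg_deg k = S rg_deg k := by rw [hS _ (by decide) (by decide)]
    have e6 : S' rg_own k = S rg_own k := by rw [hS _ (by decide) (by decide)]
    rw [eval_cond, show (arr rg_deg (var rg_j) - 1 : AExp).eval I S' = S rg_deg k - 1 by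
      simp [hv, e5]]
    simp only [eval_sub, eval_arr, eval_var, eval_div, eval_mul, eval_add, eval_one, eval_set, hv,
      e1, e2, e3, e4, e6, mod_exp]
    by_cases h : 2 ≤ S rg_deg k
    · simp [upd, h, show S rg_deg k - 1 ≠ 0 by omega]
    · simp [upd, h, show S rg_deg k - 1 = 0 by omega]
  · rw [hm, if_pos hj]

end Round

end RAM

end NashWelfare
namespace NashWelfare

namespace RAM

open AExp Cmd

/-! ### The effect of the two phases -/

section Phases

variable {I : ℕ → ℕ} {S : Store}

/-- The degrees of the items. -/
def inputDegree (I : ℕ → ℕ) (n m j : ℕ) : ℕ :=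
  ((Finset.range n).filter fun i => I (edgeCell n (n * m) (i * m + j)) ≠ 0).card

/-- The common denominator of the input. -/
def inputDen (I : ℕ → ℕ) (K : ℕ) : ℕ := ∏ t ∈ Finset.range K, I (2 * t + 3)

/-- The integral values of the input. -/
def inputValue (I : ℕ → ℕ) (d t : ℕ) : ℕ := I (2 * t + 2) * (d / I (2 * t + 3))

/-- The integral weights of the input. -/
def inputWeight (I : ℕ → ℕ) (n m d i : ℕ) : ℕ :=
  I (2 * (n * m + i) + 2) * (d * (n + 1) ^ (m + 1) / I (2 * (n * m + i) + 3))

/-- The matching problem that belongs to the input. -/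
def inputParams (I : ℕ → ℕ) (n m d l : ℕ) : Params where
  n := n
  m := m
  len := l
  huge := (n + 1) ^ (m + 1) + l * ∑ i ∈ Finset.range n, inputWeight I n m d i
  edge t := if I (edgeCell n (n * m) t) ≠ 0 ∧ 2 ≤ inputDegree I n m (t % m) then 1 else 0
  weight := inputWeight I n m d
  base i := ∑ j ∈ Finset.range m, if I (edgeCell n (n * m) (i * m + j)) ≠ 0 ∧
    ¬ 2 ≤ inputDegree I n m j then inputValue I d (i * m + j) else 0
  value := inputValue I d
  code t := (t / m + 1) * (n + 1) ^ (t % m)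

theorem mul_add_mod {i j m : ℕ} (hj : j < m) : (i * m + j) % m = j := by
  rw [mul_comm, Nat.mul_add_mod, Nat.mod_eq_of_lt hj]

theorem mul_add_div {i j m : ℕ} (hj : j < m) : (i * m + j) / m = i := by
  rw [mul_comm, Nat.mul_add_div (by omega), Nat.div_eq_of_lt hj, add_zero]

theorem phaseA_spec {n m : ℕ} (hN : S rg_nm 0 = n * m) (hK : S rg_K 0 = 2 * (n * m) + n)
    (hI : 2 * (2 * (n * m) + n) + 2 ≤ I 0) :
    phaseA.eval I S rg_den 0 = inputDen I (2 * (n * m) + n) ∧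
    (∀ t < n * m, phaseA.eval I S rg_v t
      = inputValue I (inputDen I (2 * (n * m) + n)) t) ∧
    phaseA.eval I S rg_x 0 = ∑ t ∈ Finset.range (n * m),
      inputValue I (inputDen I (2 * (n * m) + n)) t := by
  simp only [phaseA, eval_seq]
  have h1 : denCmd.eval I S rg_den 0 = inputDen I (2 * (n * m) + n) := denCmd_spec hK hI
  set S₁ := denCmd.eval I S with hS₁
  have hN₁ : S₁ rg_nm 0 = n * m := by rwa [hS₁, eval_frame I _ (by decide)]
  set S₂ := valCmd.eval I S₁ with hS₂
  have h2 : ∀ t < n * m, S₂ rg_v t = inputValue I (inputDen I (2 * (n * m) + n)) t :=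
    fun t ht => valCmd_spec hN₁ h1 (by omega) ht
  have hN₂ : S₂ rg_nm 0 = n * m := by rwa [hS₂, eval_frame I _ (by decide)]
  refine ⟨?_, ?_, sumCmd_spec hN₂ h2⟩
  · rw [eval_frame I _ (by decide), hS₂, eval_frame I _ (by decide), h1]
  · rw [eval_frame I _ (by decide)]
    exact h2

theorem prepCmd_spec {n m d l : ℕ} (hn : S rg_n 0 = n) (hm : S rg_m 0 = m)
    (hN : S rg_nm 0 = n * m) (hm1 : S rg_m1 0 = m + 1) (hl : S rg_len 0 = l)
    (hd : S rg_den 0 = d) (hv : ∀ t < n * m, S rg_v t = inputValue I d t)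
    (hC : S rg_C = fun _ => 0) (hD : S rg_D = fun _ => 0)
    (hI : 2 * (2 * (n * m) + n) + 2 ≤ I 0) :
    Eliminating (inputParams I n m d l) (Finset.range n) (prepCmd.eval I S) ∧
    (∀ j < m + 1, prepCmd.eval I S rg_pw j = (n + 1) ^ j) ∧
    ∀ j < m, prepCmd.eval I S rg_deg j = inputDegree I n m j ∧
      (0 < n → prepCmd.eval I S rg_own j < n) ∧
      ∀ i < n, I (edgeCell n (n * m) (i * m + j)) ≠ 0 →
        I (edgeCell n (n * m) (prepCmd.eval I S rg_own j * m + j)) ≠ 0 := by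
  simp only [prepCmd, eval_seq]
  set S₁ := scaleCmd.eval I S with hS₁
  set S₂ := weightCmd.eval I S₁ with hS₂
  set S₃ := powCmd.eval I S₂ with hS₃
  set S₄ := hugeCmd.eval I S₃ with hS₄
  set S₅ := degCmd.eval I S₄ with hS₅
  set S₆ := nonleafCmd.eval I S₅ with hS₆
  set S₇ := leafCmd.eval I S₆ with hS₇
  set S₈ := codeCmd.eval I S₇ with hS₈
  set S₉ := aliveCmd.eval I S₈ with hS₉
  have f1 : ∀ a, a ∉ scaleCmd.writes → S₁ a = S a := fun a ha => eval_frame I _ ha S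
  have f2 : ∀ a, a ∉ weightCmd.writes → S₂ a = S₁ a := fun a ha => eval_frame I _ ha S₁
  have f3 : ∀ a, a ∉ powCmd.writes → S₃ a = S₂ a := fun a ha => eval_frame I _ ha S₂
  have f4 : ∀ a, a ∉ hugeCmd.writes → S₄ a = S₃ a := fun a ha => eval_frame I _ ha S₃
  have f5 : ∀ a, a ∉ degCmd.writes → S₅ a = S₄ a := fun a ha => eval_frame I _ ha S₄
  have f6 : ∀ a, a ∉ nonleafCmd.writes → S₆ a = S₅ a := fun a ha => eval_frame I _ ha S₅
  have f7 : ∀ a, a ∉ leafCmd.writes → S₇ a = S₆ a := fun a ha => eval_frame I _ ha S₆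
  have f8 : ∀ a, a ∉ codeCmd.writes → S₈ a = S₇ a := fun a ha => eval_frame I _ ha S₇
  have f9 : ∀ a, a ∉ aliveCmd.writes → S₉ a = S₈ a := fun a ha => eval_frame I _ ha S₈
  have hw : ∀ i < n, S₂ rg_w i = inputWeight I n m d i := by
    intro i hi
    refine weightCmd_spec (S := S₁) (by rwa [f1 _ (by decide)]) (by rwa [f1 _ (by decide)])
      (scaleCmd_spec hn hm1 hd) (by omega) hi
  obtain ⟨hbig, hpw⟩ := powCmd_spec (I := I) (S := S₂) (n := n) (m := m)
    (by rwa [f2 _ (by decide), f1 _ (by decide)]) (by rwa [f2 _ (by decide), f1 _ (by decide)])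
  rw [← hS₃] at hbig hpw
  have hhuge : S₄ rg_huge 0
      = (n + 1) ^ (m + 1) + l * ∑ i ∈ Finset.range n, inputWeight I n m d i := by
    refine hugeCmd_spec ?_ ?_ hbig ?_
    · rwa [f3 _ (by decide), f2 _ (by decide), f1 _ (by decide)]
    · rwa [f3 _ (by decide), f2 _ (by decide), f1 _ (by decide)]
    · rwa [f3 _ (by decide)]
  have n4 : S₄ rg_n 0 = n := by
    rwa [f4 _ (by decide), f3 _ (by decide), f2 _ (by decide), f1 _ (by decide)]
  have m4 : S₄ rg_m 0 = m := by
    rwa [f4 _ (by decide), f3 _ (by decide), f2 _ (by decide), f1 _ (by decide)]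
  have N4 : S₄ rg_nm 0 = n * m := by
    rwa [f4 _ (by decide), f3 _ (by decide), f2 _ (by decide), f1 _ (by decide)]
  have v4 : ∀ t < n * m, S₄ rg_v t = inputValue I d t := by
    rwa [f4 _ (by decide), f3 _ (by decide), f2 _ (by decide), f1 _ (by decide)]
  have hdeg : ∀ j < m, S₅ rg_deg j = inputDegree I n m j ∧ (0 < n → S₅ rg_own j < n) ∧
      ∀ i < n, I (edgeCell n (n * m) (i * m + j)) ≠ 0 →
        I (edgeCell n (n * m) (S₅ rg_own j * m + j)) ≠ 0 :=
    fun j hj => degCmd_spec n4 m4 N4 (by omega) hj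
  have hh : ∀ i < n, ∀ j < m, S₆ rg_h (i * m + j) = if I (edgeCell n (n * m) (i * m + j)) ≠ 0 ∧
      2 ≤ inputDegree I n m j then 1 else 0 :=
    fun i hi j hj => nonleafCmd_spec (by rwa [f5 _ (by decide)]) (by rwa [f5 _ (by decide)])
      (by rwa [f5 _ (by decide)]) (by omega) (fun j hj => (hdeg j hj).1) hi hj
  have hu : ∀ i < n, S₇ rg_u i = (inputParams I n m d l).base i := by
    intro i hi
    refine leafCmd_spec ?_ ?_ ?_ (by omega) ?_ ?_ hi
    · rwa [f6 _ (by decide), f5 _ (by decide)]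
    · rwa [f6 _ (by decide), f5 _ (by decide)]
    · rwa [f6 _ (by decide), f5 _ (by decide)]
    · rw [f6 _ (by decide)]
      exact fun j hj => (hdeg j hj).1
    · rwa [f6 _ (by decide), f5 _ (by decide)]
  have hcode : ∀ i < n, ∀ j < m, S₈ rg_code (i * m + j) = (i + 1) * (n + 1) ^ j := by
    intro i hi j hj
    refine codeCmd_spec ?_ ?_ ?_ hi hj
    · rwa [f7 _ (by decide), f6 _ (by decide), f5 _ (by decide)]
    · rwa [f7 _ (by decide), f6 _ (by decide), f5 _ (by decide)]
    · rwa [f7 _ (by decide), f6 _ (by decide), f5 _ (by decide), f4 _ (by decide)]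
  have n8 : S₈ rg_n 0 = n := by
    rwa [f8 _ (by decide), f7 _ (by decide), f6 _ (by decide), f5 _ (by decide)]
  refine ⟨⟨⟨?_, ?_, ?_, ?_, ?_, ?_, ?_, ?_, ?_⟩, Finset.Subset.refl _, ?_, ?_⟩, ?_, ?_⟩
  · rwa [f9 _ (by decide)]
  · rwa [f9 _ (by decide), f8 _ (by decide), f7 _ (by decide), f6 _ (by decide), f5 _ (by decide)]
  · rwa [f9 _ (by decide), f8 _ (by decide), f7 _ (by decide), f6 _ (by decide), f5 _ (by decide),
      f4 _ (by decide), f3 _ (by decide), f2 _ (by decide), f1 _ (by decide)]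
  · rwa [f9 _ (by decide), f8 _ (by decide), f7 _ (by decide), f6 _ (by decide), f5 _ (by decide)]
  · intro i hi j hj
    rw [f9 _ (by decide), f8 _ (by decide), f7 _ (by decide)]
    refine (hh i hi j hj).trans ?_
    have hj' : j < m := hj
    simp only [inputParams, mul_add_mod hj']
  · rwa [f9 _ (by decide), f8 _ (by decide), f7 _ (by decide), f6 _ (by decide), f5 _ (by decide),
      f4 _ (by decide), f3 _ (by decide)]
  · rwa [f9 _ (by decide), f8 _ (by decide)]
  · intro i hi j hj
    rw [f9 _ (by decide), f8 _ (by decide), f7 _ (by decide), f6 _ (by decide), f5 _ (by decide)]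
    exact v4 _ (mul_add_lt hi hj)
  · intro i hi j hj
    rw [f9 _ (by decide)]
    refine (hcode i hi j hj).trans ?_
    have hj' : j < m := hj
    simp only [inputParams, mul_add_mod hj', mul_add_div hj']
  · intro i hi
    rw [hS₉, aliveCmd_spec n8 hi, if_pos (Finset.mem_range.mpr (show i < n from hi))]
  · rw [f9 _ (by decide), f8 _ (by decide), f7 _ (by decide), f6 _ (by decide), f5 _ (by decide),
      f4 _ (by decide), f3 _ (by decide), f2 _ (by decide), f1 _ (by decide), f9 _ (by decide),
      f8 _ (by decide), f7 _ (by decide), f6 _ (by decide), f5 _ (by decide),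
      f4 _ (by decide), f3 _ (by decide), f2 _ (by decide), f1 _ (by decide), hC, hD]
    exact TableInv.init
  · rwa [f9 _ (by decide), f8 _ (by decide), f7 _ (by decide), f6 _ (by decide), f5 _ (by decide),
      f4 _ (by decide)]
  · rwa [f9 _ (by decide), f8 _ (by decide), f7 _ (by decide), f6 _ (by decide),
      f9 _ (by decide), f8 _ (by decide), f7 _ (by decide), f6 _ (by decide)]

/-- The second phase solves the matching problem and decodes the solution. -/
theorem phaseB_spec {n m d l : ℕ} (hn : S rg_n 0 = n) (hm : S rg_m 0 = m)
    (hN : S rg_nm 0 = n * m) (hm1 : S rg_m1 0 = m + 1) (hl : S rg_len 0 = l)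
    (hd : S rg_den 0 = d) (hv : ∀ t < n * m, S rg_v t = inputValue I d t)
    (hC : S rg_C = fun _ => 0) (hD : S rg_D = fun _ => 0)
    (hI : 2 * (2 * (n * m) + n) + 2 ≤ I 0)
    (hex : ∀ U ⊆ Finset.range n, U.Nonempty →
      ∃ i ∈ U, ((inputParams I n m d l).sharedItems U i).card ≤ 1) :
    ∃ C D own : ℕ → ℕ, TableInv n m (inputParams I n m d l).Adj (inputParams I n m d l).single
        (inputParams I n m d l).paired ∅ C D ∧
      (∀ j < m, (0 < n → own j < n) ∧ ∀ i < n, I (edgeCell n (n * m) (i * m + j)) ≠ 0 →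
        I (edgeCell n (n * m) (own j * m + j)) ≠ 0) ∧
      ∀ j < m, phaseB.eval I S rg_out j = if 2 ≤ inputDegree I n m j then
        C m / (n + 1) ^ j % (n + 1) - 1 else own j := by
  obtain ⟨h1, h2, h3⟩ := prepCmd_spec (I := I) hn hm hN hm1 hl hd hv hC hD hI
  simp only [phaseB, eval_seq]
  set S₁ := prepCmd.eval I S with hS₁
  have h4 := eliminate_spec (I := I) h1 (fun i hi j hj => by
    simp only [inputParams]
    split_ifs <;> omega) hex
  set S₂ := (forb rg_r rg_n roundCmd).eval I S₁ with hS₂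
  have f2 : ∀ a, a ∉ (forb rg_r rg_n roundCmd).writes → S₂ a = S₁ a :=
    fun a ha => eval_frame I _ ha S₁
  refine ⟨S₂ rg_C, S₂ rg_D, S₁ rg_own, h4.tables, fun j hj => (h3 j hj).2, fun j hj => ?_⟩
  rw [outCmd_spec (n := n) h4.holds.n h4.holds.m (by rwa [f2 _ (by decide)]) hj,
    f2 rg_deg (by decide), f2 rg_own (by decide), (h3 j hj).1]
  rfl

end Phases

end RAM

end NashWelfare
namespace NashWelfare

namespace RAM

open AExp Cmd

/-! ### The complete program -/

section Program

/-- The address behind the input. -/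
def lenExp : Exp := .bin .add (.const 2) (.bin .mul (.const 2) (.bin .add (.bin .mul (.const 2)
  (.bin .mul (.load (.const 0)) (.load (.const 1)))) (.load (.const 0))))

/-- Set up the arrays behind the input. -/
def initProg : Prog := .seq (.store lenExp (.load (.const 0))) (.store (.const 0) lenExp)

/-- Set up the bounds of the loops. -/
def setupCmd : Cmd := rg_m ≔ inp 1 ;; rg_nm ≔ var rg_n * var rg_m ;;
  rg_K ≔ 2 * var rg_nm + var rg_n ;; rg_m1 ≔ var rg_m + 1

/-- The classes of the arrays during the set-up. -/
def setupClass (a : ℕ) : ℕ := if a = rg_n then 1 else 0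

theorem setupCmd_ok : setupCmd.ok setupClass = true := by decide

/-- One step of the computation of a bit length. -/
def halveCmd : Cmd := rg_x ≔ var rg_x / 2 ;; rg_len ≔ var rg_len + 1

/-- Compute the bit length of the sum of all values. -/
def lengthProg : Prog := .loop (var rg_x).compile halveCmd.compile

/-- Write the owner of an item. -/
def writeProg : Prog := .seq (rg_j ≔ var rg_j - 1).compile
  (.store (var rg_j).compile (arr rg_out (var rg_j)).compile)

/-- Write the output. -/
def outputProg : Prog := .seq (rg_j ≔ var rg_m).compile
  (.seq (.loop (var rg_j - 1).compile writeProg) (.store (.const 0) (arr rg_out 0).compile))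

/-- The program. -/
def mainProg : Prog := .seq initProg (.seq setupCmd.compile (.seq phaseA.compile
  (.seq lengthProg (.seq phaseB.compile outputProg))))

variable {I : ℕ → ℕ} {S : Store} {M : Memory} {β : ℕ}

/-- The bound of the bit lengths of all cells. -/
structure BitBound (β : ℕ) (I : ℕ → ℕ) (S : Store) : Prop where
  one_le : 1 ≤ β
  inp : ∀ x, I x < 2 ^ β
  arr : ∀ a i, S a i < 2 ^ β

theorem BitBound.upd (h : BitBound β I S) {a i x : ℕ} (hx : x < 2 ^ β) :
    BitBound β I (upd S a i x) := by
  refine ⟨h.one_le, h.inp, fun a' i' => ?_⟩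
  rw [upd_apply]
  split_ifs
  exacts [hx, h.arr a' i']

theorem Rep.runs_assign (h : Rep I S M) (hb : BitBound β I S) {a : ℕ} (ha : a < numArrays)
    {e : AExp} (he : e.wf = true) :
    ∃ M' t, Runs (a ≔ e).compile M M' t ∧ Rep I (upd S a 0 (e.eval I S)) M' ∧
      t ≤ β * storeWeight (addrExp a (0 : AExp).compile) e.compile :=
  h.runs_store hb.one_le hb.inp hb.arr (i := 0) ha rfl he

/-- A bound for the cost of one pass through the length loop. -/
def halveWeight : ℕ := (var rg_x).compile.weight
  + storeWeight (addrExp rg_x (0 : AExp).compile) (var rg_x / 2).compile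
  + storeWeight (addrExp rg_len (0 : AExp).compile) (var rg_len + 1).compile + 2

theorem runs_lengthProg (x : ℕ) : ∀ {S : Store} {M : Memory}, Rep I S M → BitBound β I S →
    S rg_x 0 = x → S rg_len 0 + x.size ≤ β →
    ∃ S' M' t, Runs lengthProg M M' t ∧ Rep I S' M' ∧ BitBound β I S' ∧
      S' rg_len 0 = S rg_len 0 + x.size ∧ (∀ i ≠ 0, S' rg_len i = S rg_len i) ∧
      (∀ a, a ≠ rg_x → a ≠ rg_len → S' a = S a) ∧ t ≤ (x.size + 1) * (β * halveWeight) := by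
  induction x using Nat.strong_induction_on with
  | _ x ih =>
    intro S M hR hB hx hl
    have hβ := hB.one_le
    have hcost := Exp.cost_le hβ (hR.lt hB.inp hB.arr) (var rg_x).compile
    have heval : (var rg_x).compile.eval M = x := by
      rw [hR.eval_compile (by decide), eval_var, hx]
    have hw : (var rg_x).compile.weight + 1 ≤ halveWeight := by
      rw [halveWeight]
      omega
    rcases Nat.eq_zero_or_pos x with h0 | h0
    · subst h0
      refine ⟨S, M, _, Runs.loopStop heval, hR, hB, by simp, fun _ _ => rfl, fun _ _ _ => rfl, ?_⟩
      simp only [Nat.size_zero, zero_add, one_mul]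
      nlinarith
    · obtain ⟨M₁, t₁, r₁, R₁, c₁⟩ := hR.runs_assign hB (a := rg_x) (by decide)
        (e := var rg_x / 2) (by decide)
      have hv : (var rg_x / 2).eval I S = x / 2 := by simp [hx]
      rw [hv] at R₁
      have hxlt : x < 2 ^ β := hx ▸ hB.arr rg_x 0
      have B₁ := hB.upd (a := rg_x) (i := 0) (x := x / 2) ((Nat.div_le_self _ _).trans_lt hxlt)
      obtain ⟨M₂, t₂, r₂, R₂, c₂⟩ := R₁.runs_assign B₁ (a := rg_len) (by decide)
        (e := var rg_len + 1) (by decide)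
      have hv' : (var rg_len + 1).eval I (upd S rg_x 0 (x / 2)) = S rg_len 0 + 1 := by
        simp [upd_apply]
      rw [hv'] at R₂
      have hsize : x.size = (x / 2).size + 1 := by
        have h1 : ∀ k, x.size ≤ k + 1 ↔ (x / 2).size ≤ k := by
          intro k
          rw [Nat.size_le, Nat.size_le, Nat.div_lt_iff_lt_mul two_pos, pow_succ]
        apply le_antisymm
        · exact (h1 _).mpr le_rfl
        · have h2 : 0 < x.size := Nat.size_pos.mpr h0
          have := (h1 (x.size - 1)).mp (by omega)
          omega
      have hlen : S rg_len 0 + 1 < 2 ^ β :=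
        (show S rg_len 0 + 1 ≤ β by omega).trans_lt Nat.lt_two_pow_self
      obtain ⟨S', M', t, r, R, B, l1, l2, l3, c⟩ := ih (x / 2) (by omega) R₂ (B₁.upd hlen)
        (by simp [upd_apply]) (by rw [upd_same]; omega)
      refine ⟨S', M', _, Runs.loopStep (by rw [heval]; omega) (Runs.seq r₁ r₂) r, R, B, ?_, ?_,
        ?_, ?_⟩
      · rw [l1, upd_same]
        omega
      · intro i hi
        rw [l2 i hi]
        simp [upd_apply, hi]
      · intro a ha ha'
        rw [l3 a ha ha', upd_of_ne ha', upd_of_ne ha]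
      · rw [hsize]
        have e : ((x / 2).size + 1 + 1) * (β * halveWeight)
            = ((x / 2).size + 1) * (β * halveWeight) + β * halveWeight := by ring
        have e' : β * halveWeight = β * (var rg_x).compile.weight
          + β * storeWeight (addrExp rg_x (0 : AExp).compile) (var rg_x / 2).compile
          + β * storeWeight (addrExp rg_len (0 : AExp).compile) (var rg_len + 1).compile
          + β * 2 := by
          rw [halveWeight]
          ring
        omega

theorem Rep.update_inp (h : Rep I S M) {x y : ℕ} (hx : 0 < x) (hx' : x < I 0) :
    Rep (Function.update I x y) S (Function.update M x y) := by
  have h0 : Function.update I x y 0 = I 0 := Function.update_of_ne hx.ne _ _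
  refine ⟨by rw [h0]; exact h.pos, fun z hz => ?_, fun a ha i => ?_⟩
  · rw [h0] at hz
    rw [Function.update_apply, Function.update_apply, h.inp z hz]
  · rw [h0, Function.update_of_ne (by omega), h.arr a ha i]

theorem BitBound.update_inp (h : BitBound β I S) {x y : ℕ} (hy : y < 2 ^ β) :
    BitBound β (Function.update I x y) S := by
  refine ⟨h.one_le, fun z => ?_, h.arr⟩
  rw [Function.update_apply]
  split_ifs
  exacts [hy, h.inp z]

/-- A bound for the cost of one pass through the output loop. -/
def writeWeight : ℕ := (var rg_j - 1).compile.weight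
  + storeWeight (addrExp rg_j (0 : AExp).compile) (var rg_j - 1).compile
  + storeWeight (var rg_j).compile (arr rg_out (var rg_j)).compile + 2

theorem runs_writeLoop (k : ℕ) : ∀ {I : ℕ → ℕ} {S : Store} {M : Memory}, Rep I S M →
    BitBound β I S → S rg_j 0 = k → k ≤ I 0 →
    ∃ I' S' M' t, Runs (.loop (var rg_j - 1).compile writeProg) M M' t ∧ Rep I' S' M' ∧
      BitBound β I' S' ∧ I' 0 = I 0 ∧ (∀ j, 0 < j → j < k → I' j = S rg_out j) ∧
      (∀ j, k ≤ j → I' j = I j) ∧ S' rg_out = S rg_out ∧ t ≤ (k + 1) * (β * writeWeight) := by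
  induction k with
  | zero =>
    intro I S M hR hB hj _
    have hβ := hB.one_le
    have hcost := Exp.cost_le hβ (hR.lt hB.inp hB.arr) (var rg_j - 1).compile
    have heval : (var rg_j - 1).compile.eval M = 0 := by
      rw [hR.eval_compile (by decide)]
      simp [hj]
    have hw : (var rg_j - 1).compile.weight + 1 ≤ writeWeight := by
      rw [writeWeight]
      omega
    refine ⟨I, S, M, _, Runs.loopStop heval, hR, hB, rfl, by omega, fun _ _ => rfl, rfl, ?_⟩
    simp only [zero_add, one_mul]
    nlinarith
  | succ k ih =>
    intro I S M hR hB hj hk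
    have hβ := hB.one_le
    have hcost := Exp.cost_le hβ (hR.lt hB.inp hB.arr) (var rg_j - 1).compile
    have heval : (var rg_j - 1).compile.eval M = k := by
      rw [hR.eval_compile (by decide)]
      simp [hj]
    have hw : (var rg_j - 1).compile.weight + 1 ≤ writeWeight := by
      rw [writeWeight]
      omega
    rcases Nat.eq_zero_or_pos k with h0 | h0
    · subst h0
      refine ⟨I, S, M, _, Runs.loopStop heval, hR, hB, rfl, by omega, fun _ _ => rfl, rfl, ?_⟩
      nlinarith
    · obtain ⟨M₁, t₁, r₁, R₁, c₁⟩ := hR.runs_assign hB (a := rg_j) (by decide)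
        (e := var rg_j - 1) (by decide)
      have hv : (var rg_j - 1).eval I S = k := by simp [hj]
      rw [hv] at R₁
      have hklt : k < 2 ^ β := by
        have := hB.arr rg_j 0
        omega
      have B₁ := hB.upd (a := rg_j) (i := 0) hklt
      have c₂ := store_cost_le hβ (R₁.lt B₁.inp B₁.arr) (var rg_j).compile
        (arr rg_out (var rg_j)).compile
      have r₂ := Runs.store (var rg_j).compile (arr rg_out (var rg_j)).compile M₁
      have a₁ : (var rg_j).compile.eval M₁ = k := by
        rw [R₁.eval_compile (by decide), eval_var, upd_same]
      have a₂ : (arr rg_out (var rg_j)).compile.eval M₁ = S rg_out k := by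
        rw [R₁.eval_compile (by decide), eval_arr, eval_var, upd_same, upd_of_ne (by decide)]
      generalize (var rg_j).compile.cost M₁ + (arr rg_out (var rg_j)).compile.cost M₁
        + ((var rg_j).compile.eval M₁).size + ((arr rg_out (var rg_j)).compile.eval M₁).size + 1
        = t₂ at c₂ r₂
      rw [a₁, a₂] at r₂
      have R₂ := R₁.update_inp (y := S rg_out k) h0 (by omega)
      have B₂ := B₁.update_inp (x := k) (hB.arr rg_out k)
      obtain ⟨I', S', M', t, r, R, B, l1, l2, l3, l4, c⟩ := ih R₂ B₂ (by rw [upd_same])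
        (by rw [Function.update_of_ne h0.ne]; omega)
      refine ⟨I', S', M', _, Runs.loopStep (by rw [heval]; omega) (Runs.seq r₁ r₂) r, R, B, ?_,
        ?_, ?_, ?_, ?_⟩
      · rw [l1, Function.update_of_ne h0.ne]
      · intro j hj0 hjk
        rcases Nat.lt_succ_iff_lt_or_eq.mp hjk with h | rfl
        · rw [l2 j hj0 h, upd_of_ne (by decide)]
        · rw [l3 j le_rfl, Function.update_self]
      · intro j hj
        rw [l3 j (by omega), Function.update_of_ne (by omega)]
      · rw [l4, upd_of_ne (by decide)]
      · have e : (k + 1 + 1) * (β * writeWeight)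
            = (k + 1) * (β * writeWeight) + β * writeWeight := by ring
        have e' : β * writeWeight = β * (var rg_j - 1).compile.weight
          + β * storeWeight (addrExp rg_j (0 : AExp).compile) (var rg_j - 1).compile
          + β * storeWeight (var rg_j).compile (arr rg_out (var rg_j)).compile + β * 2 := by
          rw [writeWeight]
          ring
        omega

/-- A bound for the cost of the output beside the loop. -/
def outputWeight : ℕ := storeWeight (addrExp rg_j (0 : AExp).compile) (var rg_m).compile
  + storeWeight (.const 0) (arr rg_out 0).compile + 2

theorem runs_outputProg {m : ℕ} (hR : Rep I S M) (hB : BitBound β I S) (hm : S rg_m 0 = m)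
    (hmI : m ≤ I 0) :
    ∃ M' t, Runs outputProg M M' t ∧ (∀ j < m, M' j = S rg_out j) ∧
      t ≤ (m + 1) * (β * writeWeight) + β * outputWeight := by
  obtain ⟨M₁, t₁, r₁, R₁, c₁⟩ := hR.runs_assign hB (a := rg_j) (by decide) (e := var rg_m)
    (by decide)
  rw [eval_var, hm] at R₁
  have B₁ := hB.upd (a := rg_j) (i := 0) (hm ▸ hB.arr rg_m 0)
  obtain ⟨I₂, S₂, M₂, t₂, r₂, R₂, B₂, l1, l2, -, l4, c₂⟩ := runs_writeLoop m R₁ B₁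
    (upd_same _ _ _ _) hmI
  have r₃ := Runs.store (.const 0) (arr rg_out 0).compile M₂
  have c₃ := store_cost_le B₂.one_le (R₂.lt B₂.inp B₂.arr) (.const 0) (arr rg_out 0).compile
  generalize (Exp.const 0).cost M₂ + (arr rg_out 0).compile.cost M₂
    + ((Exp.const 0).eval M₂).size + ((arr rg_out 0).compile.eval M₂).size + 1 = t₃ at c₃ r₃
  have a₃ : (arr rg_out 0).compile.eval M₂ = S rg_out 0 := by
    rw [R₂.eval_compile (by decide), eval_arr, eval_zero, l4, upd_of_ne (by decide)]
  refine ⟨_, _, Runs.seq r₁ (Runs.seq r₂ r₃), fun j hj => ?_, ?_⟩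
  · rw [a₃, Function.update_apply]
    split_ifs with h0
    · rw [h0]
      rfl
    · have h0' : j ≠ 0 := h0
      rw [R₂.inp j (by omega), l2 j (by omega) hj, upd_of_ne (by decide)]
  · have := hB.one_le
    have e' : β * outputWeight
        = β * storeWeight (addrExp rg_j (0 : AExp).compile) (var rg_m).compile
        + β * storeWeight (.const 0) (arr rg_out 0).compile + β * 2 := by
      rw [outputWeight]
      ring
    omega

end Program

end RAM

end NashWelfare
namespace NashWelfare

namespace RAM

open AExp Cmd

section Program

theorem length_le_inputSize (l : List ℕ) : l.length ≤ inputSize l := by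
  induction l with
  | nil => simp [inputSize]
  | cons x l ih =>
    simp only [inputSize, List.map_cons, List.sum_cons, List.length_cons] at *
    omega

theorem size_getD_le (l : List ℕ) (x : ℕ) : (l.getD x 0).size ≤ inputSize l := by
  rcases lt_or_ge x l.length with h | h
  · rw [List.getD_eq_getElem _ _ h, inputSize]
    have h1 : l[x].size + 1 ∈ l.map fun x => x.size + 1 :=
      List.mem_map.mpr ⟨l[x], List.getElem_mem h, rfl⟩
    have := List.single_le_sum (fun _ _ => Nat.zero_le _) _ h1
    omega
  · rw [List.getD_eq_default _ _ h]
    simp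

/-- The read-only input: the first cell holds the length. -/
def inputFun (l : List ℕ) (x : ℕ) : ℕ := if x = 0 then l.length else l.getD x 0

variable {l : List ℕ} {n m : ℕ}

theorem lenExp_eval {M : Memory} (hn : M 0 = n) (hm : M 1 = m) :
    lenExp.eval M = 2 + 2 * (2 * (n * m) + n) := by
  simp [lenExp, Exp.eval, Op.eval, hn, hm]

/-- The initial contents of the arrays. -/
def initialStore (n : ℕ) : Store := upd (fun _ _ => 0) rg_n 0 n

theorem runs_initProg (hn : l.getD 0 0 = n) (hm : l.getD 1 0 = m)
    (hl : l.length = 2 + 2 * (2 * (n * m) + n)) :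
    ∃ M t, Runs initProg (initial l) M t ∧ Rep (inputFun l) (initialStore n) M ∧
      t ≤ inputSize l * (storeWeight lenExp (.load (.const 0)) + storeWeight (.const 0) lenExp
        + 1) := by
  have hL : 1 ≤ inputSize l := by
    have := length_le_inputSize l
    omega
  have hlen : l.length < 2 ^ inputSize l :=
    (length_le_inputSize l).trans_lt Nat.lt_two_pow_self
  have hb : ∀ x, initial l x < 2 ^ inputSize l := fun x => Nat.size_le.mp (size_getD_le l x)
  have e₁ : lenExp.eval (initial l) = l.length := by
    rw [lenExp_eval (M := initial l) (show initial l 0 = n from hn) (show initial l 1 = m from hm), hl]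
  have r₁ := Runs.store lenExp (.load (.const 0)) (initial l)
  have c₁ := store_cost_le hL hb lenExp (.load (.const 0))
  generalize lenExp.cost (initial l) + (Exp.load (.const 0)).cost (initial l)
    + (lenExp.eval (initial l)).size + ((Exp.load (.const 0)).eval (initial l)).size + 1 = t₁
    at c₁ r₁
  have e₁' : (Exp.load (.const 0)).eval (initial l) = n := hn
  rw [e₁, e₁'] at r₁
  set M₁ := Function.update (initial l) l.length n with hM₁
  have hb₁ : ∀ x, M₁ x < 2 ^ inputSize l := by
    intro x
    rw [hM₁, Function.update_apply]
    split_ifs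
    exacts [hn ▸ hb 0, hb x]
  have e₂ : lenExp.eval M₁ = l.length := by
    rw [lenExp_eval (n := n) (m := m), hl]
    · rw [hM₁, Function.update_of_ne (by omega)]
      exact hn
    · rw [hM₁, Function.update_of_ne (by omega)]
      exact hm
  have r₂ := Runs.store (.const 0) lenExp M₁
  have c₂ := store_cost_le hL hb₁ (.const 0) lenExp
  generalize (Exp.const 0).cost M₁ + lenExp.cost M₁ + ((Exp.const 0).eval M₁).size
    + (lenExp.eval M₁).size + 1 = t₂ at c₂ r₂
  rw [e₂] at r₂
  refine ⟨_, _, Runs.seq r₁ r₂, ⟨?_, ?_, ?_⟩, ?_⟩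
  · simp only [inputFun, if_true]
    omega
  · intro x hx
    simp only [inputFun, if_true] at hx ⊢
    rw [Function.update_apply]
    refine if_congr Iff.rfl rfl ?_
    rw [hM₁, Function.update_of_ne (by omega)]
    rfl
  · intro a _ i
    simp only [inputFun, if_true]
    rw [Function.update_of_ne (by simp only [Exp.eval]; omega), hM₁, initialStore, upd_apply,
      Function.update_apply]
    refine if_congr ?_ rfl ?_
    · simp only [numArrays]
      omega
    · exact List.getD_eq_default _ _ (by omega)
  · have e' : inputSize l * (storeWeight lenExp (.load (.const 0))
        + storeWeight (.const 0) lenExp + 1) = inputSize l * storeWeight lenExp (.load (.const 0))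
        + inputSize l * storeWeight (.const 0) lenExp + inputSize l := by ring
    omega

theorem setupCmd_spec {I : ℕ → ℕ} (hI : I 1 = m) (hI0 : 1 < I 0) (a i : ℕ) :
    setupCmd.eval I (initialStore n) a i = if i = 0 then
      if a = rg_n then n else if a = rg_m then m else if a = rg_nm then n * m else
      if a = rg_K then 2 * (n * m) + n else if a = rg_m1 then m + 1 else 0 else 0 := by
  simp only [setupCmd, eval_seq, eval_assign, eval_inp, eval_var, eval_mul, eval_add, eval_one,
    eval_two, initialStore, Nat.mod_eq_of_lt hI0, hI]
  by_cases hi : i = 0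
  · subst hi
    simp only [upd_apply]
    split_ifs <;> first | rfl | omega | simp_all
  · simp [upd_apply, hi]

/-- The state between the two phases. -/
structure Prepared (I : ℕ → ℕ) (n m : ℕ) (S : Store) : Prop where
  agents : S rg_n 0 = n
  items : S rg_m 0 = m
  pairs : S rg_nm 0 = n * m
  succ : S rg_m1 0 = m + 1
  length : S rg_len 0 = (∑ t ∈ Finset.range (n * m),
    inputValue I (inputDen I (2 * (n * m) + n)) t).size
  den : S rg_den 0 = inputDen I (2 * (n * m) + n)
  value : ∀ t < n * m, S rg_v t = inputValue I (inputDen I (2 * (n * m) + n)) t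
  low : S rg_C = fun _ => 0
  high : S rg_D = fun _ => 0

/-- The program runs in polynomial time. -/
theorem exists_runs_mainProg : ∃ p : Polynomial ℕ, ∀ (l : List ℕ) (n m : ℕ), 0 < n →
    l.getD 0 0 = n → l.getD 1 0 = m → l.length = 2 + 2 * (2 * (n * m) + n) →
    ∃ S M t, Runs mainProg (initial l) M t ∧ t ≤ p.eval (inputSize l) ∧
      Prepared (inputFun l) n m S ∧ ∀ j < m, M j = phaseB.eval (inputFun l) S rg_out j := by
  obtain ⟨pS, hpS⟩ := setupCmd.exists_polynomial_time
  obtain ⟨pA, hpA⟩ := phaseA.exists_polynomial_time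
  obtain ⟨pB, hpB⟩ := phaseB.exists_polynomial_time
  let qA : Polynomial ℕ := .X + pA
  let qB : Polynomial ℕ := qA + pB.comp qA
  refine ⟨.X * .C (storeWeight lenExp (.load (.const 0)) + storeWeight (.const 0) lenExp + 1)
    + pS * (.X + pS) + pA * qA + (qA + 1) * (qA * .C halveWeight) + pB.comp qA * qB
    + ((.X + 1) * (qB * .C writeWeight) + qB * .C outputWeight) + 5, ?_⟩
  intro l n m hn0 hn hm hl
  have hLl := length_le_inputSize l
  have hnm : m ≤ n * m := Nat.le_mul_of_pos_left m hn0
  set L := inputSize l with hL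
  set I := inputFun l with hI
  have hI0 : I 0 = l.length := rfl
  have hI1 : I 1 = m := hm
  have hIlt : ∀ x, I x < 2 ^ L := by
    intro x
    rw [hI, inputFun]
    split_ifs
    · exact hLl.trans_lt Nat.lt_two_pow_self
    · exact Nat.size_le.mp (size_getD_le l x)
  have hpow : ∀ {x : ℕ}, x ≤ L → x < 2 ^ L := fun hx => hx.trans_lt Nat.lt_two_pow_self
  obtain ⟨M₁, t₁, r₁, R₁, c₁⟩ := runs_initProg hn hm hl
  have hS₀ : ∀ a i, initialStore n a i ≤ L := by
    intro a i
    rw [initialStore, upd_apply]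
    split_ifs <;> omega
  have B₁ : Bounded setupClass L L I (initialStore n) := by
    refine ⟨by omega, le_rfl, hIlt, fun a i => hpow (hS₀ a i), fun a i _ => hpow (hS₀ a i),
      fun a i _ => hS₀ a i⟩
  obtain ⟨M₂, t₂, r₂, R₂, -, c₂⟩ := Cmd.runs setupCmd_ok R₁ B₁
  have hS₁ := setupCmd_spec (n := n) hI1 (by omega)
  set S₁ := setupCmd.eval I (initialStore n) with hS₁def
  have hS₁le : ∀ a i, S₁ a i ≤ L := by
    intro a i
    rw [hS₁]
    split_ifs <;> omega
  have B₂ : Bounded arrayClass L L I S₁ := by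
    refine ⟨by omega, le_rfl, hIlt, fun a i => hpow (hS₁le a i), fun a i _ => hpow (hS₁le a i),
      fun a i _ => hS₁le a i⟩
  obtain ⟨M₃, t₃, r₃, R₃, B₃, c₃⟩ := Cmd.runs phaseA_ok R₂ B₂
  obtain ⟨h1, h2, h3⟩ := phaseA_spec (I := I) (S := S₁) (n := n) (m := m) (by rw [hS₁]; rfl)
    (by rw [hS₁]; rfl) (by omega)
  set S₂ := phaseA.eval I S₁ with hS₂def
  have f2 : ∀ a, a ∉ phaseA.writes → S₂ a = S₁ a := fun a ha => eval_frame I _ ha S₁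
  have hqA : L + phaseA.time L = qA.eval L := by simp [qA, hpA]
  rw [hqA] at B₃ c₃
  have hLA : L ≤ qA.eval L := by omega
  obtain ⟨S₃, M₄, t₄, r₄, R₄, B₄, l1, l2, l3, c₄⟩ := runs_lengthProg (S₂ rg_x 0) R₃
    ⟨by omega, B₃.inp', B₃.big⟩ rfl (by
      rw [f2 _ (by decide), hS₁]
      simpa using Nat.size_le.mpr (B₃.big rg_x 0))
  have hxsize : (S₂ rg_x 0).size ≤ qA.eval L := Nat.size_le.mpr (B₃.big rg_x 0)
  rw [f2 rg_len (by decide), hS₁, if_pos rfl] at l1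
  have hcount : ∀ a i, arrayClass a ≠ 0 → S₃ a i ≤ qA.eval L := by
    intro a i ha
    have ha2 : arrayClass a = 2 := by
      rw [arrayClass] at ha ⊢
      split_ifs at ha ⊢
      · rfl
      · exact absurd rfl ha
    by_cases hlen : a = rg_len
    · subst hlen
      by_cases hi : i = 0
      · subst hi
        rw [l1]
        simpa using hxsize
      · rw [l2 i hi]
        exact (B₃.counter _ i ha2).trans hLA
    · rw [l3 a (by rintro rfl; exact absurd ha2 (by decide)) hlen]
      exact (B₃.counter _ i ha2).trans hLA
  have B₄' : Bounded arrayClass (qA.eval L) (qA.eval L) I S₃ :=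
    ⟨by omega, le_rfl, B₄.inp, B₄.arr, fun a i _ => B₄.arr a i,
      fun a i ha => hcount a i (by omega)⟩
  obtain ⟨M₅, t₅, r₅, R₅, B₅, c₅⟩ := Cmd.runs phaseB_ok R₄ B₄'
  have hqB : qA.eval L + phaseB.time (qA.eval L) = qB.eval L := by simp [qB, hpB]
  rw [hqB] at B₅ c₅
  have f3 : ∀ a, a ≠ rg_x → a ≠ rg_len → a ∉ phaseA.writes → S₃ a = S₁ a :=
    fun a ha ha' ha'' => by rw [l3 a ha ha', f2 a ha'']
  have hm₅ : phaseB.eval I S₃ rg_m 0 = m := by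
    rw [eval_frame I _ (by decide), f3 _ (by decide) (by decide) (by decide), hS₁]
    rfl
  have hmI : m ≤ I 0 := by omega
  obtain ⟨M₆, t₆, r₆, hM₆, c₆⟩ := runs_outputProg R₅ ⟨B₅.one_le.trans B₅.le, B₅.inp', B₅.big⟩ hm₅
    hmI
  refine ⟨S₃, M₆, _, Runs.seq r₁ (Runs.seq r₂ (Runs.seq r₃ (Runs.seq r₄ (Runs.seq r₅ r₆)))), ?_,
    ⟨?_, ?_, ?_, ?_, ?_, ?_, ?_, ?_, ?_⟩, hM₆⟩
  · have g₄ : t₄ ≤ (qA.eval L + 1) * (qA.eval L * halveWeight) :=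
      c₄.trans (Nat.mul_le_mul_right _ (by omega))
    have g₆ : t₆ ≤ (L + 1) * (qB.eval L * writeWeight) + qB.eval L * outputWeight :=
      c₆.trans (Nat.add_le_add_right (Nat.mul_le_mul_right _ (by omega)) _)
    rw [← hL] at c₁
    rw [hpS] at c₂
    rw [hpA] at c₃
    rw [hpB] at c₅
    simp only [Polynomial.eval_add, Polynomial.eval_mul, Polynomial.eval_C, Polynomial.eval_X,
      Polynomial.eval_comp, Polynomial.eval_one, Polynomial.eval_ofNat]
    omega
  · rw [f3 _ (by decide) (by decide) (by decide), hS₁]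
    rfl
  · rw [f3 _ (by decide) (by decide) (by decide), hS₁]
    rfl
  · rw [f3 _ (by decide) (by decide) (by decide), hS₁]
    rfl
  · rw [f3 _ (by decide) (by decide) (by decide), hS₁]
    rfl
  · rw [l1, h3]
    simp
  · rw [l3 _ (by decide) (by decide), h1]
  · rw [l3 _ (by decide) (by decide)]
    exact h2
  · rw [f3 _ (by decide) (by decide) (by decide)]
    funext i
    rw [hS₁]
    simp
  · rw [f3 _ (by decide) (by decide) (by decide)]
    funext i
    rw [hS₁]
    simp

end Program

end RAM

end NashWelfare
namespace NashWelfare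

/-! ### Decoding an optimal matching -/

section Decoding

theorem sum_digits_lt {r : ℕ} (d : ℕ → ℕ) {m : ℕ} (hd : ∀ j < m, d j < r) :
    ∑ j ∈ Finset.range m, d j * r ^ j < r ^ m := by
  induction m with
  | zero => simp
  | succ m ih =>
    rw [Finset.sum_range_succ, pow_succ]
    have h1 := ih fun j hj => hd j (by omega)
    have h2 : (d m + 1) * r ^ m ≤ r * r ^ m := Nat.mul_le_mul_right _ (hd m (by omega))
    nlinarith

theorem sum_digits_div_mod {r : ℕ} (d : ℕ → ℕ) {m : ℕ} (hd : ∀ j < m, d j < r) (q : ℕ) {k : ℕ}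
    (hk : k < m) : (∑ j ∈ Finset.range m, d j * r ^ j + r ^ m * q) / r ^ k % r = d k := by
  induction m generalizing d k with
  | zero => omega
  | succ m ih =>
    have e : ∑ j ∈ Finset.range (m + 1), d j * r ^ j + r ^ (m + 1) * q
        = d 0 + r * (∑ j ∈ Finset.range m, d (j + 1) * r ^ j + r ^ m * q) := by
      rw [Finset.sum_range_succ', mul_add, Finset.mul_sum]
      simp only [pow_succ]
      have : ∀ j, d (j + 1) * (r ^ j * r) = r * (d (j + 1) * r ^ j) := fun j => by ring
      simp only [this]
      ring
    have h0 := hd 0 (by omega)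
    rw [e]
    cases k with
    | zero =>
      rw [pow_zero, Nat.div_one, Nat.add_mul_mod_self_left, Nat.mod_eq_of_lt h0]
    | succ k =>
      rw [pow_succ', ← Nat.div_div_eq_div_mul, Nat.add_mul_div_left _ _ (by omega),
        Nat.div_eq_of_lt h0, zero_add]
      exact ih (fun j => d (j + 1)) (fun j hj => hd (j + 1) (by omega)) (by omega)

end Decoding

namespace RAM

/-- The matching problems whose optimal solutions can be decoded. -/
structure Params.IsCoded (P : Params) (B : ℕ) (W : ℕ → ℕ) : Prop where
  base_eq : B = (P.n + 1) ^ (P.m + 1)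
  weight : ∀ i < P.n, P.weight i = B * W i
  huge : P.huge = B + P.len * ∑ i ∈ Finset.range P.n, P.weight i
  code : ∀ i < P.n, ∀ j < P.m, P.code (i * P.m + j) = (i + 1) * (P.n + 1) ^ j

/-- The value of agent `i` under the matching `M`. -/
def Params.total (P : Params) (M : ℕ → Option ℕ) (i : ℕ) : ℕ :=
  P.base i + (M i).elim 0 fun j => P.value (i * P.m + j)

/-- The digit of item `j` in the code of the matching `M`. -/
def Params.digit (P : Params) (M : ℕ → Option ℕ) (j : ℕ) : ℕ :=
  ∑ i ∈ Finset.range P.n, if M i = some j then i + 1 else 0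

section Coded

variable {P : Params} {B : ℕ} {W : ℕ → ℕ} {M : ℕ → Option ℕ}

theorem Params.digit_eq (hM : IsMatching P.m P.Adj M) {i j : ℕ} (hi : i < P.n)
    (hij : M i = some j) : P.digit M j = i + 1 := by
  rw [Params.digit, Finset.sum_eq_single i]
  · rw [if_pos hij]
  · intro k _ hki
    rw [if_neg fun hk => hki (hM.2 k i j hk hij)]
  · intro h
    exact absurd (Finset.mem_range.mpr hi) h

theorem Params.digit_lt (hM : IsMatching P.m P.Adj M) (j : ℕ) : P.digit M j < P.n + 1 := by
  by_cases h : ∃ i < P.n, M i = some j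
  · obtain ⟨i, hi, hij⟩ := h
    rw [Params.digit_eq hM hi hij]
    omega
  · push Not at h
    rw [Params.digit, Finset.sum_eq_zero fun i hi => if_neg (h i (Finset.mem_range.mp hi))]
    omega

theorem Params.earning_eq (hP : P.IsCoded B W) (hM : IsMatching P.m P.Adj M) {i : ℕ}
    (hi : i < P.n) : earning P.single P.paired i (M i)
      = P.weight i * min P.len (P.total M i).size
        + (if P.total M i ≠ 0 ∧ P.weight i ≠ 0 then P.huge else 0)
        + ∑ j ∈ Finset.range P.m, (if M i = some j then i + 1 else 0) * (P.n + 1) ^ j := by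
  rcases h : M i with _ | j
  · simp [earning, Params.single, Params.gain, Params.total, h]
  · have hj := (hM.1 i j h).1
    rw [Finset.sum_eq_single j]
    · simp only [earning, Option.elim_some, Params.paired, Params.gain, Params.total, h, if_true,
        hP.code i hi j hj]
    · intro k _ hkj
      rw [if_neg fun h' => hkj (Option.some.inj h').symm, zero_mul]
    · intro h'
      exact absurd (Finset.mem_range.mpr hj) h'

theorem Params.sum_earning (hP : P.IsCoded B W) (hM : IsMatching P.m P.Adj M) :
    ∑ i ∈ Finset.range P.n, earning P.single P.paired i (M i)
      = B * ∑ i ∈ Finset.range P.n, W i * min P.len (P.total M i).size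
        + ((Finset.range P.n).filter fun i => P.total M i ≠ 0 ∧ P.weight i ≠ 0).card * P.huge
        + ∑ j ∈ Finset.range P.m, P.digit M j * (P.n + 1) ^ j := by
  rw [Finset.sum_congr rfl fun i hi => Params.earning_eq hP hM (Finset.mem_range.mp hi),
    Finset.sum_add_distrib, Finset.sum_add_distrib, Finset.sum_comm, Finset.mul_sum,
    ← Finset.sum_filter, Finset.sum_const, smul_eq_mul]
  congr 1
  · congr 1
    refine Finset.sum_congr rfl fun i hi => ?_
    rw [hP.weight i (Finset.mem_range.mp hi), mul_assoc]
  · refine Finset.sum_congr rfl fun j _ => ?_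
    rw [← Finset.sum_mul]
    rfl

theorem Params.decode (hP : P.IsCoded B W) (hM : IsMatching P.m P.Adj M) {j : ℕ} (hj : j < P.m) :
    (∑ i ∈ Finset.range P.n, earning P.single P.paired i (M i)) / (P.n + 1) ^ j % (P.n + 1)
      = P.digit M j := by
  have hB : B = (P.n + 1) ^ P.m * (P.n + 1) := by rw [hP.base_eq, pow_succ]
  have hh : P.huge = B * (1 + P.len * ∑ i ∈ Finset.range P.n, W i) := by
    rw [hP.huge, Finset.sum_congr rfl fun i hi => hP.weight i (Finset.mem_range.mp hi),
      ← Finset.mul_sum]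
    ring
  rw [Params.sum_earning hP hM, hh, hB]
  generalize ∑ i ∈ Finset.range P.n, W i * min P.len (P.total M i).size = a
  generalize ((Finset.range P.n).filter fun i => P.total M i ≠ 0 ∧ P.weight i ≠ 0).card = k
  generalize 1 + P.len * ∑ i ∈ Finset.range P.n, W i = c
  rw [show (P.n + 1) ^ P.m * (P.n + 1) * a + k * ((P.n + 1) ^ P.m * (P.n + 1) * c)
      + ∑ j ∈ Finset.range P.m, P.digit M j * (P.n + 1) ^ j
      = ∑ j ∈ Finset.range P.m, P.digit M j * (P.n + 1) ^ j
        + (P.n + 1) ^ P.m * ((P.n + 1) * a + k * ((P.n + 1) * c)) by ring]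
  exact sum_digits_div_mod _ (fun j _ => Params.digit_lt hM j) _ hj

/-- A matching with the largest earnings gives positive values to all agents if that is possible,
and then it maximizes the weighted sum of the bit lengths of the values. -/
theorem Params.optimal (hP : P.IsCoded B W) {M' : ℕ → Option ℕ} (hM : IsMatching P.m P.Adj M)
    (hM' : IsMatching P.m P.Adj M')
    (hle : ∑ i ∈ Finset.range P.n, earning P.single P.paired i (M' i)
      ≤ ∑ i ∈ Finset.range P.n, earning P.single P.paired i (M i))
    (hpos : ∀ i < P.n, P.weight i ≠ 0 → P.total M' i ≠ 0) :
    (∀ i < P.n, P.weight i ≠ 0 → P.total M i ≠ 0) ∧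
      ∑ i ∈ Finset.range P.n, W i * min P.len (P.total M' i).size
        ≤ ∑ i ∈ Finset.range P.n, W i * min P.len (P.total M i).size := by
  have hB : 0 < B := by rw [hP.base_eq]; positivity
  have hc : ∑ j ∈ Finset.range P.m, P.digit M j * (P.n + 1) ^ j < B := by
    refine (sum_digits_lt _ fun j _ => Params.digit_lt hM j).trans_le ?_
    rw [hP.base_eq]
    exact Nat.pow_le_pow_right (by omega) (by omega)
  rw [Params.sum_earning hP hM, Params.sum_earning hP hM'] at hle
  have hall : ((Finset.range P.n).filter fun i => P.total M' i ≠ 0 ∧ P.weight i ≠ 0)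
      = (Finset.range P.n).filter fun i => P.weight i ≠ 0 := by
    refine Finset.filter_congr fun i hi => ?_
    exact ⟨fun h => h.2, fun h => ⟨hpos i (Finset.mem_range.mp hi) h, h⟩⟩
  have hsub : ((Finset.range P.n).filter fun i => P.total M i ≠ 0 ∧ P.weight i ≠ 0)
      ⊆ (Finset.range P.n).filter fun i => P.weight i ≠ 0 :=
    Finset.monotone_filter_right _ fun i _ h => h.2
  rw [hall] at hle
  have hk := Finset.card_le_card hsub
  have ha : B * ∑ i ∈ Finset.range P.n, W i * min P.len (P.total M i).size
      ≤ P.len * ∑ i ∈ Finset.range P.n, P.weight i := by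
    rw [Finset.mul_sum, Finset.mul_sum]
    refine Finset.sum_le_sum fun i hi => ?_
    rw [hP.weight i (Finset.mem_range.mp hi), ← mul_assoc, mul_comm P.len]
    exact Nat.mul_le_mul_left _ (min_le_left _ _)
  have hhuge := hP.huge
  generalize hk0 : ((Finset.range P.n).filter fun i => P.weight i ≠ 0).card = k₀ at *
  generalize hk1 : ((Finset.range P.n).filter fun i => P.total M i ≠ 0 ∧ P.weight i ≠ 0).card
    = k₁ at *
  generalize ∑ i ∈ Finset.range P.n, W i * min P.len (P.total M i).size = a at *
  generalize ∑ i ∈ Finset.range P.n, W i * min P.len (P.total M' i).size = a' at *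
  have hkeq : k₁ = k₀ := by
    refine le_antisymm hk (le_of_not_gt fun hlt => ?_)
    have := Nat.mul_le_mul_right P.huge (show k₁ + 1 ≤ k₀ from hlt)
    rw [add_mul, one_mul] at this
    omega
  subst hkeq
  constructor
  · have heq := Finset.eq_of_subset_of_card_le hsub (by omega)
    intro i hi hw
    have : i ∈ (Finset.range P.n).filter fun i => P.weight i ≠ 0 :=
      Finset.mem_filter.mpr ⟨Finset.mem_range.mpr hi, hw⟩
    rw [← heq] at this
    exact (Finset.mem_filter.mp this).2.1
  · have h1 : B * a' < B * (a + 1) := by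
      rw [mul_add, mul_one]
      omega
    exact Nat.lt_succ_iff.mp (Nat.lt_of_mul_lt_mul_left h1)

end Coded

end RAM

/-! ### Bit lengths and logarithms -/

theorem log_le_size {x : ℕ} (hx : x ≠ 0) : Real.log x ≤ x.size * Real.log 2 := by
  have h1 : (x : ℝ) ≤ (2 : ℝ) ^ x.size := by exact_mod_cast (Nat.lt_size_self x).le
  have h2 : (0 : ℝ) < x := by exact_mod_cast Nat.pos_of_ne_zero hx
  have := Real.log_le_log h2 h1
  rwa [Real.log_pow] at this

theorem size_le_log {x : ℕ} (hx : x ≠ 0) : x.size * Real.log 2 - Real.log 2 ≤ Real.log x := by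
  have h0 : 0 < x.size := Nat.size_pos.mpr (Nat.pos_of_ne_zero hx)
  have h1 : 2 ^ (x.size - 1) ≤ x := Nat.lt_size.mp (by omega)
  have h2 : (2 : ℝ) ^ (x.size - 1) ≤ x := by exact_mod_cast h1
  have h3 := Real.log_le_log (by positivity) h2
  rw [Real.log_pow, Nat.cast_sub h0] at h3
  push_cast at h3
  linarith

/-- Comparing weighted sums of bit lengths loses at most `log 2` in the weighted logarithms. -/
theorem sum_log_ge_of_size {ι : Type*} [Fintype ι] {w z z' : ι → ℝ} {x x' : ι → ℕ} {d : ℝ}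
    (hd : 0 < d) (hw : ∀ i, 0 ≤ w i) (hw1 : ∑ i, w i = 1) (hx : ∀ i, (x i : ℝ) = d * z i)
    (hx' : ∀ i, (x' i : ℝ) = d * z' i) (hpos : ∀ i, 0 < w i → x i ≠ 0)
    (hpos' : ∀ i, 0 < w i → x' i ≠ 0)
    (h : ∑ i, w i * ((x' i).size : ℝ) ≤ ∑ i, w i * ((x i).size : ℝ)) :
    ∑ i, w i * Real.log (z' i) - Real.log 2 ≤ ∑ i, w i * Real.log (z i) := by
  have key : ∀ {x : ι → ℕ} {z : ι → ℝ}, (∀ i, (x i : ℝ) = d * z i) → (∀ i, 0 < w i → x i ≠ 0) →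
      ∑ i, w i * Real.log (x i) = Real.log d + ∑ i, w i * Real.log (z i) := by
    intro x z hx hpos
    rw [← one_mul (Real.log d), ← hw1, Finset.sum_mul, ← Finset.sum_add_distrib]
    refine Finset.sum_congr rfl fun i _ => ?_
    rcases (hw i).eq_or_lt with h0 | h0
    · simp [← h0]
    · have h1 : d * z i ≠ 0 := by
        rw [← hx i]
        exact_mod_cast hpos i h0
      rw [hx i, Real.log_mul hd.ne' (right_ne_zero_of_mul h1), mul_add]
  have h1 : ∑ i, w i * Real.log (x' i) ≤ (∑ i, w i * ((x' i).size : ℝ)) * Real.log 2 := by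
    rw [Finset.sum_mul]
    refine Finset.sum_le_sum fun i _ => ?_
    rcases (hw i).eq_or_lt with h0 | h0
    · simp [← h0]
    · rw [mul_assoc]
      exact mul_le_mul_of_nonneg_left (log_le_size (hpos' i h0)) h0.le
  have h2 : (∑ i, w i * ((x i).size : ℝ)) * Real.log 2 - Real.log 2
      ≤ ∑ i, w i * Real.log (x i) := by
    have e : (∑ i, w i * ((x i).size : ℝ)) * Real.log 2 - Real.log 2
        = ∑ i, w i * ((x i).size * Real.log 2 - Real.log 2) := by
      simp only [mul_sub, Finset.sum_sub_distrib, ← Finset.sum_mul, hw1, one_mul, ← mul_assoc]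
    rw [e]
    refine Finset.sum_le_sum fun i _ => ?_
    rcases (hw i).eq_or_lt with h0 | h0
    · simp [← h0]
    · exact mul_le_mul_of_nonneg_left (size_le_log (hpos i h0)) h0.le
  have h3 := mul_le_mul_of_nonneg_right h (Real.log_nonneg one_le_two)
  rw [key hx' hpos'] at h1
  rw [key hx hpos] at h2
  linarith

end NashWelfare
namespace NashWelfare

/-! ### The cells of the input -/

section Cells

theorem getElem?_flatMap {α β : Type*} (l : List α) (f : α → List β) {k : ℕ}
    (hf : ∀ x, (f x).length = k) {i j : ℕ} (hi : i < l.length) (hj : j < k) :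
    (l.flatMap f)[i * k + j]? = (f l[i])[j]? := by
  induction l generalizing i with
  | nil => simp at hi
  | cons x l ih =>
    rw [List.flatMap_cons]
    cases i with
    | zero => simp [List.getElem?_append_left (show j < (f x).length by rw [hf]; exact hj)]
    | succ i =>
      rw [List.getElem?_append_right (by rw [hf]; nlinarith), hf,
        show (i + 1) * k + j - k = i * k + j by rw [add_mul, one_mul]; omega,
        ih (by simpa using hi)]
      simp

theorem length_flatMap_const {α β : Type*} (l : List α) (f : α → List β) {k : ℕ}
    (hf : ∀ x, (f x).length = k) : (l.flatMap f).length = l.length * k := by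
  simp [List.length_flatMap, hf]

theorem length_encodeMatrix {n m : ℕ} (c : Fin n → Fin m → ℚ≥0) :
    (encodeMatrix c).length = n * (m * 2) := by
  rw [encodeMatrix, length_flatMap_const (k := m * 2), List.length_finRange]
  intro i
  rw [length_flatMap_const (k := 2), List.length_finRange]
  exact fun _ => rfl

theorem getElem?_encodeMatrix {n m : ℕ} (c : Fin n → Fin m → ℚ≥0) (i : Fin n) (j : Fin m) {e : ℕ}
    (he : e < 2) : (encodeMatrix c)[2 * (i * m + j) + e]? = (encodeRat (c i j))[e]? := by
  rw [show 2 * ((i : ℕ) * m + j) + e = i * (m * 2) + (j * 2 + e) by ring, encodeMatrix,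
    getElem?_flatMap (k := m * 2)]
  · have e : (List.finRange n)[(i : ℕ)]'(by simp) = i := by simp
    have e' : (List.finRange m)[(j : ℕ)]'(by simp) = j := by simp
    rw [e, getElem?_flatMap (k := 2) _ _ (fun _ => rfl) (by simp) he, e']
  · intro i
    rw [length_flatMap_const (k := 2), List.length_finRange]
    exact fun _ => rfl
  · simp
  · have := j.2
    omega

variable {n m : ℕ} (v : Fin n → Fin m → ℚ≥0) (w : Fin n → ℚ≥0) (b : Fin n → Fin m → ℚ≥0)

theorem length_encodeWeights : ((List.finRange n).flatMap fun i => encodeRat (w i)).length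
    = n * 2 := by
  rw [length_flatMap_const (k := 2), List.length_finRange]
  exact fun _ => rfl

theorem length_encodeInput :
    (encodeInput v w b).length = 2 + 2 * (2 * (n * m) + n) := by
  simp only [encodeInput, List.length_append, length_encodeMatrix, length_encodeWeights,
    List.length_cons, List.length_nil]
  ring

theorem getElem?_encodeInput_value (i : Fin n) (j : Fin m) {e : ℕ} (he : e < 2) :
    (encodeInput v w b)[2 * (i * m + j) + 2 + e]? = (encodeRat (v i j))[e]? := by
  have hlt := RAM.mul_add_lt i.2 j.2
  have h0 : [n, m].length = 2 := rfl
  have hl := length_encodeMatrix v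
  have e1 : n * (m * 2) = 2 * (n * m) := by ring
  rw [encodeInput, List.append_assoc, List.append_assoc, List.getElem?_append_right (by omega),
    List.getElem?_append_left, ← getElem?_encodeMatrix v i j he]
  · congr 1
    omega
  · omega

theorem getElem?_encodeInput_weight (i : Fin n) {e : ℕ} (he : e < 2) :
    (encodeInput v w b)[2 * (n * m + i) + 2 + e]? = (encodeRat (w i))[e]? := by
  have h0 : [n, m].length = 2 := rfl
  have hl := length_encodeMatrix v
  have hl' := length_encodeWeights w
  have e1 : n * (m * 2) = 2 * (n * m) := by ring
  have hi := i.2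
  rw [encodeInput, List.append_assoc, List.append_assoc, List.getElem?_append_right (by omega),
    List.getElem?_append_right (by omega), List.getElem?_append_left (by omega)]
  have h := getElem?_flatMap (List.finRange n) (fun i => encodeRat (w i)) (k := 2)
    (fun _ => rfl) (i := i) (by simp) he
  simp only [List.getElem_finRange, Fin.cast_mk, Fin.eta] at h
  rw [← h]
  congr 1
  omega

theorem getElem?_encodeInput_edge (i : Fin n) (j : Fin m) {e : ℕ} (he : e < 2) :
    (encodeInput v w b)[2 * (n * m + n + (i * m + j)) + 2 + e]? = (encodeRat (b i j))[e]? := by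
  have h0 : [n, m].length = 2 := rfl
  have hl := length_encodeMatrix v
  have hl' := length_encodeWeights w
  have e1 : n * (m * 2) = 2 * (n * m) := by ring
  rw [encodeInput, List.append_assoc, List.append_assoc, List.getElem?_append_right (by omega),
    List.getElem?_append_right (by omega), List.getElem?_append_right (by omega),
    ← getElem?_encodeMatrix b i j he]
  congr 1
  omega

/-- The input of the program, with the length in the first cell. -/
abbrev cell : ℕ → ℕ := RAM.inputFun (encodeInput v w b)

theorem cell_eq {x y : ℕ} (hx : x ≠ 0) (h : (encodeInput v w b)[x]? = some y) :
    cell v w b x = y := by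
  rw [cell, RAM.inputFun, if_neg hx, List.getD_eq_getElem?_getD, h]
  rfl

theorem cell_value (i : Fin n) (j : Fin m) : cell v w b (2 * (i * m + j) + 2) = (v i j).num ∧
    cell v w b (2 * (i * m + j) + 3) = (v i j).den :=
  ⟨cell_eq v w b (by omega) (getElem?_encodeInput_value v w b i j (e := 0) (by omega)),
    cell_eq v w b (by omega) (getElem?_encodeInput_value v w b i j (e := 1) (by omega))⟩

theorem cell_weight (i : Fin n) : cell v w b (2 * (n * m + i) + 2) = (w i).num ∧
    cell v w b (2 * (n * m + i) + 3) = (w i).den :=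
  ⟨cell_eq v w b (by omega) (getElem?_encodeInput_weight v w b i (e := 0) (by omega)),
    cell_eq v w b (by omega) (getElem?_encodeInput_weight v w b i (e := 1) (by omega))⟩

theorem cell_edge (i : Fin n) (j : Fin m) :
    cell v w b (RAM.edgeCell n (n * m) (i * m + j)) = (b i j).num ∧
    cell v w b (2 * (n * m + n + (i * m + j)) + 3) = (b i j).den :=
  ⟨cell_eq v w b (by simp [RAM.edgeCell])
    (getElem?_encodeInput_edge v w b i j (e := 0) (by omega)),
    cell_eq v w b (by omega) (getElem?_encodeInput_edge v w b i j (e := 1) (by omega))⟩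

/-- The common denominator. -/
abbrev commonDen : ℕ := RAM.inputDen (cell v w b) (2 * (n * m) + n)

theorem exists_pair {t : ℕ} (ht : t < n * m) : ∃ (i : Fin n) (j : Fin m), t = i * m + j := by
  have hm : 0 < m := Nat.pos_of_ne_zero fun h => by simp [h] at ht
  refine ⟨⟨t / m, (Nat.div_lt_iff_lt_mul hm).mpr ht⟩, ⟨t % m, Nat.mod_lt _ hm⟩, ?_⟩
  rw [mul_comm]
  exact (Nat.div_add_mod t m).symm

theorem commonDen_pos : 0 < commonDen v w b := by
  refine Finset.prod_pos fun t ht => ?_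
  rw [Finset.mem_range] at ht
  rcases lt_or_ge t (n * m) with h1 | h1
  · obtain ⟨i, j, rfl⟩ := exists_pair h1
    rw [(cell_value v w b i j).2]
    exact (v i j).den_pos
  · rcases lt_or_ge t (n * m + n) with h2 | h2
    · have := (cell_weight v w b ⟨t - n * m, by omega⟩).2
      rw [show 2 * (n * m + (t - n * m)) + 3 = 2 * t + 3 by omega] at this
      rw [this]
      exact (w _).den_pos
    · obtain ⟨i, j, h⟩ := exists_pair (show t - (n * m + n) < n * m by omega)
      have := (cell_edge v w b i j).2
      rw [← h, show 2 * (n * m + n + (t - (n * m + n))) + 3 = 2 * t + 3 by omega] at this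
      rw [this]
      exact (b i j).den_pos

theorem den_value_dvd (i : Fin n) (j : Fin m) : (v i j).den ∣ commonDen v w b := by
  rw [← (cell_value v w b i j).2]
  have := RAM.mul_add_lt i.2 j.2
  exact Finset.dvd_prod_of_mem _ (Finset.mem_range.mpr (by omega))

theorem den_weight_dvd (i : Fin n) : (w i).den ∣ commonDen v w b := by
  rw [← (cell_weight v w b i).2]
  have := i.2
  exact Finset.dvd_prod_of_mem (fun t => cell v w b (2 * t + 3))
    (Finset.mem_range.mpr (by omega : n * m + i < 2 * (n * m) + n))

theorem cast_num_mul_div {q : ℚ≥0} {d : ℕ} (h : q.den ∣ d) :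
    ((q.num * (d / q.den) : ℕ) : ℝ) = d * (q : ℝ) := by
  have h0 : (q.den : ℝ) ≠ 0 := by exact_mod_cast q.den_ne_zero
  rw [Nat.cast_mul, Nat.cast_div h h0, NNRat.cast_def]
  ring

theorem cast_inputValue (i : Fin n) (j : Fin m) :
    (RAM.inputValue (cell v w b) (commonDen v w b) (i * m + j) : ℝ)
      = commonDen v w b * (v i j : ℝ) := by
  rw [RAM.inputValue, (cell_value v w b i j).1, (cell_value v w b i j).2]
  exact cast_num_mul_div (den_value_dvd v w b i j)

/-- The integral weight of an agent, without the scaling factor. -/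
def scaledWeight (i : ℕ) : ℕ :=
  cell v w b (2 * (n * m + i) + 2) * (commonDen v w b / cell v w b (2 * (n * m + i) + 3))

theorem cast_scaledWeight (i : Fin n) :
    (scaledWeight v w b i : ℝ) = commonDen v w b * (w i : ℝ) := by
  rw [scaledWeight, (cell_weight v w b i).1, (cell_weight v w b i).2]
  exact cast_num_mul_div (den_weight_dvd v w b i)

theorem inputWeight_eq (i : Fin n) : RAM.inputWeight (cell v w b) n m (commonDen v w b) i
    = (n + 1) ^ (m + 1) * scaledWeight v w b i := by
  rw [RAM.inputWeight, scaledWeight, (cell_weight v w b i).2,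
    Nat.mul_comm (commonDen v w b), Nat.mul_div_assoc _ (den_weight_dvd v w b i)]
  ring

theorem cell_edge_ne_zero (i : Fin n) (j : Fin m) :
    cell v w b (RAM.edgeCell n (n * m) (i * m + j)) ≠ 0 ↔ 0 < (b i j : ℝ) := by
  rw [(cell_edge v w b i j).1, NNRat.num_ne_zero, NNRat.cast_pos, pos_iff_ne_zero]

end Cells

end NashWelfare
namespace NashWelfare

/-! ### The guarantee for the output of the program -/

section Output

open RAM

variable {n m : ℕ} (v : Fin n → Fin m → ℚ≥0) (w : Fin n → ℚ≥0) (b : Fin n → Fin m → ℚ≥0)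

/-- The sum of all integral values. -/
def valueSum : ℕ := ∑ t ∈ Finset.range (n * m), inputValue (cell v w b) (commonDen v w b) t

/-- The matching problem of the instance. -/
def instanceParams : Params :=
  inputParams (cell v w b) n m (commonDen v w b) (valueSum v w b).size

/-- The number of neighbours of an item. -/
def itemDegree (j : ℕ) : ℕ := inputDegree (cell v w b) n m j

open Classical in
/-- The items with a single neighbour `i`. -/
noncomputable def soleItems (i : Fin n) : Finset (Fin m) :=
  Finset.univ.filter fun j => 0 < (b i j : ℝ) ∧ ¬ 2 ≤ itemDegree v w b j

/-- The matching of the instance that is given by a function on natural numbers. -/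
def toMatching (M : ℕ → Option ℕ) (i : Fin n) : Option (Fin m) :=
  (M i).bind fun j => if h : j < m then some ⟨j, h⟩ else none

/-- The function on natural numbers that is given by a matching of the instance. -/
def ofMatching (M : Fin n → Option (Fin m)) (i : ℕ) : Option ℕ :=
  if h : i < n then (M ⟨i, h⟩).map Fin.val else none

theorem toMatching_eq_some {M : ℕ → Option ℕ} {i : Fin n} {j : Fin m} :
    toMatching M i = some j ↔ M i = some (j : ℕ) := by
  rw [toMatching, Option.bind_eq_some_iff]
  constructor
  · rintro ⟨k, hk, h⟩
    split_ifs at h with hkm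
    rw [hk, ← Option.some.inj h]
  · intro h
    exact ⟨j, h, by simp⟩

theorem ofMatching_eq_some {M : Fin n → Option (Fin m)} {i j : ℕ} :
    ofMatching M i = some j ↔ ∃ (hi : i < n) (hj : j < m), M ⟨i, hi⟩ = some ⟨j, hj⟩ := by
  rw [ofMatching]
  split_ifs with h
  · rw [Option.map_eq_some_iff]
    constructor
    · rintro ⟨k, hk, rfl⟩
      exact ⟨h, k.2, hk⟩
    · rintro ⟨_, hj, hij⟩
      exact ⟨_, hij, rfl⟩
  · simp [h]

theorem toMatching_ofMatching (M : Fin n → Option (Fin m)) : toMatching (ofMatching M) = M := by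
  funext i
  ext j
  rw [toMatching_eq_some, ofMatching_eq_some]
  exact ⟨fun ⟨_, _, h⟩ => h, fun h => ⟨i.2, j.2, h⟩⟩

theorem two_le_itemDegree {j : Fin m} :
    2 ≤ itemDegree v w b j ↔ ∃ i i' : Fin n, i ≠ i' ∧ 0 < (b i j : ℝ) ∧ 0 < (b i' j : ℝ) := by
  rw [itemDegree, inputDegree, Nat.succ_le_iff, Finset.one_lt_card]
  simp only [Finset.mem_filter, Finset.mem_range]
  constructor
  · rintro ⟨i, ⟨hi, h⟩, i', ⟨hi', h'⟩, hne⟩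
    refine ⟨⟨i, hi⟩, ⟨i', hi'⟩, fun h => hne (congrArg Fin.val h), ?_, ?_⟩
    · exact (cell_edge_ne_zero v w b ⟨i, hi⟩ j).mp h
    · exact (cell_edge_ne_zero v w b ⟨i', hi'⟩ j).mp h'
  · rintro ⟨i, i', hne, h, h'⟩
    exact ⟨i, ⟨i.2, (cell_edge_ne_zero v w b i j).mpr h⟩, i',
      ⟨i'.2, (cell_edge_ne_zero v w b i' j).mpr h'⟩, fun h => hne (Fin.ext h)⟩

theorem instanceParams_edge {i : Fin n} {j : Fin m} :
    (instanceParams v w b).edge (i * m + j) ≠ 0 ↔ 0 < (b i j : ℝ) ∧ 2 ≤ itemDegree v w b j := by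
  simp only [instanceParams, inputParams, mul_add_mod j.2, ← cell_edge_ne_zero v w b i j,
    itemDegree]
  split_ifs with h
  · simpa using h
  · simpa using h

theorem instanceParams_isCoded :
    (instanceParams v w b).IsCoded ((n + 1) ^ (m + 1)) (scaledWeight v w b) where
  base_eq := rfl
  weight i hi := inputWeight_eq v w b ⟨i, hi⟩
  huge := rfl
  code i _ j hj := by
    have hj' : j < m := hj
    simp only [instanceParams, inputParams, mul_add_mod hj', mul_add_div hj']

theorem cast_total {M : ℕ → Option ℕ} (hM : IsMatching m (instanceParams v w b).Adj M)
    (i : Fin n) : ((instanceParams v w b).total M i : ℝ) = commonDen v w b *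
      ((toMatching M i).elim 0 (fun j => (v i j : ℝ)) + ∑ j ∈ soleItems v w b i, (v i j : ℝ)) := by
  have h1 : ((instanceParams v w b).base i : ℝ)
      = commonDen v w b * ∑ j ∈ soleItems v w b i, (v i j : ℝ) := by
    have hbase : (instanceParams v w b).base i = ∑ j ∈ Finset.range m,
        if cell v w b (edgeCell n (n * m) (i * m + j)) ≠ 0 ∧ ¬ 2 ≤ itemDegree v w b j
          then inputValue (cell v w b) (commonDen v w b) (i * m + j) else 0 := rfl
    rw [hbase, Finset.sum_range, Nat.cast_sum, Finset.mul_sum, soleItems, Finset.sum_filter]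
    refine Finset.sum_congr rfl fun j _ => ?_
    by_cases hij : 0 < (b i j : ℝ) ∧ ¬ 2 ≤ itemDegree v w b j
    · rw [if_pos hij, if_pos ⟨(cell_edge_ne_zero v w b i j).mpr hij.1, hij.2⟩]
      exact cast_inputValue v w b i j
    · rw [if_neg hij, if_neg fun h => hij ⟨(cell_edge_ne_zero v w b i j).mp h.1, h.2⟩]
      exact Nat.cast_zero
  rw [Params.total, Nat.cast_add, h1, mul_add, add_comm]
  congr 1
  rcases h : M i with _ | j
  · simp [toMatching, h]
  · have hj := (hM.1 i j h).1
    have h' : toMatching M i = some (⟨j, hj⟩ : Fin m) := toMatching_eq_some.mpr h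
    rw [h', Option.elim_some, Option.elim_some]
    exact cast_inputValue v w b i ⟨j, hj⟩

theorem total_le {M : ℕ → Option ℕ} (hM : IsMatching m (instanceParams v w b).Adj M)
    (i : Fin n) : (instanceParams v w b).total M i ≤ valueSum v w b := by
  set f := inputValue (cell v w b) (commonDen v w b) with hf
  have hrow : ∑ j ∈ Finset.range m, f (i * m + j) ≤ valueSum v w b := by
    have h1 : ((i : ℕ) + 1) * m ≤ n * m := Nat.mul_le_mul_right m i.2
    have h2 := Finset.sum_Ico_eq_sum_range f (i * m) ((i + 1) * m)
    rw [show ((i : ℕ) + 1) * m - i * m = m by rw [add_mul, one_mul]; omega] at h2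
    rw [← h2, valueSum]
    refine Finset.sum_le_sum_of_subset fun t ht => ?_
    rw [Finset.mem_Ico] at ht
    exact Finset.mem_range.mpr (by omega)
  refine le_trans ?_ hrow
  have hbase : (instanceParams v w b).base i = ∑ j ∈ Finset.range m,
      if cell v w b (edgeCell n (n * m) (i * m + j)) ≠ 0 ∧ ¬ 2 ≤ itemDegree v w b j
        then f (i * m + j) else 0 := rfl
  rw [Params.total, hbase]
  rcases h : M i with _ | j
  · rw [Option.elim_none, add_zero]
    refine Finset.sum_le_sum fun j _ => ?_
    split_ifs <;> omega
  · obtain ⟨hj, hadj⟩ := hM.1 i j h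
    have hdeg : 2 ≤ itemDegree v w b j :=
      ((instanceParams_edge v w b (i := i) (j := ⟨j, hj⟩)).mp hadj).2
    rw [Option.elim_some, ← Finset.sum_erase_add _ _ (Finset.mem_range.mpr hj),
      ← Finset.sum_erase_add (Finset.range m) (fun j => f (i * m + j)) (Finset.mem_range.mpr hj),
      if_neg fun h => h.2 hdeg, add_zero]
    refine Nat.add_le_add_right (Finset.sum_le_sum fun j _ => ?_) _
    split_ifs <;> omega

theorem min_size_total {M : ℕ → Option ℕ} (hM : IsMatching m (instanceParams v w b).Adj M)
    (i : Fin n) : min (instanceParams v w b).len ((instanceParams v w b).total M i).size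
      = ((instanceParams v w b).total M i).size :=
  min_eq_right (Nat.size_le_size (total_le v w b hM i))

/-- In a forest, some agent of every set shares at most one item with the others. -/
theorem exists_card_sharedItems_le_one
    (hacyc : (supportGraph fun i j => (b i j : ℝ)).IsAcyclic) {U : Finset ℕ}
    (hU : U ⊆ Finset.range n) (hne : U.Nonempty) :
    ∃ i ∈ U, ((instanceParams v w b).sharedItems U i).card ≤ 1 := by
  obtain ⟨root, hroot⟩ := exists_isRooting (supportGraph fun i j => (b i j : ℝ))
  have hlt : ∀ i ∈ U, i < n := fun i hi => Finset.mem_range.mp (hU hi)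
  obtain ⟨i, hi, hmax⟩ := Finset.exists_max_image U (fun i => if h : i < n then
    agentDepth (supportGraph fun i j => (b i j : ℝ)) root ⟨i, h⟩ else 0) hne
  refine ⟨i, hi, Finset.card_le_one.mpr ?_⟩
  have key : ∀ j ∈ (instanceParams v w b).sharedItems U i, ∃ hj : j < m,
      IsAgentChild (supportGraph fun i j => (b i j : ℝ)) root ⟨j, hj⟩ ⟨i, hlt i hi⟩ := by
    intro j hj
    rw [Params.sharedItems, Finset.mem_filter] at hj
    have hjm : j < m := Finset.mem_range.mp hj.1
    refine ⟨hjm, ?_⟩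
    have hij := (instanceParams_edge v w b (i := ⟨i, hlt i hi⟩) (j := ⟨j, hjm⟩)).mp hj.2.1
    obtain ⟨i', hi', hne', hij'⟩ : ∃ i' ∈ U, i' ≠ i ∧
        (instanceParams v w b).edge (i' * m + j) ≠ 0 := by
      by_contra hcon
      push Not at hcon
      have h2 := hj.2.2
      rw [Params.count, ← Finset.add_sum_erase _ _ hi, Finset.sum_eq_zero] at h2
      · have : (instanceParams v w b).edge (i * (instanceParams v w b).m + j) ≤ 1 := by
          simp only [instanceParams, inputParams]
          split_ifs <;> omega
        omega
      · intro k hk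
        exact hcon k (Finset.mem_of_mem_erase hk) (Finset.ne_of_mem_erase hk)
    have hij'' := (instanceParams_edge v w b (i := ⟨i', hlt i' hi'⟩) (j := ⟨j, hjm⟩)).mp hij'
    rcases isItemChild_or_isAgentChild hacyc hroot hij.1 with h1 | h1
    · rcases isItemChild_or_isAgentChild hacyc hroot hij''.1 with h2 | h2
      · exact absurd (congrArg Fin.val (h2.unique hacyc hroot h1)) hne'
      · have h3 := h1.depth_lt hroot h2
        have h4 := hmax i' hi'
        simp only [hlt i hi, hlt i' hi', dif_pos] at h4
        omega
    · exact h1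
  intro j hj j' hj'
  obtain ⟨hjm, h1⟩ := key j hj
  obtain ⟨hjm', h2⟩ := key j' hj'
  exact congrArg Fin.val (h1.unique hacyc hroot h2)

theorem isMatching_ofMatching {M : Fin n → Option (Fin m)}
    (hM : ∀ i j, M i = some j → 0 < (b i j : ℝ) ∧ 2 ≤ itemDegree v w b j)
    (hinj : ∀ i i' j, M i = some j → M i' = some j → i = i') :
    IsMatching m (instanceParams v w b).Adj (ofMatching M) := by
  constructor
  · intro i j h
    obtain ⟨hi, hj, hij⟩ := ofMatching_eq_some.mp h
    exact ⟨hj, (instanceParams_edge v w b (i := ⟨i, hi⟩) (j := ⟨j, hj⟩)).mpr (hM _ _ hij)⟩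
  · intro i i' j h h'
    obtain ⟨hi, hj, hij⟩ := ofMatching_eq_some.mp h
    obtain ⟨hi', hj', hij'⟩ := ofMatching_eq_some.mp h'
    exact congrArg Fin.val (hinj _ _ _ hij hij')

/-- The matching with the largest earnings satisfies the guarantee. -/
theorem matching_ge (hw1 : ∑ i, w i = 1)
    (hb : (fun i j => (b i j : ℝ)) ∈ feasible (Fin n) (Fin m))
    (hacyc : (supportGraph fun i j => (b i j : ℝ)).IsAcyclic)
    (hfin : ∀ i j, 0 < (w i : ℝ) * b i j → 0 < (v i j : ℝ)) {M : ℕ → Option ℕ}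
    (hM : IsMatching m (instanceParams v w b).Adj M)
    (hopt : ∀ M', IsMatching m (instanceParams v w b).Adj M' →
      ∑ i ∈ Finset.range n, earning (instanceParams v w b).single (instanceParams v w b).paired i
        (M' i) ≤ ∑ i ∈ Finset.range n, earning (instanceParams v w b).single
        (instanceParams v w b).paired i (M i)) :
    ((realObjective (fun i j => (v i j : ℝ)) (fun i => (w i : ℝ)) (fun i j => (b i j : ℝ))
      - (klUniform (fun i => (w i : ℝ)) + 2 * Real.log 2) : ℝ) : EReal)
      ≤ ∑ i, ((w i : ℝ) : EReal) * elog ((toMatching M i).elim 0 (fun j => (v i j : ℝ))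
        + ∑ j ∈ soleItems v w b i, (v i j : ℝ)) := by
  classical
  have hw1' : ∑ i, (w i : ℝ) = 1 := by exact_mod_cast hw1
  have hne : Nonempty (Fin n) := by
    by_contra hcon
    rw [not_nonempty_iff] at hcon
    simp at hw1
  obtain ⟨root, hroot⟩ := exists_isRooting (supportGraph fun i j => (b i j : ℝ))
  have hcard : (Finset.univ.filter fun j : Fin m => 2 ≤ itemDegree v w b j).card
      ≤ Fintype.card (Fin n) := by
    refine card_le_of_agentChild hacyc hroot _ fun j hj => ?_
    obtain ⟨i, i', hii, h, h'⟩ := (two_le_itemDegree v w b).mp (Finset.mem_filter.mp hj).2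
    exact exists_agentChild_of_two hacyc hroot hii h h'
  obtain ⟨M₀, h1, h2, h3, h4⟩ := exists_matching_log_ge (fun i j => (v i j : ℝ))
    (fun i => (w i : ℝ)) (fun i j => (b i j : ℝ)) (fun i j => (b i j : ℝ)) 1
    (Finset.univ.filter fun j : Fin m => 2 ≤ itemDegree v w b j) (soleItems v w b)
    (fun i j => NNRat.cast_nonneg _) (fun i => NNRat.cast_nonneg _) hw1'
    (fun i j => NNRat.cast_nonneg _) (fun i j => NNRat.cast_nonneg _) one_pos
    (fun i j => (one_mul _).ge) hb.2.1 (fun j _ => hb.2.2 j) hcard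
    (fun i j hij => by
      by_cases hj : 2 ≤ itemDegree v w b j
      · exact Or.inl (by simpa using hj)
      · exact Or.inr (by simpa [soleItems] using ⟨by simpa using hij, by simpa using hj⟩))
    (fun i j hj hj' => by
      rw [soleItems, Finset.mem_filter] at hj
      exact hj.2.2 (Finset.mem_filter.mp hj').2)
    (fun i j hi hij => hfin i j (mul_pos hi hij))
  have hM₀ := isMatching_ofMatching v w b (fun i j h => ⟨(h1 i j h).1,
    (Finset.mem_filter.mp (h1 i j h).2).2⟩) h2
  have hd : (0 : ℝ) < commonDen v w b := by exact_mod_cast commonDen_pos v w b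
  have ht := cast_total v w b hM
  have ht₀ := cast_total v w b hM₀
  rw [toMatching_ofMatching] at ht₀
  have hpos₀ : ∀ i : Fin n, 0 < (w i : ℝ) →
      (instanceParams v w b).total (ofMatching M₀) i ≠ 0 := by
    intro i hi h0
    have := ht₀ i
    rw [h0, Nat.cast_zero] at this
    exact (mul_pos hd (h3 i hi)).ne this
  have hweight : ∀ i : Fin n, (instanceParams v w b).weight i ≠ 0 ↔ 0 < (w i : ℝ) := by
    intro i
    rw [(instanceParams_isCoded v w b).weight i i.2, ← pos_iff_ne_zero,
      Nat.mul_pos_iff_of_pos_left (by positivity), ← Nat.cast_pos (α := ℝ), cast_scaledWeight,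
      mul_pos_iff_of_pos_left hd]
  obtain ⟨g1, g2⟩ := Params.optimal (instanceParams_isCoded v w b) hM hM₀ (hopt _ hM₀)
    fun i hi hwi => hpos₀ ⟨i, hi⟩ ((hweight ⟨i, hi⟩).mp hwi)
  have hpos : ∀ i : Fin n, 0 < (w i : ℝ) → (instanceParams v w b).total M i ≠ 0 :=
    fun i hi => g1 i i.2 ((hweight i).mpr hi)
  have hsum : ∀ M : ℕ → Option ℕ, IsMatching m (instanceParams v w b).Adj M →
      ((∑ i ∈ Finset.range n, scaledWeight v w b i * min (instanceParams v w b).len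
        ((instanceParams v w b).total M i).size : ℕ) : ℝ)
      = commonDen v w b * ∑ i : Fin n, (w i : ℝ) * (((instanceParams v w b).total M i).size : ℝ) := by
    intro M hM
    rw [Finset.sum_range, Nat.cast_sum, Finset.mul_sum]
    refine Finset.sum_congr rfl fun i _ => ?_
    rw [min_size_total v w b hM, Nat.cast_mul, cast_scaledWeight, mul_assoc]
  have hsize : ∑ i : Fin n, (w i : ℝ) * (((instanceParams v w b).total (ofMatching M₀) i).size : ℝ)
      ≤ ∑ i : Fin n, (w i : ℝ) * (((instanceParams v w b).total M i).size : ℝ) := by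
    have := (Nat.cast_le (α := ℝ)).mpr g2
    rw [show (instanceParams v w b).n = n from rfl, hsum _ hM, hsum _ hM₀] at this
    exact le_of_mul_le_mul_left this hd
  have hlog := sum_log_ge_of_size hd (fun i => NNRat.cast_nonneg (w i)) hw1' ht ht₀ hpos hpos₀ hsize
  rw [sum_mul_elog (fun i => NNRat.cast_nonneg _), EReal.coe_le_coe_iff, realObjective_eq,
    klUniform_eq hw1']
  · have hn : (Fintype.card (Fin n) : ℝ) ≠ 0 := by exact_mod_cast Fintype.card_ne_zero
    rw [mul_one, Real.log_mul two_ne_zero hn] at h4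
    linarith
  · intro i hi
    have h0 : (0 : ℝ) < (instanceParams v w b).total M i := by
      exact_mod_cast Nat.pos_of_ne_zero (hpos i hi)
    rw [ht i] at h0
    exact (mul_pos_iff_of_pos_left hd).mp h0

theorem guarantee_of_tables (hw1 : ∑ i, w i = 1)
    (hb : (fun i j => (b i j : ℝ)) ∈ feasible (Fin n) (Fin m))
    (hacyc : (supportGraph fun i j => (b i j : ℝ)).IsAcyclic) {C D own : ℕ → ℕ}
    (hT : TableInv n m (instanceParams v w b).Adj (instanceParams v w b).single
      (instanceParams v w b).paired ∅ C D)
    (hown : ∀ j : Fin m, ∀ i < n, cell v w b (edgeCell n (n * m) (i * m + j)) ≠ 0 →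
      cell v w b (edgeCell n (n * m) (own j * m + j)) ≠ 0) (σ : Fin m → Fin n)
    (hσ : ∀ j : Fin m, (σ j : ℕ) = if 2 ≤ itemDegree v w b j then
      C m / (n + 1) ^ (j : ℕ) % (n + 1) - 1 else own j) :
    Guarantee (fun i j => (v i j : ℝ)) (fun i => (w i : ℝ)) (fun i j => (b i j : ℝ)) σ := by
  obtain ⟨⟨M, hM, hMn, hMsum⟩, hopt⟩ := hT.final
  have hv : ∀ i j, (0 : ℝ) ≤ v i j := fun i j => NNRat.cast_nonneg _
  have hw : ∀ i, (0 : ℝ) ≤ w i := fun i => NNRat.cast_nonneg _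
  by_cases hfin : ∀ i j, 0 < (w i : ℝ) * b i j → 0 < (v i j : ℝ)
  · have hge := matching_ge v w b hw1 hb hacyc hfin hM fun M' hM' => by
      rw [hMsum]
      exact hopt M' hM'
    have hdeg : ∀ {i : Fin n} {j : Fin m}, toMatching M i = some j →
        2 ≤ itemDegree v w b j := fun {i j} h => ((instanceParams_edge v w b).mp
          (hM.1 i j (toMatching_eq_some.mp h)).2).2
    have hNSW := sum_elog_le_NSW (σ := σ) hv hw (fun i => (soleItems v w b i : Set (Fin m)))
      (toMatching M) ?_ ?_ ?_
    · classical
      simp only [sum_indicator_eq, Finset.mem_coe, Finset.filter_univ_mem] at hNSW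
      rw [Guarantee, fcvx_eq_coe hw (fun i j => NNRat.cast_nonneg _) hfin]
      refine le_trans ?_ (hge.trans hNSW)
      rw [← EReal.coe_sub, EReal.coe_le_coe_iff]
      have : 0 < 1 / (2 * Real.exp 1) := by positivity
      linarith
    · intro i j hj
      rw [Finset.mem_coe, soleItems, Finset.mem_filter] at hj
      have h1 := hσ j
      rw [if_neg hj.2.2] at h1
      have h2 := hown j i i.2 ((cell_edge_ne_zero v w b i j).mpr hj.2.1)
      rw [← h1, cell_edge_ne_zero] at h2
      by_contra hne
      exact hj.2.2 ((two_le_itemDegree v w b).mpr ⟨_, _, hne, h2, hj.2.1⟩)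
    · intro i j hij
      have h1 := hσ j
      have h2 := Params.decode (instanceParams_isCoded v w b) hM j.2
      rw [show (instanceParams v w b).n = n from rfl, hMsum,
        Params.digit_eq hM i.2 (toMatching_eq_some.mp hij)] at h2
      rw [if_pos (hdeg hij), h2] at h1
      exact Fin.ext h1
    · intro i j hij hj
      rw [Finset.mem_coe, soleItems, Finset.mem_filter] at hj
      exact hj.2.2 (hdeg hij)
  · rw [Guarantee, fcvx_eq_bot hv hfin, EReal.bot_sub]
    exact bot_le

end Output

end NashWelfare
theorem mainTheorem2 :
    -- the exact algorithm: it has an output, and every output satisfies the guarantee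
    (∀ (A G : Type*) [Fintype A] [Fintype G] (v : A → G → ℝ) (w : A → ℝ) (b : A → G → ℝ),
      (∀ i j, 0 ≤ v i j) → (∀ i, 0 ≤ w i) → ∑ i, w i = 1 →
      b ∈ NashWelfare.feasible A G → (NashWelfare.supportGraph b).IsAcyclic →
      (∃ σ, NashWelfare.IsRoundingOutput v w b σ) ∧
      ∀ σ, NashWelfare.IsRoundingOutput v w b σ → NashWelfare.Guarantee v w b σ) ∧
    -- polynomial time: one deterministic program reaches the guarantee on all rational inputs,
    -- in a number of steps bounded by a polynomial in the bit length of the input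
    (∃ (P : NashWelfare.RAM.Prog) (p : Polynomial ℕ),
      ∀ (n m : ℕ) (v : Fin n → Fin m → ℚ≥0) (w : Fin n → ℚ≥0) (b : Fin n → Fin m → ℚ≥0),
      ∑ i, w i = 1 →
      (fun i j => (b i j : ℝ)) ∈ NashWelfare.feasible (Fin n) (Fin m) →
      (NashWelfare.supportGraph fun i j => (b i j : ℝ)).IsAcyclic →
      ∃ (M : NashWelfare.RAM.Memory) (t : ℕ) (σ : Fin m → Fin n),
        NashWelfare.RAM.Runs P (NashWelfare.RAM.initial (NashWelfare.encodeInput v w b)) M t ∧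
        t ≤ p.eval (NashWelfare.RAM.inputSize (NashWelfare.encodeInput v w b)) ∧
        (∀ j : Fin m, M j = σ j) ∧
        NashWelfare.Guarantee (fun i j => (v i j : ℝ)) (fun i => (w i : ℝ))
          (fun i j => (b i j : ℝ)) σ) := by
  open NashWelfare NashWelfare.RAM in
  refine ⟨?_, ?_⟩
  · intro A G _ _ v w b hv hw hw1 hb hacyc
    have hne : Nonempty A := by
      by_contra hcon
      rw [not_nonempty_iff] at hcon
      simp at hw1
    exact ⟨exists_isRoundingOutput hv hw hb, fun σ => IsRoundingOutput.guarantee hv hw hw1 hb hacyc⟩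
  · obtain ⟨p, hp⟩ := exists_runs_mainProg
    refine ⟨mainProg, p, fun n m v w b hw1 hb hacyc => ?_⟩
    have hn : 0 < n := by
      rcases Nat.eq_zero_or_pos n with rfl | h
      · simp at hw1
      · exact h
    obtain ⟨S, M, t, hrun, ht, hS, hM⟩ := hp (encodeInput v w b) n m hn rfl rfl
      (length_encodeInput v w b)
    have hI : 2 * (2 * (n * m) + n) + 2 ≤ cell v w b 0 := by
      have : cell v w b 0 = (encodeInput v w b).length := rfl
      rw [this, length_encodeInput]
      omega
    obtain ⟨C, D, own, hT, hown, hout⟩ := phaseB_spec hS.agents hS.items hS.pairs hS.succ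
      hS.length hS.den hS.value hS.low hS.high hI
      fun U hU hUne => exists_card_sharedItems_le_one v w b hacyc hU hUne
    have hlt : ∀ j : Fin m, (if 2 ≤ itemDegree v w b j then
        C m / (n + 1) ^ (j : ℕ) % (n + 1) - 1 else own j) < n := by
      intro j
      split_ifs
      · have := Nat.mod_lt (C m / (n + 1) ^ (j : ℕ)) (show 0 < n + 1 by omega)
        omega
      · exact (hown j j.2).1 hn
    exact ⟨M, t, fun j => ⟨_, hlt j⟩, hrun, ht, fun j => (hM j j.2).trans (hout j j.2),
      guarantee_of_tables v w b hw1 hb hacyc hT (fun j => (hown j j.2).2) _ fun j => rfl⟩
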